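/- Let $0<p<1$ and $\alpha=2-p$. Consider the two-type (red/blue) continuous-time branching process $\mathsf{BP}(t)$ started at time $0$ from one red vertex, in which no vertex dies, each vertex, independently of the others, gives birth at rate one plus the current number of its blue children, and each newborn is independently red with probability $p$ and blue with probability $1-p$. Let $\sigma_v$ be the birth time of $v$, let $|\mathsf{BP}(t)|$ be the number of vertices born by time $t$ and $B(t)$ the number of blue ones among them. Let $v_1,v_2,\dots$ be the vertices in order of birth, let $\zeta_{v,1}<\zeta_{v,2}<\cdots$ be the ages of $v$ at the births of its children, and define the reproduction martingale by $$\tilde R_0=1,\qquad \tilde R_{m+1}=\tilde R_m+e^{-\alpha\sigma_{v_{m+1}}}\Big(\sum_{j\ge1}e^{-\alpha\zeta_{v_{m+1},j}}-1\Big).$$ A bounded characteristic is a jointly measurable process $\phi=(\phi(t))_{t\ge0}$ with $0\le\phi\le C$ for a non-random constant $C$ and with almost surely right-continuous paths, which is a function of the offspring process (birth times and colours of the children) of a single vertex; let $\phi^v$ be the same function of the offspring process of $v$, and let $$Z_\phi(t)=\sum_{v\in\mathsf{BP}(t)}\phi^v(t-\sigma_v),\qquad \tilde m_\phi(\infty)=\int_0^\infty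 e^{-\alpha s}\,\mathbb E[\phi(s)]\,ds .$$ (Decomposing at the first vertex, every such $\phi$ satisfies the branching recursion $Z_\phi(t)=\phi^{v_1}(t)+\sum_{i:\,\zeta_{v_1,i}\le t}Z^{(i)}_\phi(t-\zeta_{v_1,i})$, where the $Z_\phi^{(i)}$, the processes counted in the subtrees of the children of $v_1$, are independent copies of $Z_\phi$.) Then, almost surely, all these objects are well defined: $\mathsf{BP}(t)$ is finite for every $t$, the birth times are distinct, and the sums $\sum_j e^{-\alpha\zeta_{v,j}}$ converge. There is a real random variable $R_\infty$ such that: 1. $\tilde R_m\to R_\infty$ almost surely as $m\to\infty$; 2. for every bounded characteristic $\phi$, $e^{-\alpha t}Z_\phi(t)\to\tilde m_\phi(\infty)\,R_\infty$ almost surely as $t\to\infty$; 3. $e^{-\alpha t}\big(|\mathsf{BP}(t)|+B(t)\big)\to R_\infty$ almost surely as $t\to\infty$, that is, $R_\infty$ is the almost sure limit of this martingale. -/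

import Mathlib

open MeasureTheory ProbabilityTheory Filter Topology

noncomputable section

namespace SuperstarBP

/-- Ulam–Harris labels: `[]` is the progenitor, and `j :: v` is the `j`-th child
(counted from `0`) of the vertex `v`. -/
abbrev Vertex : Type := List ℕ

/-- The offspring process of one vertex: the `j`-th entry is the age of the mother at the birth
of her `j`-th child, and the colour of that child (`true` is blue, `false` is red). -/
abbrev Offspring : Type := ℕ → ℝ × Bool

/-- The law of a colour: red with probability `p`, blue with probability `1 - p`. -/
def colourLaw (p : ℝ) : Measure Bool :=
  ENNReal.ofReal p • Measure.dirac false + ENNReal.ofReal (1 - p) • Measure.dirac true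

/-- The number of blue children among the first `k` children, read off from the colours. -/
def blueAmong (ω : ℕ → ℝ × Bool) (k : ℕ) : ℕ :=
  ((Finset.range k).filter fun j => (ω j).2 = true).card

/-- The offspring process driven by the clocks `(ω k).1` and the colours `(ω k).2`: when `k`
children have been born, `b` of them blue, the mother gives birth at rate `b + 1`, so that she
waits `(ω k).1 / (b + 1)` for the next child, where `(ω k).1` is a standard exponential clock. -/
def offspringOfClocks (ω : ℕ → ℝ × Bool) : Offspring := fun n =>
  (∑ k ∈ Finset.range (n + 1), (ω k).1 / ((blueAmong ω k : ℝ) + 1), (ω n).2)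

/-- The law of the offspring process of a vertex: births at rate (number of blue children) `+ 1`,
each child being independently red with probability `p` and blue with probability `1 - p`. -/
def offspringLaw (p : ℝ) : Measure Offspring :=
  (Measure.infinitePi fun _ : ℕ => (expMeasure 1).prod (colourLaw p)).map offspringOfClocks

/-- The family `ξ` of offspring processes drives the two-type branching process with
parameter `p`: the offspring processes of the vertices are independent with law
`offspringLaw p`. -/
structure IsBranchingProcess {Ω : Type*} [MeasurableSpace Ω] (μ : Measure Ω) (p : ℝ)
    (ξ : Vertex → Ω → Offspring) : Prop where
  measurable : ∀ v, Measurable (ξ v)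
  law : ∀ v, μ.map (ξ v) = offspringLaw p
  indep : iIndepFun ξ μ

/-! Below, `x : Vertex → Offspring` is one realization of the offspring processes of all
vertices. -/

/-- The birth time `σ_v` of a vertex. -/
def birthTime (x : Vertex → Offspring) : Vertex → ℝ
  | [] => 0
  | j :: v => birthTime x v + (x v j).1

/-- Whether a vertex is blue; the progenitor is red. -/
def isBlue (x : Vertex → Offspring) : Vertex → Bool
  | [] => false
  | j :: v => (x v j).2

/-- The vertices of `BP(t)`: those born by time `t`. -/
def population (x : Vertex → Offspring) (t : ℝ) : Set Vertex := {v | birthTime x v ≤ t}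

/-- The blue vertices of `BP(t)`. -/
def bluePopulation (x : Vertex → Offspring) (t : ℝ) : Set Vertex :=
  {v ∈ population x t | isBlue x v = true}

/-- `Z_φ(t)`, the sum of `φ^v(t - σ_v)` over the vertices `v` of `BP(t)`. -/
def countedProcess (φ : Offspring → ℝ → ℝ) (x : Vertex → Offspring) (t : ℝ) : ℝ :=
  ∑' v : population x t, φ (x v) (t - birthTime x v)

/-- `M(t) = e^{-(2-p)t} (|BP(t)| + B(t))`. -/
def sizeMartingale (p : ℝ) (x : Vertex → Offspring) (t : ℝ) : ℝ :=
  Real.exp (-(2 - p) * t) * ((population x t).ncard + (bluePopulation x t).ncard)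

/-- `ξ_α`, the sum of `e^{-α ζ}` over the ages `ζ` at which children are born,
for `α = 2 - p`. -/
def discountedOffspring (p : ℝ) (o : Offspring) : ℝ := ∑' j, Real.exp (-(2 - p) * (o j).1)

/-- `nthBorn x m` is the vertex `v_{m+1}` in the order of birth `v_1, v_2, …`, that is, the one
before which exactly `m` vertices are born. -/
def nthBorn (x : Vertex → Offspring) (m : ℕ) : Vertex :=
  Classical.epsilon fun v => {w | birthTime x w < birthTime x v}.encard = m

/-- The reproduction martingale: `R_0 = 1` and
`R_{m+1} = R_m + e^{-α σ} (ξ_α - 1)`, where `σ` is the birth time of `v_{m+1}`, `ξ_α` is taken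
for the offspring process of `v_{m+1}`, and `α = 2 - p`. -/
def reproductionMartingale (p : ℝ) (x : Vertex → Offspring) : ℕ → ℝ
  | 0 => 1
  | m + 1 => reproductionMartingale p x m +
      Real.exp (-(2 - p) * birthTime x (nthBorn x m)) *
        (discountedOffspring p (x (nthBorn x m)) - 1)

/-- The almost sure properties which make the objects above meaningful for a realization: finite
populations, distinct birth times, and convergence of the sums `ξ_α`. -/
structure IsRegular (p : ℝ) (x : Vertex → Offspring) : Prop where
  finite : ∀ t, (population x t).Finite
  injective : Function.Injective (birthTime x)
  summable : ∀ v, Summable fun j => Real.exp (-(2 - p) * (x v j).1)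

/-- A bounded characteristic: a measurable, non-negative, bounded process on `[0, ∞)`, given as
a function of the offspring process of a single vertex, almost all of whose paths are
right-continuous. -/
structure IsBoundedCharacteristic (p : ℝ) (φ : Offspring → ℝ → ℝ) : Prop where
  measurable : Measurable (Function.uncurry φ)
  nonneg : ∀ o, ∀ t, 0 ≤ t → 0 ≤ φ o t
  bounded : ∃ C, ∀ o, ∀ t, 0 ≤ t → φ o t ≤ C
  rightContinuous : ∀ᵐ o ∂(offspringLaw p), ∀ t, 0 ≤ t → ContinuousWithinAt (φ o) (Set.Ici t) t

/-- `m̃_φ(∞) = ∫_0^∞ e^{-αs} E[φ(s)] ds` for `α = 2 - p`. -/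
def limitMean (p : ℝ) (φ : Offspring → ℝ → ℝ) : ℝ :=
  ∫ s in Set.Ioi (0 : ℝ), Real.exp (-(2 - p) * s) * ∫ o, φ o s ∂(offspringLaw p)

end SuperstarBP

end

/-! Put α = 2 - p and g = 3/2 - p. Each birth raises the birth rate of the mother by 1 - p on
average, so children are born with intensity e^{(1-p)s} ds (`lintegral_offspringLaw_tsum`).
Discounted by e^{-αs} this is e^{-s} ds: the renewal law is exponential, and the renewal equation
for the discounted mean is solved in closed form by m(u) = H(u) + ∫_0^u H with H(u) = e^{-αu}
E[φ(u)]. Thus m tends to m̃_φ(∞) exponentially fast (`IsDiscounted.lintegral_childSum`,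
`IsDiscounted.abs_renew_sub_le`).

The randomness is controlled in L². Every error is written as a sum over all vertices v of Φ(σ_v,
ξ_v), where Φ(s, ·) has mean zero for each s (`IsFluctuation`). Since σ_v depends only on the strict
ancestors of v, terms of different vertices are orthogonal. If |Φ(s, o)| ≤ κ e^{-gs} X(o), the
second moment of the sum is at most κ² E[X²] Σ_v E[e^{-2gσ_v}]. The last sum is a convergent
geometric series over the generations because 2g = 3 - 2p exceeds α, and E[X²] is finite by a
Lyapunov function for one offspring process (`lintegral_sq_tsum_le`). When κ decays geometrically
along a sequence of times, the sums tend to zero almost surely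
(`IsBranchingProcess.ae_tendsto_fluctuation`).

Let R_t be the reproduction martingale summed over the vertices born by time t (`reproAt`). The
method applies to the increments of R_t, which produces R_∞; to e^{-αt} Z_φ(t) - m(t) - m̃_φ(∞)(R_t
- 1), where the terms e^{-ασ_v} m(t - σ_v) telescope along the tree (`IsGood.tsum_charFluct`); and
to e^{-αt}(B - (1-p)|BP| + (1-p)), a sum of centred colours (`IsGood.tsum_blueFluct`). So all limits
hold along each lattice n/k. The characteristic 1 gives e^{-αt}|BP| → R_∞/α, and B ≈ (1-p)|BP| turns
this into the limit of |BP| + B.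

Continuous time is reached by letting k → ∞. The counts are monotone; R_t drops over a short
interval by at most the discounted number of births there; φ is bounded above by its supremum over
windows of length 1/k, and below by the same argument for C - φ. Finally, the discrete martingale
after m + 1 steps is R_t at the birth time of v_{m+1}. -/

noncomputable section

namespace SuperstarBP

open scoped ENNReal

/-! ### Independence of one member of a family from the others -/

section Independence

variable {Ω ι E : Type*} [MeasurableSpace E]

/-- The σ-algebra generated by all members of the family `X` except `X i`. -/
@[reducible] def awayFrom (X : ι → Ω → E) (i : ι) : MeasurableSpace Ω :=
  ⨆ u ∈ ({i}ᶜ : Set ι), MeasurableSpace.comap (X u) inferInstance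

theorem measurable_awayFrom {X : ι → Ω → E} {i u : ι} (h : u ≠ i) :
    Measurable[awayFrom X i] (X u) := by
  rw [measurable_iff_comap_le]
  exact le_iSup₂_of_le u h le_rfl

theorem awayFrom_le [MeasurableSpace Ω] {X : ι → Ω → E} (hX : ∀ i, Measurable (X i)) (i : ι) :
    awayFrom X i ≤ (inferInstance : MeasurableSpace Ω) :=
  iSup₂_le fun u _ => (hX u).comap_le

/-- Independence is grouped along the partition into `{i}` and its complement. It serves twice: for
the clocks of one vertex, and for the offspring processes of the tree. -/
theorem map_prodMk_of_awayFrom [MeasurableSpace Ω] {μ : Measure Ω}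
    [IsProbabilityMeasure μ] {S : Type*} [MeasurableSpace S]
    {X : ι → Ω → E} (hX : ∀ i, Measurable (X i)) (hind : iIndepFun X μ) {i : ι} {Y : Ω → S}
    (hY : Measurable[awayFrom X i] Y) :
    μ.map (fun ω => (Y ω, X i ω)) = (μ.map Y).prod (μ.map (X i)) := by
  have h1 := indep_iSup_of_disjoint (fun i => (hX i).comap_le) hind.iIndep
    (S := {i}ᶜ) (T := {i}) disjoint_compl_left
  have h2 : Indep (MeasurableSpace.comap Y inferInstance)
      (MeasurableSpace.comap (X i) inferInstance) μ := by
    refine indep_of_indep_of_le_right (indep_of_indep_of_le_left h1 ?_) ?_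
    · exact measurable_iff_comap_le.1 hY
    · exact le_iSup₂_of_le i rfl le_rfl
  have h3 : IndepFun Y (X i) μ := h2
  exact h3.map_prod_eq_prod_map_map (hY.mono (awayFrom_le hX i) le_rfl).aemeasurable
    (hX i).aemeasurable

theorem lintegral_awayFrom [MeasurableSpace Ω] {μ : Measure Ω}
    [IsProbabilityMeasure μ] {S : Type*} [MeasurableSpace S]
    {X : ι → Ω → E} (hX : ∀ i, Measurable (X i)) (hind : iIndepFun X μ) {i : ι} {Y : Ω → S}
    (hY : Measurable[awayFrom X i] Y) {f : S × E → ℝ≥0∞} (hf : Measurable f) :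
    ∫⁻ ω, f (Y ω, X i ω) ∂μ = ∫⁻ ω, ∫⁻ e, f (Y ω, e) ∂(μ.map (X i)) ∂μ := by
  have hY' : Measurable Y := hY.mono (awayFrom_le hX i) le_rfl
  have := Measure.isProbabilityMeasure_map (μ := μ) (hX i).aemeasurable
  rw [← lintegral_map (f := f) (g := fun ω => (Y ω, X i ω)) hf (hY'.prodMk (hX i)),
    map_prodMk_of_awayFrom hX hind hY, lintegral_prod _ hf.aemeasurable,
    lintegral_map hf.lintegral_prod_right' hY']

end Independence

/-! ### The exponential clock and the colour -/

theorem isProbabilityMeasure_colourLaw {p : ℝ} (h0 : 0 ≤ p) (h1 : p ≤ 1) :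
    IsProbabilityMeasure (colourLaw p) := by
  constructor
  simp [colourLaw, ← ENNReal.ofReal_add h0 (sub_nonneg.2 h1)]

theorem lintegral_colourLaw (p : ℝ) (f : Bool → ℝ≥0∞) :
    ∫⁻ c, f c ∂(colourLaw p) =
      ENNReal.ofReal p * f false + ENNReal.ofReal (1 - p) * f true := by
  simp [colourLaw, lintegral_add_measure, lintegral_smul_measure]

theorem lintegral_expMeasure_one {f : ℝ → ℝ≥0∞} (hf : Measurable f) :
    ∫⁻ x, f x ∂(expMeasure 1) = ∫⁻ x in Set.Ioi 0, ENNReal.ofReal (Real.exp (-x)) * f x := by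
  have hm : Measurable (exponentialPDF 1) := (measurable_exponentialPDFReal 1).ennreal_ofReal
  have : expMeasure 1 = volume.withDensity (exponentialPDF 1) := rfl
  rw [this, lintegral_withDensity_eq_lintegral_mul _ hm hf, ← lintegral_indicator measurableSet_Ioi]
  refine lintegral_congr_ae ?_
  have : ∀ᵐ x : ℝ, x ≠ 0 := by simp [ae_iff]
  filter_upwards [this] with x hx
  by_cases h : 0 < x
  · simp [Set.indicator, h, exponentialPDF_of_nonneg h.le]
  · have : x < 0 := lt_of_le_of_ne (not_lt.1 h) hx
    simp [Set.indicator, h, exponentialPDF_of_neg this]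

theorem lintegral_exp_Ioi {c : ℝ} (hc : 0 < c) (a : ℝ) :
    ∫⁻ x in Set.Ioi a, ENNReal.ofReal (Real.exp (-(c * x))) =
      ENNReal.ofReal (Real.exp (-(c * a)) / c) := by
  have h := integral_exp_mul_Ioi (a := -c) (by linarith) a
  have hi := integrableOn_exp_mul_Ioi (a := -c) (by linarith) a
  rw [← ofReal_integral_eq_lintegral_ofReal]
  · congr 1
    simp only [← neg_mul, h]
    ring
  · simpa only [neg_mul, IntegrableOn] using hi
  · exact Eventually.of_forall fun x => (Real.exp_pos _).le

theorem ae_expMeasure_pos : ∀ᵐ x ∂(expMeasure 1), 0 < x := by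
  rw [ae_iff]
  have hs : MeasurableSet {x : ℝ | ¬ 0 < x} := by measurability
  rw [← lintegral_indicator_one hs, lintegral_expMeasure_one (measurable_one.indicator hs)]
  rw [setLIntegral_congr_fun (g := fun _ => 0) measurableSet_Ioi, lintegral_zero]
  intro x hx
  simp [show 0 < x from hx]

/-- The law of one pair of a clock and a colour. -/
abbrev clockLaw (p : ℝ) : Measure (ℝ × Bool) := (expMeasure 1).prod (colourLaw p)

/-- The law of the clocks and the colours which drive one offspring process. -/
abbrev clocksLaw (p : ℝ) : Measure (ℕ → ℝ × Bool) := Measure.infinitePi fun _ => clockLaw p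

theorem isProbabilityMeasure_clockLaw {p : ℝ} (h0 : 0 ≤ p) (h1 : p ≤ 1) :
    IsProbabilityMeasure (clockLaw p) := by
  have := isProbabilityMeasure_colourLaw h0 h1
  have := isProbabilityMeasure_expMeasure one_pos
  infer_instance

theorem lintegral_clockLaw {p : ℝ} (h0 : 0 ≤ p) (h1 : p ≤ 1) {f : ℝ × Bool → ℝ≥0∞}
    (hf : Measurable f) :
    ∫⁻ x, f x ∂(clockLaw p) = ENNReal.ofReal p * ∫⁻ x, f (x, false) ∂(expMeasure 1) +
      ENNReal.ofReal (1 - p) * ∫⁻ x, f (x, true) ∂(expMeasure 1) := by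
  have := isProbabilityMeasure_colourLaw h0 h1
  have := isProbabilityMeasure_expMeasure one_pos
  rw [lintegral_prod _ hf.aemeasurable]
  simp only [lintegral_colourLaw]
  rw [lintegral_add_left (by fun_prop), lintegral_const_mul _ (by fun_prop),
    lintegral_const_mul _ (by fun_prop)]

/-! ### The births of the children of one vertex as a Markov chain -/

/-- The age of the mother at the birth of her `n`-th child (`0` for `n = 0`) and the number of
blue ones among her first `n` children. -/
def chain (ω : ℕ → ℝ × Bool) : ℕ → ℝ × ℕ
  | 0 => (0, 0)
  | n + 1 => ((chain ω n).1 + (ω n).1 / (((chain ω n).2 : ℝ) + 1),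
      (chain ω n).2 + if (ω n).2 = true then 1 else 0)

theorem chain_snd (ω : ℕ → ℝ × Bool) (n : ℕ) : (chain ω n).2 = blueAmong ω n := by
  induction n with
  | zero => simp [chain, blueAmong]
  | succ n ih =>
    simp only [chain, ih, blueAmong, Finset.range_add_one, Finset.filter_insert]
    split_ifs <;> simp

theorem chain_fst (ω : ℕ → ℝ × Bool) (n : ℕ) :
    (chain ω n).1 = ∑ k ∈ Finset.range n, (ω k).1 / ((blueAmong ω k : ℝ) + 1) := by
  induction n with
  | zero => simp [chain]
  | succ n ih => rw [Finset.sum_range_succ, ← ih, ← chain_snd]; rfl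

/-- Children are numbered from 0, so child `n` is born at step `n + 1` of the chain, while its
colour sits in entry `n`. -/
theorem offspringOfClocks_apply (ω : ℕ → ℝ × Bool) (n : ℕ) :
    offspringOfClocks ω n = ((chain ω (n + 1)).1, (ω n).2) := by
  rw [chain_fst]; rfl

theorem chain_snd_le (ω : ℕ → ℝ × Bool) (n : ℕ) : (chain ω n).2 ≤ n := by
  rw [chain_snd]
  exact (Finset.card_filter_le _ _).trans (by simp)

/-- One step of `chain`. -/
def chainStep (s : ℝ × ℕ) (x : ℝ × Bool) : ℝ × ℕ :=
  (s.1 + x.1 / ((s.2 : ℝ) + 1), s.2 + if x.2 = true then 1 else 0)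

theorem measurable_chainStep : Measurable fun y : (ℝ × ℕ) × (ℝ × Bool) => chainStep y.1 y.2 := by
  unfold chainStep
  have h : Measurable fun c : Bool => if c = true then (1:ℕ) else 0 := measurable_of_countable _
  have h2 : Measurable fun c : ℕ => (c : ℝ) := measurable_of_countable _
  have h3 : Measurable fun c : ℕ × ℕ => c.1 + c.2 := measurable_of_countable _
  refine Measurable.prodMk ?_ ?_
  · exact (measurable_fst.comp measurable_fst).add ((measurable_fst.comp measurable_snd).div
      ((h2.comp (measurable_snd.comp measurable_fst)).add_const 1))
  · exact h3.comp ((measurable_snd.comp measurable_fst).prodMk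
      (h.comp (measurable_snd.comp measurable_snd)))

theorem chain_succ (ω : ℕ → ℝ × Bool) (n : ℕ) : chain ω (n + 1) = chainStep (chain ω n) (ω n) :=
  rfl

/-- The coordinate process. -/
abbrev coord (i : ℕ) (ω : ℕ → ℝ × Bool) : ℝ × Bool := ω i

/-- The first `m` steps read only the entries below `m`, hence not entry `n`. -/
theorem measurable_chain_awayFrom {n m : ℕ} (h : m ≤ n) :
    Measurable[awayFrom coord n] fun ω => chain ω m := by
  induction m with
  | zero => exact measurable_const
  | succ m ih =>
    exact measurable_chainStep.comp ((ih (by omega)).prodMk (measurable_awayFrom (by omega)))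

theorem measurable_coord (i : ℕ) : Measurable (coord i) := measurable_pi_apply i

theorem measurable_chain (n : ℕ) : Measurable fun ω => chain ω n :=
  (measurable_chain_awayFrom le_rfl).mono (awayFrom_le measurable_coord n) le_rfl

/-- This is the Markov property of `chain`: entry `n` can be integrated out with the past frozen. -/
theorem lintegral_clocksLaw_coord {p : ℝ} (h0 : 0 ≤ p) (h1 : p ≤ 1) {S : Type*} [MeasurableSpace S] {n : ℕ}
    {Y : (ℕ → ℝ × Bool) → S} (hY : Measurable[awayFrom coord n] Y) {f : S × (ℝ × Bool) → ℝ≥0∞}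
    (hf : Measurable f) :
    ∫⁻ ω, f (Y ω, ω n) ∂(clocksLaw p) = ∫⁻ ω, ∫⁻ x, f (Y ω, x) ∂(clockLaw p) ∂(clocksLaw p) := by
  have := isProbabilityMeasure_clockLaw h0 h1
  have h := lintegral_awayFrom (μ := clocksLaw p) measurable_coord
    (iIndepFun_infinitePi (X := fun _ x => x) fun _ => measurable_id) hY hf
  have h2 : (clocksLaw p).map (coord n) = clockLaw p := Measure.infinitePi_map_eval _ n
  rw [h2] at h
  exact h

theorem ae_clocks_pos {p : ℝ} (h0 : 0 ≤ p) (h1 : p ≤ 1) : ∀ᵐ ω ∂(clocksLaw p), ∀ n, 0 < (ω n).1 := by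
  rw [ae_all_iff]
  intro n
  have := isProbabilityMeasure_clockLaw h0 h1
  have := isProbabilityMeasure_colourLaw h0 h1
  have := isProbabilityMeasure_expMeasure one_pos
  have h : ∀ᵐ x ∂(clockLaw p), 0 < x.1 :=
    Measure.quasiMeasurePreserving_fst.ae (p := fun x => 0 < x) ae_expMeasure_pos
  have h2 : (clocksLaw p).map (coord n) = clockLaw p := Measure.infinitePi_map_eval _ n
  rw [← h2] at h
  exact ae_of_ae_map (measurable_coord n).aemeasurable h

/-! ### The intensity of the births of the children of one vertex -/

/-- The exponential function with values in `ℝ≥0∞`. -/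
def expE (a : ℝ) : ℝ≥0∞ := ENNReal.ofReal (Real.exp a)

@[fun_prop]
theorem measurable_expE : Measurable expE := Real.measurable_exp.ennreal_ofReal

theorem expE_add (a b : ℝ) : expE (a + b) = expE a * expE b := by
  rw [expE, expE, expE, Real.exp_add, ENNReal.ofReal_mul (Real.exp_pos _).le]

theorem expE_ne_top (a : ℝ) : expE a ≠ ∞ := ENNReal.ofReal_ne_top

@[simp] theorem expE_zero : expE 0 = 1 := by simp [expE]

theorem expE_le_expE {a b : ℝ} (h : a ≤ b) : expE a ≤ expE b :=
  ENNReal.ofReal_le_ofReal (Real.exp_le_exp.2 h)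

theorem lintegral_Ioo_exp {c : ℝ} (hc : 0 < c) {w : ℝ} (hw : 0 ≤ w) :
    ∫⁻ r in Set.Ioo 0 w, ENNReal.ofReal c * expE (-(c * r)) = 1 - expE (-(c * w)) := by
  have h0 := lintegral_exp_Ioi hc 0
  have hw' := lintegral_exp_Ioi hc w
  have hd : Set.Ioi (0:ℝ) = Set.Ioc 0 w ∪ Set.Ioi w := (Set.Ioc_union_Ioi_eq_Ioi hw).symm
  rw [hd, lintegral_union measurableSet_Ioi (Set.disjoint_left.2 fun x hx hx' =>
    absurd hx.2 (not_le.2 hx')), hw', ← setLIntegral_congr Ioo_ae_eq_Ioc] at h0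
  rw [lintegral_const_mul _ (by fun_prop)]
  unfold expE
  have hc' : ENNReal.ofReal c ≠ 0 := (ENNReal.ofReal_pos.2 hc).ne'
  have h2 := congrArg (fun x => ENNReal.ofReal c * x) h0
  simp only [mul_add, ← ENNReal.ofReal_mul hc.le] at h2
  rw [mul_div_cancel₀ _ hc.ne', mul_div_cancel₀ _ hc.ne'] at h2
  simp only [mul_zero, neg_zero, Real.exp_zero, ENNReal.ofReal_one] at h2
  rw [← h2, ENNReal.add_sub_cancel_right ENNReal.ofReal_ne_top]

theorem lintegral_comp_mul_left_real {b : ℝ} (hb : 0 < b) {f : ℝ → ℝ≥0∞} (hf : Measurable f) :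
    ∫⁻ x, f x = ENNReal.ofReal b * ∫⁻ r, f (b * r) := by
  conv_lhs => rw [← Real.smul_map_volume_mul_left hb.ne']
  rw [lintegral_smul_measure, lintegral_map hf (measurable_const_mul b), abs_of_pos hb, smul_eq_mul]

theorem lintegral_expMeasure_div {b : ℝ} (hb : 0 < b) {f : ℝ → ℝ≥0∞} (hf : Measurable f) :
    ∫⁻ x, f (x / b) ∂(expMeasure 1) =
      ENNReal.ofReal b * ∫⁻ r in Set.Ioi 0, expE (-(b * r)) * f r := by
  have hm : Measurable fun x => expE (-x) * f (x / b) :=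
    (measurable_expE.comp measurable_neg).mul (hf.comp (measurable_id.div_const b))
  rw [lintegral_expMeasure_one (by fun_prop),
    ← lintegral_indicator measurableSet_Ioi]
  change ∫⁻ x, (Set.Ioi 0).indicator (fun x => expE (-x) * f (x / b)) x = _
  rw [lintegral_comp_mul_left_real hb (hm.indicator measurableSet_Ioi),
    ← lintegral_indicator measurableSet_Ioi]
  congr 1
  refine lintegral_congr fun r => ?_
  by_cases h : 0 < r
  · simp [Set.indicator, h, mul_pos hb h, expE, mul_div_cancel_left₀ r hb.ne']
  · have : ¬ 0 < b * r := fun h' => h (pos_of_mul_pos_right h' hb.le)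
    simp [Set.indicator, h, this]

/-- The integral of `f(s + r) e^{qr}` over `r > 0`. -/
def expTail (q : ℝ) (f : ℝ → ℝ≥0∞) (s : ℝ) : ℝ≥0∞ :=
  ∫⁻ r in Set.Ioi 0, f (s + r) * expE (q * r)

theorem measurable_expTail (q : ℝ) {f : ℝ → ℝ≥0∞} (hf : Measurable f) :
    Measurable (expTail q f) := by
  refine Measurable.lintegral_prod_right' (f := fun y : ℝ × ℝ => f (y.1 + y.2) * expE (q * y.2)) ?_
  exact (hf.comp (measurable_fst.add measurable_snd)).mul
    (measurable_expE.comp (measurable_snd.const_mul q))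

theorem expTail_mono {q : ℝ} {f g : ℝ → ℝ≥0∞} (h : ∀ s, f s ≤ g s) (s : ℝ) :
    expTail q f s ≤ expTail q g s :=
  lintegral_mono fun _ => mul_le_mul_left (h _) _

theorem expTail_exp {q l : ℝ} (h : q < l) (C : ℝ≥0∞) (s : ℝ) :
    expTail q (fun s => C * expE (-(l * s))) s =
      C * (ENNReal.ofReal (1 / (l - q)) * expE (-(l * s))) := by
  unfold expTail
  have : ∀ r, C * expE (-(l * (s + r))) * expE (q * r) =
      C * expE (-(l * s)) * expE (-((l - q) * r)) := by
    intro r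
    rw [mul_assoc, mul_assoc, ← expE_add, ← expE_add]
    congr 2; ring
  simp only [this]
  rw [lintegral_const_mul _ (by fun_prop)]
  have h3 := lintegral_exp_Ioi (sub_pos.2 h) 0
  unfold expE at h3 ⊢
  rw [h3]
  simp only [mul_zero, neg_zero, Real.exp_zero]
  ring

/-- Fubini with w = r + v, where v is the variable inside `expTail`: for fixed w the remaining
integral of (b+q) e^{-(b+q)r} over 0 < r < w is 1 - e^{-(b+q)w}. -/
theorem lintegral_exp_mul_expTail {q b : ℝ} (hbq : 0 < b + q) {f : ℝ → ℝ≥0∞}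
    (hf : Measurable f) (s : ℝ) :
    ∫⁻ r in Set.Ioi 0, expE (-(b * r)) * (ENNReal.ofReal (b + q) * expTail q f (s + r)) =
      ∫⁻ w in Set.Ioi 0, f (s + w) * expE (q * w) * (1 - expE (-((b + q) * w))) := by
  set k : ℝ → ℝ → ℝ≥0∞ := fun r w => Set.indicator {y : ℝ × ℝ | 0 < y.1 ∧ y.1 < y.2}
    (fun y => ENNReal.ofReal (b + q) * expE (-((b + q) * y.1)) * (f (s + y.2) * expE (q * y.2)))
    (r, w) with hk
  have hkm : Measurable (Function.uncurry k) := by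
    have hset : MeasurableSet {y : ℝ × ℝ | 0 < y.1 ∧ y.1 < y.2} :=
      (measurableSet_lt measurable_const measurable_fst).inter
        (measurableSet_lt measurable_fst measurable_snd)
    refine Measurable.indicator ?_ hset
    exact (((measurable_expE.comp (by fun_prop)).const_mul _)).mul
      ((hf.comp (by fun_prop)).mul (measurable_expE.comp (by fun_prop)))
  have h1 : ∀ r, Set.indicator (Set.Ioi 0) (fun r => expE (-(b * r)) *
      (ENNReal.ofReal (b + q) * expTail q f (s + r))) r = ∫⁻ w, k r w := by
    intro r
    by_cases hr : 0 < r
    · have hm : Measurable fun v => f (s + r + v) * expE (q * v) :=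
        (hf.comp (by fun_prop)).mul (measurable_expE.comp (by fun_prop))
      rw [Set.indicator_of_mem (by exact hr), expTail, ← lintegral_indicator measurableSet_Ioi,
        ← mul_assoc, ← lintegral_const_mul _ (hm.indicator measurableSet_Ioi),
        ← lintegral_sub_right_eq_self _ r]
      refine lintegral_congr fun w => ?_
      by_cases hw : r < w
      · simp only [hk, Set.indicator, Set.mem_Ioi, sub_pos, hw, Set.mem_ofPred_eq, hr, and_self,
          if_true]
        rw [show s + r + (w - r) = s + w by ring,
          show -((b + q) * r) = -(b * r) + -(q * r) by ring,
          show q * (w - r) = -(q * r) + q * w by ring, expE_add, expE_add]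
        ring
      · simp [hk, Set.indicator, hw]
    · simp [hk, Set.indicator, hr]
  rw [← lintegral_indicator measurableSet_Ioi, lintegral_congr h1,
    lintegral_lintegral_swap hkm.aemeasurable, ← lintegral_indicator measurableSet_Ioi]
  refine lintegral_congr fun w => ?_
  by_cases hw : 0 < w
  · have h2 : ∀ r, k r w = Set.indicator (Set.Ioo 0 w) (fun r =>
        ENNReal.ofReal (b + q) * expE (-((b + q) * r))) r * (f (s + w) * expE (q * w)) := by
      intro r
      simp only [hk, Set.indicator, Set.mem_ofPred_eq, Set.mem_Ioo]
      split_ifs <;> simp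
    rw [Set.indicator_of_mem (by exact hw), lintegral_congr h2, lintegral_mul_const,
      lintegral_indicator measurableSet_Ioo, lintegral_Ioo_exp hbq hw.le, mul_comm]
    exact ((measurable_expE.comp (by fun_prop)).const_mul _).indicator measurableSet_Ioo
  · have h2 : ∀ r, k r w = 0 := by
      intro r
      simp only [hk, Set.indicator, Set.mem_ofPred_eq]
      rw [if_neg]
      rintro ⟨h, h'⟩
      exact hw (h.trans h')
    simp [h2, hw]

/-- At birth rate b and age s, the expected sum of f over future births should be b · `expTail q f
s`, since the mean rate grows like b e^{qr}. The identity checks this at the next birth, after which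
the mean rate is b + q: the next birth contributes the factor e^{-bw} = e^{qw} e^{-(b+q)w}, and the
later ones e^{qw}(1 - e^{-(b+q)w}). -/
theorem lintegral_step_expTail {q b : ℝ} (hq : 0 ≤ q) (hb : 0 < b) {f : ℝ → ℝ≥0∞}
    (hf : Measurable f) (s : ℝ) :
    ∫⁻ x, (f (s + x / b) + ENNReal.ofReal (b + q) * expTail q f (s + x / b)) ∂(expMeasure 1) =
      ENNReal.ofReal b * expTail q f s := by
  have hF := measurable_expTail q hf
  have hbq : 0 < b + q := by linarith
  have m1 : Measurable fun r => f (s + r) := hf.comp (by fun_prop)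
  have m2 : Measurable fun r => ENNReal.ofReal (b + q) * expTail q f (s + r) :=
    (hF.comp (by fun_prop)).const_mul _
  rw [lintegral_expMeasure_div (f := fun r => f (s + r) + ENNReal.ofReal (b + q) *
    expTail q f (s + r)) hb (m1.add m2)]
  congr 1
  simp only [mul_add]
  have m3 : Measurable fun r => expE (-(b * r)) := measurable_expE.comp (by fun_prop)
  rw [lintegral_add_left (by fun_prop), lintegral_exp_mul_expTail hbq hf, ← lintegral_add_left
    (by fun_prop)]
  refine setLIntegral_congr_fun measurableSet_Ioi fun w hw => ?_
  have hw : 0 < w := hw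
  have e1 : expE (-(b * w)) = expE (q * w) * expE (-((b + q) * w)) := by
    rw [← expE_add]; congr 1; ring
  have e2 : expE (-((b + q) * w)) ≤ 1 := by
    rw [← expE_zero]; exact expE_le_expE (by nlinarith [mul_pos hbq hw])
  rw [e1, show expE (q * w) * expE (-((b + q) * w)) * f (s + w) =
    f (s + w) * expE (q * w) * expE (-((b + q) * w)) by ring, ← mul_add, add_tsub_cancel_of_le e2,
    mul_one]

/-- The conserved quantity of the Markov chain `chain`. -/
def chainTail (p : ℝ) (f : ℝ → ℝ≥0∞) (n : ℕ) : ℝ≥0∞ :=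
  ∫⁻ ω, ENNReal.ofReal ((chain ω n).2 + 1) * expTail (1 - p) f (chain ω n).1 ∂(clocksLaw p)

theorem measurable_natCast_add_one : Measurable fun b : ℕ => ENNReal.ofReal ((b : ℝ) + 1) :=
  measurable_of_countable _

/-- `chainTail p f n` plays the role of the expected sum of f over the births after the n-th; one
birth moves its own share out of it. -/
theorem chainTail_step {p : ℝ} (h0 : 0 ≤ p) (h1 : p ≤ 1) {f : ℝ → ℝ≥0∞} (hf : Measurable f)
    (n : ℕ) :
    ∫⁻ ω, f (chain ω (n + 1)).1 ∂(clocksLaw p) + chainTail p f (n + 1) = chainTail p f n := by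
  have hF := measurable_expTail (1 - p) hf
  set G : ℝ × ℕ → ℝ≥0∞ := fun s => f s.1 + ENNReal.ofReal (s.2 + 1) * expTail (1 - p) f s.1 with hG
  have hGm : Measurable G := (hf.comp measurable_fst).add
    ((measurable_natCast_add_one.comp measurable_snd).mul (hF.comp measurable_fst))
  unfold chainTail
  have hc : Measurable fun ω => f (chain ω (n + 1)).1 := hf.comp (measurable_chain (n + 1)).fst
  rw [← lintegral_add_left hc]
  change ∫⁻ ω, G (chain ω (n + 1)) ∂(clocksLaw p) = _
  simp only [chain_succ]
  rw [lintegral_clocksLaw_coord h0 h1 (measurable_chain_awayFrom le_rfl)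
    (f := fun y => G (chainStep y.1 y.2)) (hGm.comp measurable_chainStep)]
  refine lintegral_congr fun ω => ?_
  generalize chain ω n = s
  obtain ⟨z, b⟩ := s
  have hGs : Measurable fun x => G (chainStep (z, b) x) :=
    hGm.comp (measurable_chainStep.comp (measurable_const.prodMk measurable_id))
  change ∫⁻ x, G (chainStep (z, b) x) ∂(clockLaw p) = _
  rw [lintegral_clockLaw h0 h1 hGs]
  have hb : (0 : ℝ) < (b : ℝ) + 1 := by positivity
  have m1 : Measurable fun x : ℝ => f (z + x / ((b : ℝ) + 1)) := hf.comp (by fun_prop)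
  have m2 : Measurable fun x : ℝ => expTail (1 - p) f (z + x / ((b : ℝ) + 1)) :=
    hF.comp (by fun_prop)
  have hs := lintegral_step_expTail (sub_nonneg.2 h1) hb hf z
  simp only [hG, chainStep, if_true, Bool.false_eq_true, if_false, add_zero]
  rw [lintegral_add_left m1, lintegral_const_mul _ m2] at hs
  rw [lintegral_add_left m1, lintegral_add_left m1, lintegral_const_mul _ m2,
    lintegral_const_mul _ m2, ← hs]
  generalize ∫⁻ x, f (z + x / ((b : ℝ) + 1)) ∂(expMeasure 1) = I
  generalize ∫⁻ x, expTail (1 - p) f (z + x / ((b : ℝ) + 1)) ∂(expMeasure 1) = J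
  have e1 : ENNReal.ofReal p + ENNReal.ofReal (1 - p) = 1 := by
    rw [← ENNReal.ofReal_add h0 (sub_nonneg.2 h1)]; simp
  -- A red child leaves the rate unchanged and a blue one adds 1, so the mean rate rises by 1 - p.
  have e2 : ENNReal.ofReal p * ENNReal.ofReal ((b : ℝ) + 1) +
      ENNReal.ofReal (1 - p) * ENNReal.ofReal (((b + 1 : ℕ) : ℝ) + 1) =
      ENNReal.ofReal ((b : ℝ) + 1 + (1 - p)) := by
    rw [← ENNReal.ofReal_mul h0, ← ENNReal.ofReal_mul (sub_nonneg.2 h1), ← ENNReal.ofReal_add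
      (by positivity) (mul_nonneg (sub_nonneg.2 h1) (by positivity))]
    congr 1; push_cast; ring
  rw [← e2]
  calc _ = (ENNReal.ofReal p + ENNReal.ofReal (1 - p)) * I + (ENNReal.ofReal p *
        ENNReal.ofReal ((b : ℝ) + 1) +
      ENNReal.ofReal (1 - p) * ENNReal.ofReal (((b + 1 : ℕ) : ℝ) + 1)) * J := by ring
    _ = _ := by rw [e1, one_mul]

theorem sum_chainTail {p : ℝ} (h0 : 0 ≤ p) (h1 : p ≤ 1) {f : ℝ → ℝ≥0∞} (hf : Measurable f)
    (n : ℕ) :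
    ∑ k ∈ Finset.range n, ∫⁻ ω, f (chain ω (k + 1)).1 ∂(clocksLaw p) + chainTail p f n =
      expTail (1 - p) f 0 := by
  induction n with
  | zero =>
    have := isProbabilityMeasure_clockLaw h0 h1
    simp [chainTail, chain]
  | succ n ih =>
    rw [Finset.sum_range_succ, add_assoc, chainTail_step h0 h1 hf, ih]

/-- A positive limit would make every decrement at least a constant times 1/(n+1), and the harmonic
series diverges. -/
theorem tendsto_zero_of_harmonic_decrease {a : ℕ → ℝ} {c l : ℝ} (hc : 0 < c) (hl : 0 ≤ l)
    (ha : ∀ n, 0 ≤ a n) (h : ∀ n, a (n + 1) ≤ a n - c * (a n / (n + 1 + l))) :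
    Tendsto a atTop (𝓝 0) := by
  have hanti : Antitone a := antitone_nat_of_succ_le fun n => by
    have : 0 ≤ c * (a n / (n + 1 + l)) := mul_nonneg hc.le (div_nonneg (ha n) (by positivity))
    linarith [h n]
  have hbdd : BddBelow (Set.range a) := ⟨0, by rintro _ ⟨n, rfl⟩; exact ha n⟩
  have hlim := tendsto_atTop_ciInf hanti hbdd
  set L := ⨅ i, a i
  have hL0 : 0 ≤ L := le_ciInf ha
  have hLle : ∀ n, L ≤ a n := fun n => ciInf_le hbdd n
  rcases hL0.eq_or_lt with hL | hL
  · rw [hL]; exact hlim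
  exfalso
  -- The factor 1 + l comes from n + 1 + l ≤ (1 + l)(n + 1).
  set d := c * L / (1 + l) with hd
  have hdpos : 0 < d := by positivity
  have hsum : ∀ n, d * ∑ i ∈ Finset.range n, (1 / ((i : ℝ) + 1)) ≤ a 0 - a n := by
    intro n
    induction n with
    | zero => simp
    | succ n ih =>
      rw [Finset.sum_range_succ, mul_add]
      have h2 : d * (1 / ((n : ℝ) + 1)) ≤ c * (a n / (n + 1 + l)) := by
        have e : d * (1 / ((n : ℝ) + 1)) = c * (L / ((1 + l) * (n + 1))) := by
          rw [hd]; field_simp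
        rw [e]
        refine mul_le_mul_of_nonneg_left ?_ hc.le
        refine div_le_div₀ (ha n) (hLle n) (by positivity) ?_
        nlinarith [mul_nonneg hl (Nat.cast_nonneg (α := ℝ) n)]
      linarith [h n]
  have ht := (Real.tendsto_sum_range_one_div_nat_succ_atTop).const_mul_atTop hdpos
  obtain ⟨n, hn⟩ := (ht.eventually_gt_atTop (a 0)).exists
  linarith [hsum n, ha n]

theorem chainTail_exp {p l : ℝ} (hl : 1 - p < l) (C : ℝ≥0∞) (n : ℕ) :
    chainTail p (fun s => C * expE (-(l * s))) n = C * ENNReal.ofReal (1 / (l - (1 - p))) *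
      ∫⁻ ω, ENNReal.ofReal ((chain ω n).2 + 1) * expE (-(l * (chain ω n).1)) ∂(clocksLaw p) := by
  have hc := measurable_chain n
  have hm : Measurable fun ω => ENNReal.ofReal ((chain ω n).2 + 1) * expE (-(l * (chain ω n).1)) :=
    (measurable_natCast_add_one.comp hc.snd).mul
      (measurable_expE.comp (hc.fst.const_mul l).neg)
  rw [chainTail, ← lintegral_const_mul _ hm]
  refine lintegral_congr fun ω => ?_
  rw [expTail_exp hl]
  ring

theorem lintegral_expMeasure_exp {b l : ℝ} (hb : 0 < b) (hl : 0 ≤ l) (z : ℝ) :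
    ∫⁻ x, expE (-(l * (z + x / b))) ∂(expMeasure 1) =
      ENNReal.ofReal b * (ENNReal.ofReal (1 / (b + l)) * expE (-(l * z))) := by
  rw [lintegral_expMeasure_div (f := fun y => expE (-(l * (z + y)))) hb (by fun_prop)]
  have h : ∀ r, expE (-(b * r)) * expE (-(l * (z + r))) =
      expE (-(l * z)) * expE (-((b + l) * r)) := by
    intro r
    rw [← expE_add, ← expE_add]
    congr 1; ring
  simp only [h]
  rw [lintegral_const_mul _ (by fun_prop)]
  have h3 := lintegral_exp_Ioi (c := b + l) (by linarith) 0
  unfold expE at h3 ⊢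
  rw [h3]
  simp only [mul_zero, neg_zero, Real.exp_zero]
  rw [mul_comm (ENNReal.ofReal (Real.exp (-(l * z))))]

/-- With b blue children the next wait has Laplace transform (b+1)/(b+1+l), and b ≤ n bounds the
denominator. -/
theorem lintegral_chain_exp_ge {p l : ℝ} (h0 : 0 ≤ p) (h1 : p ≤ 1) (hl : 0 ≤ l) (n : ℕ) :
    ENNReal.ofReal (1 / (n + 1 + l)) *
      ∫⁻ ω, ENNReal.ofReal ((chain ω n).2 + 1) * expE (-(l * (chain ω n).1)) ∂(clocksLaw p) ≤
    ∫⁻ ω, expE (-(l * (chain ω (n + 1)).1)) ∂(clocksLaw p) := by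
  have hc := measurable_chain n
  have hm : Measurable fun ω => ENNReal.ofReal ((chain ω n).2 + 1) * expE (-(l * (chain ω n).1)) :=
    (measurable_natCast_add_one.comp hc.snd).mul
      (measurable_expE.comp (hc.fst.const_mul l).neg)
  have hGm : Measurable fun s : ℝ × ℕ => expE (-(l * s.1)) := by fun_prop
  simp only [chain_succ]
  rw [lintegral_clocksLaw_coord h0 h1 (measurable_chain_awayFrom le_rfl)
    (f := fun y => expE (-(l * (chainStep y.1 y.2).1))) (hGm.comp measurable_chainStep),
    ← lintegral_const_mul _ hm]
  refine lintegral_mono fun ω => ?_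
  have hb := chain_snd_le ω n
  simp only
  generalize chain ω n = s at *
  obtain ⟨z, b⟩ := s
  have hGs : Measurable fun x => expE (-(l * (chainStep (z, b) x).1)) :=
    hGm.comp (measurable_chainStep.comp (measurable_const.prodMk measurable_id))
  rw [lintegral_clockLaw h0 h1 hGs]
  simp only [chainStep]
  rw [lintegral_expMeasure_exp (by positivity) hl, ← add_mul,
    ← ENNReal.ofReal_add h0 (sub_nonneg.2 h1)]
  simp only [add_sub_cancel, ENNReal.ofReal_one, one_mul]
  rw [mul_left_comm]
  gcongr

/-- For f = e^{-ls} the conserved quantity is a multiple of the sequence itself, so `chainTail_step`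
becomes a recursion whose decrement is at least harmonic. The conclusion says that no expected mass
escapes after infinitely many births. -/
theorem tendsto_chain_exp {p l : ℝ} (h0 : 0 ≤ p) (h1 : p ≤ 1) (hl : 1 - p < l) :
    Tendsto (fun n => ∫⁻ ω, ENNReal.ofReal ((chain ω n).2 + 1) *
      expE (-(l * (chain ω n).1)) ∂(clocksLaw p)) atTop (𝓝 0) := by
  set a : ℕ → ℝ≥0∞ := fun n => ∫⁻ ω, ENNReal.ofReal ((chain ω n).2 + 1) *
      expE (-(l * (chain ω n).1)) ∂(clocksLaw p) with ha
  set c := l - (1 - p) with hc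
  have hcpos : 0 < c := by linarith
  have hl0 : 0 ≤ l := by linarith
  have hstep : ∀ n : ℕ, ENNReal.ofReal (1 / (n + 1 + l)) * a n + ENNReal.ofReal (1 / c) * a (n + 1) ≤
      ENNReal.ofReal (1 / c) * a n := by
    intro n
    have h := chainTail_step h0 h1 (f := fun s => 1 * expE (-(l * s))) (by fun_prop) n
    rw [chainTail_exp hl, chainTail_exp hl] at h
    simp only [one_mul] at h
    rw [← h]
    exact add_le_add_left (lintegral_chain_exp_ge h0 h1 hl0 n) _
  have hfin : ∀ n, a n ≠ ∞ := by
    intro n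
    induction n with
    | zero =>
      have := isProbabilityMeasure_clockLaw h0 h1
      simp [ha, chain]
    | succ n ih =>
      intro htop
      have h := hstep n
      rw [htop, ENNReal.mul_top (by simpa using hcpos), add_top, top_le_iff] at h
      exact ENNReal.mul_ne_top ENNReal.ofReal_ne_top ih h
  have hr : Tendsto (fun n => (a n).toReal) atTop (𝓝 0) := by
    refine tendsto_zero_of_harmonic_decrease hcpos hl0 (fun n => ENNReal.toReal_nonneg) fun n => ?_
    have h := ENNReal.toReal_mono (ENNReal.mul_ne_top ENNReal.ofReal_ne_top (hfin n)) (hstep n)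
    rw [ENNReal.toReal_add (ENNReal.mul_ne_top ENNReal.ofReal_ne_top (hfin n))
      (ENNReal.mul_ne_top ENNReal.ofReal_ne_top (hfin (n + 1)))] at h
    simp only [ENNReal.toReal_mul] at h
    rw [ENNReal.toReal_ofReal (by positivity), ENNReal.toReal_ofReal (by positivity)] at h
    have h2 := mul_le_mul_of_nonneg_left h hcpos.le
    have e1 : c * (1 / c * (a n).toReal) = (a n).toReal := by field_simp
    have e2 : c * (1 / (n + 1 + l) * (a n).toReal + 1 / c * (a (n + 1)).toReal) =
        c * ((a n).toReal / (n + 1 + l)) + (a (n + 1)).toReal := by field_simp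
    rw [e1, e2] at h2
    linarith
  have := ENNReal.tendsto_ofReal hr
  simpa [ENNReal.ofReal_toReal (hfin _)] using this

/-! ### From the clocks to the intensity of the offspring law -/

theorem measurable_offspringOfClocks : Measurable offspringOfClocks := by
  refine measurable_pi_lambda _ fun n => ?_
  simp only [offspringOfClocks_apply]
  exact (measurable_chain (n + 1)).fst.prodMk (measurable_coord n).snd

theorem isProbabilityMeasure_offspringLaw {p : ℝ} (h0 : 0 ≤ p) (h1 : p ≤ 1) :
    IsProbabilityMeasure (offspringLaw p) := by
  have := isProbabilityMeasure_clockLaw h0 h1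
  exact Measure.isProbabilityMeasure_map measurable_offspringOfClocks.aemeasurable

theorem measurable_age (j : ℕ) : Measurable fun o : Offspring => (o j).1 :=
  (measurable_pi_apply j).fst

/-- The intensity of the births of the children of a vertex is `e^{(1-p)s} ds`. -/
theorem lintegral_offspringLaw_tsum {p l : ℝ} (h0 : 0 ≤ p) (h1 : p ≤ 1) (hl : 1 - p < l)
    {f : ℝ → ℝ≥0∞} (hf : Measurable f) {C : ℝ≥0∞} (hC : C ≠ ∞)
    (hle : ∀ s, f s ≤ C * expE (-(l * s))) :
    ∫⁻ o, ∑' j, f (o j).1 ∂(offspringLaw p) = ∫⁻ r in Set.Ioi 0, f r * expE ((1 - p) * r) := by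
  have hm : ∀ j, Measurable fun o : Offspring => f (o j).1 := fun j => hf.comp (measurable_age j)
  rw [offspringLaw, lintegral_map (Measurable.tsum hm) measurable_offspringOfClocks]
  simp only [offspringOfClocks_apply]
  have hm' : ∀ j, AEMeasurable (fun ω => f (chain ω (j + 1)).1) (clocksLaw p) :=
    fun j => (hf.comp (measurable_chain (j + 1)).fst).aemeasurable
  rw [lintegral_tsum hm']
  -- The leftover in `sum_chainTail` is dominated by that of C e^{-ls}, which vanishes.
  have ht : Tendsto (fun n => chainTail p f n) atTop (𝓝 0) := by
    have h := ENNReal.Tendsto.const_mul (a := C * ENNReal.ofReal (1 / (l - (1 - p))))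
      (tendsto_chain_exp h0 h1 hl) (Or.inr (ENNReal.mul_ne_top hC ENNReal.ofReal_ne_top))
    simp only [mul_zero, ← chainTail_exp hl] at h
    refine tendsto_of_tendsto_of_tendsto_of_le_of_le tendsto_const_nhds h
      (fun _ => zero_le) fun n => ?_
    exact lintegral_mono fun ω => mul_le_mul_right (expTail_mono hle _) _
  have h := (ENNReal.summable.tendsto_sum_tsum_nat (f := fun k =>
    ∫⁻ ω, f (chain ω (k + 1)).1 ∂(clocksLaw p))).add ht
  simp only [sum_chainTail h0 h1 hf, add_zero] at h
  rw [tendsto_nhds_unique h tendsto_const_nhds, expTail]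
  simp

/-! ### Almost sure properties and the second moment of one offspring process -/

theorem lintegral_expMeasure_quadratic {b g : ℝ} (hb : 0 < b) (hg : 0 ≤ g) {k0 k1 k2 : ℝ}
    (hk0 : 0 ≤ k0) (hk1 : 0 ≤ k1) (hk2 : 0 ≤ k2) :
    ∫⁻ x, ENNReal.ofReal (k0 + k1 * Real.exp (-(g * (x / b))) +
      k2 * Real.exp (-(2 * g * (x / b)))) ∂(expMeasure 1) =
    ENNReal.ofReal (k0 + k1 * (b / (b + g)) + k2 * (b / (b + 2 * g))) := by
  have := isProbabilityMeasure_expMeasure one_pos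
  have e : ∀ x, ENNReal.ofReal (k0 + k1 * Real.exp (-(g * (x / b))) +
      k2 * Real.exp (-(2 * g * (x / b)))) = ENNReal.ofReal k0 +
      ENNReal.ofReal k1 * expE (-(g * (x / b))) + ENNReal.ofReal k2 * expE (-(2 * g * (x / b))) := by
    intro x
    rw [ENNReal.ofReal_add (by positivity) (by positivity), ENNReal.ofReal_add (by positivity)
      (by positivity), ENNReal.ofReal_mul hk1, ENNReal.ofReal_mul hk2]
    rfl
  simp only [e]
  rw [lintegral_add_left (by fun_prop), lintegral_add_left (by fun_prop), lintegral_const,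
    lintegral_const_mul _ (by fun_prop), lintegral_const_mul _ (by fun_prop)]
  have h1 := lintegral_expMeasure_exp hb hg 0
  have h2 := lintegral_expMeasure_exp hb (mul_nonneg zero_le_two hg) 0
  simp only [zero_add, mul_zero, neg_zero, expE_zero, mul_one] at h1 h2
  rw [h1, h2, measure_univ, mul_one, ← ENNReal.ofReal_mul hb.le, ← ENNReal.ofReal_mul hb.le,
    ← ENNReal.ofReal_mul hk1, ← ENNReal.ofReal_mul hk2, ← ENNReal.ofReal_add (by positivity)
    (by positivity), ← ENNReal.ofReal_add (by positivity) (by positivity)]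
  simp only [mul_one_div]

/-- The Lyapunov function which bounds the second moment of the discounted offspring. -/
def lyapunov (p a w b : ℝ) : ℝ := a ^ 2 + 4 * (a * w * b) + 9 / p * (w ^ 2 * b ^ 2)

/-- Here a is the partial sum, w the current discount and b the birth rate. As g - (1-p) = 1/2, the
expected remaining sum is 2wb, so the cross term 4awb = 2a · 2wb is preserved exactly (`e1`). The
coefficient 9/p only has to absorb the rest (`e2`): b - (1-p) ≥ pb for b ≥ 1, and 9b ≥ 1 + 4b +
4(1-p). -/
theorem lyapunov_step {p a w b : ℝ} (hp : 0 < p) (hp1 : p ≤ 1) (hb : 1 ≤ b) :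
    p * (a ^ 2 + (2 * a * w + 4 * (a * w * b)) * (b / (b + (3 / 2 - p))) +
      (w ^ 2 * (1 + 4 * b + 9 / p * b ^ 2)) * (b / (b + 2 * (3 / 2 - p)))) +
    (1 - p) * (a ^ 2 + (2 * a * w + 4 * (a * w * (b + 1))) * (b / (b + (3 / 2 - p))) +
      (w ^ 2 * (1 + 4 * (b + 1) + 9 / p * (b + 1) ^ 2)) * (b / (b + 2 * (3 / 2 - p)))) ≤
    lyapunov p a w b := by
  have hd1 : 0 < b + (3 / 2 - p) := by linarith
  have hd2 : 0 < b + 2 * (3 / 2 - p) := by linarith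
  have e1 : (2 + 4 * (b + (1 - p))) * (b / (b + (3 / 2 - p))) = 4 * b := by
    rw [← mul_div_assoc, div_eq_iff hd1.ne']; ring
  have e2 : (1 + 4 * (b + (1 - p)) + 9 / p * (b ^ 2 + 2 * (1 - p) * b + (1 - p))) *
      (b / (b + 2 * (3 / 2 - p))) ≤ 9 / p * b ^ 2 := by
    rw [← mul_div_assoc, div_le_iff₀ hd2]
    have h9 : 9 / p * (b - (1 - p)) ≥ 9 * b := by
      have : 9 / p * (b - (1 - p)) = 9 * ((b - (1 - p)) / p) := by ring
      rw [this]
      refine mul_le_mul_of_nonneg_left ?_ (by norm_num)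
      rw [le_div_iff₀ hp]
      nlinarith
    nlinarith
  have e3 := mul_le_mul_of_nonneg_left e2 (sq_nonneg w)
  have e4 := congrArg (fun y => a * w * y) e1
  unfold lyapunov
  linarith

/-- The sum of `e^{-g ζ}` over the first `n` children. -/
def partialDiscount (g : ℝ) (ω : ℕ → ℝ × Bool) (n : ℕ) : ℝ :=
  ∑ j ∈ Finset.range n, Real.exp (-(g * (chain ω (j + 1)).1))

/-- The Lyapunov function as a function of the partial sum and the state of `chain`. -/
def lyapunovState (p : ℝ) (y : ℝ × (ℝ × ℕ)) : ℝ :=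
  lyapunov p y.1 (Real.exp (-((3 / 2 - p) * y.2.1))) (y.2.2 + 1)

theorem measurable_lyapunovState (p : ℝ) : Measurable (lyapunovState p) := by
  have hcast : Measurable fun b : ℕ => (b : ℝ) + 1 := measurable_of_countable _
  have hb : Measurable fun y : ℝ × (ℝ × ℕ) => (y.2.2 : ℝ) + 1 := hcast.comp measurable_snd.snd
  unfold lyapunovState lyapunov
  fun_prop

/-- The partial sum and the state of `chain` after one more birth. -/
def discountStep (p : ℝ) (y : ℝ × (ℝ × ℕ)) (x : ℝ × Bool) : ℝ × (ℝ × ℕ) :=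
  (y.1 + Real.exp (-((3 / 2 - p) * (chainStep y.2 x).1)), chainStep y.2 x)

theorem measurable_discountStep (p : ℝ) :
    Measurable fun z : (ℝ × (ℝ × ℕ)) × (ℝ × Bool) => discountStep p z.1 z.2 := by
  have h : Measurable fun z : (ℝ × (ℝ × ℕ)) × (ℝ × Bool) => chainStep z.1.2 z.2 :=
    measurable_chainStep.comp (measurable_fst.snd.prodMk measurable_snd)
  unfold discountStep
  exact (measurable_fst.fst.add (Real.measurable_exp.comp (h.fst.const_mul _).neg)).prodMk h

theorem lyapunovState_discountStep (p a z : ℝ) (b : ℕ) (x : ℝ) (c : Bool) :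
    lyapunovState p (discountStep p (a, (z, b)) (x, c)) =
      a ^ 2 + (2 * a * Real.exp (-((3 / 2 - p) * z)) + 4 * (a * Real.exp (-((3 / 2 - p) * z)) *
        (((b + if c = true then 1 else 0 : ℕ) : ℝ) + 1))) *
        Real.exp (-((3 / 2 - p) * (x / ((b : ℝ) + 1)))) +
      (Real.exp (-((3 / 2 - p) * z)) ^ 2 * (1 + 4 * (((b + if c = true then 1 else 0 : ℕ) : ℝ) + 1)
        + 9 / p * (((b + if c = true then 1 else 0 : ℕ) : ℝ) + 1) ^ 2)) *
        Real.exp (-(2 * (3 / 2 - p) * (x / ((b : ℝ) + 1)))) := by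
  simp only [lyapunovState, discountStep, chainStep, lyapunov]
  generalize (((b + if c = true then 1 else 0 : ℕ) : ℝ) + 1) = d
  generalize x / ((b : ℝ) + 1) = y
  generalize 3 / 2 - p = g
  have e1 : Real.exp (-(g * (z + y))) = Real.exp (-(g * z)) * Real.exp (-(g * y)) := by
    rw [← Real.exp_add]; congr 1; ring
  have e2 : Real.exp (-(2 * g * y)) = Real.exp (-(g * y)) ^ 2 := by
    rw [← Real.exp_nat_mul]; congr 1; push_cast; ring
  rw [e1, e2]
  ring

theorem lintegral_lyapunovState_step {p : ℝ} (hp : 0 < p) (hp1 : p ≤ 1) {a : ℝ} (ha : 0 ≤ a)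
    (z : ℝ) (b : ℕ) :
    ∫⁻ x, ENNReal.ofReal (lyapunovState p (discountStep p (a, (z, b)) x)) ∂(clockLaw p) ≤
      ENNReal.ofReal (lyapunovState p (a, (z, b))) := by
  have hm : Measurable fun x => ENNReal.ofReal (lyapunovState p (discountStep p (a, (z, b)) x)) :=
    ((measurable_lyapunovState p).comp ((measurable_discountStep p).comp
      ((measurable_const (a := (a, (z, b)))).prodMk measurable_id))).ennreal_ofReal
  rw [lintegral_clockLaw hp.le hp1 hm]
  simp only [lyapunovState_discountStep, Bool.false_eq_true, if_false, if_true, add_zero]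
  have hw : 0 < Real.exp (-((3 / 2 - p) * z)) := Real.exp_pos _
  simp only [lyapunovState]
  generalize Real.exp (-((3 / 2 - p) * z)) = w at *
  have hb0 : (0:ℝ) < (b : ℝ) + 1 := by positivity
  have hg0 : 0 ≤ 3 / 2 - p := by linarith
  have hb1 : (1:ℝ) ≤ (b : ℝ) + 1 := by simp
  have hb2 : (((b + 1 : ℕ) : ℝ) + 1) = (b : ℝ) + 1 + 1 := by push_cast; ring
  rw [hb2]
  generalize (b : ℝ) + 1 = c at *
  rw [lintegral_expMeasure_quadratic hb0 hg0 (by positivity) (by positivity) (by positivity),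
    lintegral_expMeasure_quadratic hb0 hg0 (by positivity) (by positivity) (by positivity),
    ← ENNReal.ofReal_mul hp.le, ← ENNReal.ofReal_mul (sub_nonneg.2 hp1),
    ← ENNReal.ofReal_add (by positivity) (mul_nonneg (sub_nonneg.2 hp1) (by positivity))]
  exact ENNReal.ofReal_le_ofReal (lyapunov_step hp hp1 hb1)

/-- The Lyapunov function along the chain is a supermartingale; only its means are needed. -/
theorem lintegral_lyapunov_succ_le {p : ℝ} (hp : 0 < p) (hp1 : p ≤ 1) (n : ℕ) :
    ∫⁻ ω, ENNReal.ofReal (lyapunovState p (partialDiscount (3 / 2 - p) ω (n + 1),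
      chain ω (n + 1))) ∂(clocksLaw p) ≤
    ∫⁻ ω, ENNReal.ofReal (lyapunovState p (partialDiscount (3 / 2 - p) ω n, chain ω n))
      ∂(clocksLaw p) := by
  have hY : Measurable[awayFrom coord n] fun ω => (partialDiscount (3 / 2 - p) ω n, chain ω n) := by
    refine Measurable.prodMk ?_ (measurable_chain_awayFrom le_rfl)
    refine Finset.measurable_fun_sum _ fun j hj => ?_
    have hj' : j + 1 ≤ n := Finset.mem_range.1 hj
    have := measurable_chain_awayFrom hj'
    exact Real.measurable_exp.comp (((measurable_fst.comp this).const_mul _).neg)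
  have hG : Measurable fun y : (ℝ × (ℝ × ℕ)) × (ℝ × Bool) =>
      ENNReal.ofReal (lyapunovState p (discountStep p y.1 y.2)) :=
    ((measurable_lyapunovState p).comp (measurable_discountStep p)).ennreal_ofReal
  have hstart : ∀ ω, (partialDiscount (3 / 2 - p) ω (n + 1), chain ω (n + 1)) =
      discountStep p (partialDiscount (3 / 2 - p) ω n, chain ω n) (ω n) := by
    intro ω
    rw [discountStep, ← chain_succ, partialDiscount, Finset.sum_range_succ]
    rfl
  simp only [hstart]
  have h := lintegral_clocksLaw_coord hp.le hp1 hY hG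
  simp only at h
  rw [h]
  refine lintegral_mono fun ω => ?_
  exact lintegral_lyapunovState_step hp hp1
    (Finset.sum_nonneg fun _ _ => (Real.exp_pos _).le) _ _

theorem lintegral_sq_partialDiscount_le {p : ℝ} (hp : 0 < p) (hp1 : p ≤ 1) (n : ℕ) :
    ∫⁻ ω, ENNReal.ofReal (partialDiscount (3 / 2 - p) ω n ^ 2) ∂(clocksLaw p) ≤
      ENNReal.ofReal (9 / p) := by
  have h : ∫⁻ ω, ENNReal.ofReal (lyapunovState p (partialDiscount (3 / 2 - p) ω n, chain ω n))
      ∂(clocksLaw p) ≤ ENNReal.ofReal (9 / p) := by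
    induction n with
    | zero =>
      have := isProbabilityMeasure_clockLaw hp.le hp1
      -- The chain starts from a = 0, w = 1, b = 1, where the Lyapunov function equals 9/p.
      simp [lyapunovState, lyapunov, partialDiscount, chain]
    | succ n ih => exact (lintegral_lyapunov_succ_le hp hp1 n).trans ih
  refine le_trans (lintegral_mono fun ω => ENNReal.ofReal_le_ofReal ?_) h
  have ha : 0 ≤ partialDiscount (3 / 2 - p) ω n := Finset.sum_nonneg fun _ _ => (Real.exp_pos _).le
  unfold lyapunovState lyapunov
  have := Real.exp_pos (-((3 / 2 - p) * (chain ω n).1))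
  have h2 : 0 ≤ 4 * (partialDiscount (3 / 2 - p) ω n * Real.exp (-((3 / 2 - p) * (chain ω n).1)) *
    ((chain ω n).2 + 1)) := by positivity
  have h3 : 0 ≤ 9 / p * (Real.exp (-((3 / 2 - p) * (chain ω n).1)) ^ 2 *
    (((chain ω n).2 : ℝ) + 1) ^ 2) := by positivity
  linarith

theorem lintegral_sq_tsum_le {p : ℝ} (hp : 0 < p) (hp1 : p ≤ 1) :
    ∫⁻ o, (∑' j, expE (-((3 / 2 - p) * (o j).1))) ^ 2 ∂(offspringLaw p) ≤
      ENNReal.ofReal (9 / p) := by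
  have hm : ∀ j, Measurable fun o : Offspring => expE (-((3 / 2 - p) * (o j).1)) := fun j =>
    measurable_expE.comp ((measurable_age j).const_mul _).neg
  rw [offspringLaw, lintegral_map ((Measurable.tsum hm).pow_const 2) measurable_offspringOfClocks]
  simp only [offspringOfClocks_apply]
  have hlim : ∀ ω, Tendsto (fun n => ENNReal.ofReal (partialDiscount (3 / 2 - p) ω n ^ 2)) atTop
      (𝓝 ((∑' j, expE (-((3 / 2 - p) * (chain ω (j + 1)).1))) ^ 2)) := by
    intro ω
    have h := (ENNReal.summable.tendsto_sum_tsum_nat (f := fun j =>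
      expE (-((3 / 2 - p) * (chain ω (j + 1)).1))))
    have h2 := ((ENNReal.continuous_pow 2).tendsto _).comp h
    refine h2.congr fun n => ?_
    simp only [Function.comp]
    rw [partialDiscount, ENNReal.ofReal_pow (Finset.sum_nonneg fun _ _ => (Real.exp_pos _).le),
      ENNReal.ofReal_sum_of_nonneg fun _ _ => (Real.exp_pos _).le]
    rfl
  have hpm : ∀ n, Measurable fun ω => ENNReal.ofReal (partialDiscount (3 / 2 - p) ω n ^ 2) := by
    intro n
    refine (Measurable.pow_const (Finset.measurable_fun_sum _ fun j _ => ?_) 2).ennreal_ofReal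
    exact Real.measurable_exp.comp (((measurable_chain (j + 1)).fst.const_mul _).neg)
  calc _ = ∫⁻ ω, liminf (fun n => ENNReal.ofReal (partialDiscount (3 / 2 - p) ω n ^ 2)) atTop
        ∂(clocksLaw p) := lintegral_congr fun ω => (hlim ω).liminf_eq.symm
    _ ≤ liminf (fun n => ∫⁻ ω, ENNReal.ofReal (partialDiscount (3 / 2 - p) ω n ^ 2)
        ∂(clocksLaw p)) atTop := lintegral_liminf_le hpm
    _ ≤ _ := by
      refine liminf_le_of_frequently_le' (Frequently.of_forall fun n => ?_)
      exact lintegral_sq_partialDiscount_le hp hp1 n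

/-- The almost sure properties of an offspring process: the children are born at increasing
positive ages, and the ages grow so fast that the discounted sum converges. -/
structure IsRegularOffspring (p : ℝ) (o : Offspring) : Prop where
  pos : ∀ j, 0 < (o j).1
  strictMono : StrictMono fun j => (o j).1
  summable : Summable fun j => Real.exp (-((3 / 2 - p) * (o j).1))

theorem ae_isRegularOffspring {p : ℝ} (hp : 0 < p) (hp1 : p ≤ 1) :
    ∀ᵐ o ∂(offspringLaw p), IsRegularOffspring p o := by
  have h1 : ∀ᵐ o ∂(offspringLaw p), (∀ j, 0 < (o j).1) ∧ ∀ j, (o j).1 < (o (j + 1)).1 := by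
    have hset : MeasurableSet {o : Offspring | (∀ j, 0 < (o j).1) ∧ ∀ j, (o j).1 < (o (j + 1)).1} := by
      rw [Set.ofPred_and, Set.ofPred_forall, Set.ofPred_forall]
      refine (MeasurableSet.iInter fun j => ?_).inter (MeasurableSet.iInter fun j => ?_)
      · exact measurableSet_lt measurable_const (measurable_age j)
      · exact measurableSet_lt (measurable_age j) (measurable_age (j + 1))
    rw [offspringLaw, ae_map_iff measurable_offspringOfClocks.aemeasurable hset]
    filter_upwards [ae_clocks_pos hp.le hp1] with ω hω
    have hlt : ∀ j, (chain ω j).1 < (chain ω (j + 1)).1 := fun j => by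
      have : 0 < (ω j).1 / (((chain ω j).2 : ℝ) + 1) := div_pos (hω j) (by positivity)
      rw [chain_succ, chainStep]
      simpa using this
    have hnn : ∀ j, 0 ≤ (chain ω j).1 := fun j => by
      induction j with
      | zero => exact le_rfl
      | succ j ih => exact ih.trans (hlt j).le
    simp only [offspringOfClocks_apply]
    exact ⟨fun j => (hnn j).trans_lt (hlt j), fun j => hlt (j + 1)⟩
  have h2 : ∀ᵐ o ∂(offspringLaw p), (∑' j, expE (-((3 / 2 - p) * (o j).1))) ^ 2 < ∞ := by
    refine ae_lt_top ((Measurable.tsum fun j => ?_).pow_const 2)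
      ((lintegral_sq_tsum_le hp hp1).trans_lt ENNReal.ofReal_lt_top).ne
    exact measurable_expE.comp ((measurable_age j).const_mul _).neg
  filter_upwards [h1, h2] with o ho ho2
  refine ⟨ho.1, strictMono_nat_of_lt_succ ho.2, ?_⟩
  have h3 : ∑' j, expE (-((3 / 2 - p) * (o j).1)) ≠ ∞ := by
    intro h; simp [h] at ho2
  have := ENNReal.summable_toReal h3
  refine this.congr fun j => ?_
  rw [expE, ENNReal.toReal_ofReal (Real.exp_pos _).le]

/-- The intensity of all births has a density, so no single age has an atom. The constant e^{2a}
makes the indicator of {a} lie below C e^{-2s}, as the intensity formula requires. -/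
theorem offspringLaw_age_eq {p : ℝ} (h0 : 0 ≤ p) (h1 : p ≤ 1) (j : ℕ) (a : ℝ) :
    offspringLaw p {o | (o j).1 = a} = 0 := by
  have hf : Measurable (Set.indicator {a} (fun _ : ℝ => (1 : ℝ≥0∞))) :=
    measurable_const.indicator (measurableSet_singleton a)
  have h := lintegral_offspringLaw_tsum h0 h1 (l := 2) (p := p) (by linarith) hf
    (C := expE (2 * a)) (expE_ne_top _) (fun s => by
      by_cases hs : s = a
      · subst hs; simp [← expE_add]
      · simp [hs])
  have hz : ∫⁻ r in Set.Ioi 0, Set.indicator {a} (fun _ : ℝ => (1 : ℝ≥0∞)) r *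
      expE ((1 - p) * r) = 0 := by
    rw [← lintegral_zero (μ := volume.restrict (Set.Ioi (0:ℝ)))]
    refine lintegral_congr_ae (ae_restrict_of_ae ?_)
    have : ∀ᵐ x : ℝ, x ≠ a := by simp [ae_iff]
    filter_upwards [this] with x hx
    simp [hx]
  have hset : MeasurableSet {o : Offspring | (o j).1 = a} :=
    measurableSet_eq_fun (measurable_age j) measurable_const
  rw [hz] at h
  rw [← nonpos_iff_eq_zero, ← h, ← lintegral_indicator_one hset]
  refine lintegral_mono fun o => le_trans ?_ (ENNReal.le_tsum j)
  by_cases ho : (o j).1 = a <;> simp [ho]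

/-- The age of child `j` is determined by the past of the chain and by clock `j`, and the colour in
the same entry is independent of both. -/
theorem lintegral_offspringLaw_blue {p : ℝ} (h0 : 0 ≤ p) (h1 : p ≤ 1) {f : ℝ → ℝ≥0∞}
    (hf : Measurable f) (j : ℕ) :
    ∫⁻ o, f (o j).1 * (if (o j).2 = true then 1 else 0) ∂(offspringLaw p) =
      ENNReal.ofReal (1 - p) * ∫⁻ o, f (o j).1 ∂(offspringLaw p) := by
  have hb : Measurable fun c : Bool => if c = true then (1 : ℝ≥0∞) else 0 :=
    measurable_of_countable _
  have hcs := measurable_chainStep.fst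
  have hm1 : Measurable fun o : Offspring => f (o j).1 := hf.comp (measurable_age j)
  have hm2 : Measurable fun o : Offspring => if (o j).2 = true then (1 : ℝ≥0∞) else 0 :=
    hb.comp (measurable_pi_apply j).snd
  have hm3 : Measurable fun o : Offspring => f (o j).1 * (if (o j).2 = true then (1 : ℝ≥0∞) else 0) :=
    hm1.mul hm2
  rw [offspringLaw, lintegral_map hm1 measurable_offspringOfClocks,
    lintegral_map hm3 measurable_offspringOfClocks]
  simp only [offspringOfClocks_apply, chain_succ]
  have hY := measurable_chain_awayFrom (le_refl j)
  have hf2 : Measurable fun y : (ℝ × ℕ) × (ℝ × Bool) => f (chainStep y.1 y.2).1 := hf.comp hcs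
  have hf3 : Measurable fun y : (ℝ × ℕ) × (ℝ × Bool) =>
      f (chainStep y.1 y.2).1 * (if y.2.2 = true then 1 else 0) :=
    hf2.mul (hb.comp measurable_snd.snd)
  have e1 := lintegral_clocksLaw_coord h0 h1 hY hf2
  have e2 := lintegral_clocksLaw_coord h0 h1 hY hf3
  simp only at e1 e2
  change ∫⁻ ω, _ ∂(clocksLaw p) = _ * ∫⁻ ω, _ ∂(clocksLaw p)
  rw [e1, e2, ← lintegral_const_mul]
  · refine lintegral_congr fun ω => ?_
    generalize chain ω j = s
    have hs2 : Measurable fun x => f (chainStep s x).1 :=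
      hf2.comp ((measurable_const (a := s)).prodMk measurable_id)
    have hs3 : Measurable fun x => f (chainStep s x).1 * (if x.2 = true then 1 else 0) :=
      hf3.comp ((measurable_const (a := s)).prodMk measurable_id)
    rw [lintegral_clockLaw h0 h1 hs2, lintegral_clockLaw h0 h1 hs3]
    simp only [Bool.false_eq_true, if_false, if_true, mul_zero, mul_one, lintegral_zero, zero_add,
      chainStep, ← add_mul, ← ENNReal.ofReal_add h0 (sub_nonneg.2 h1), add_sub_cancel,
      ENNReal.ofReal_one, one_mul]
  · have := isProbabilityMeasure_clockLaw h0 h1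
    exact (Measurable.lintegral_prod_right' (ν := clockLaw p) hf2).comp (measurable_chain j)

/-! ### Birth times in the tree -/

/-- A vertex is the progenitor, or is given by its mother and its rank among her children. -/
def vertexEquiv : Unit ⊕ (Vertex × ℕ) ≃ Vertex where
  toFun := Sum.elim (fun _ => []) fun y => y.2 :: y.1
  invFun
    | [] => Sum.inl ()
    | j :: v => Sum.inr (v, j)
  left_inv := by rintro (_ | ⟨v, j⟩) <;> rfl
  right_inv := by rintro (_ | ⟨j, v⟩) <;> rfl

theorem tsum_vertex (g : Vertex → ℝ≥0∞) : ∑' v, g v = g [] + ∑' v, ∑' j : ℕ, g (j :: v) := by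
  rw [← vertexEquiv.tsum_eq g, Summable.tsum_sum ENNReal.summable ENNReal.summable,
    ENNReal.tsum_prod', tsum_fintype]
  simp [vertexEquiv]

section Tree

variable {Ω : Type*}

/-- The birth time of `v` as a random variable. -/
def birth (ξ : Vertex → Ω → Offspring) (v : Vertex) (ω : Ω) : ℝ := birthTime (fun u => ξ u ω) v

@[simp] theorem birth_nil (ξ : Vertex → Ω → Offspring) (ω : Ω) : birth ξ [] ω = 0 := rfl

theorem birth_cons (ξ : Vertex → Ω → Offspring) (j : ℕ) (v : Vertex) (ω : Ω) :
    birth ξ (j :: v) ω = birth ξ v ω + (ξ v ω j).1 := rfl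

/-- A birth time reads the offspring processes of strict ancestors only, and these are shorter
labels than `w`. The case `v = w` is included: the birth time of a vertex does not involve its own
offspring. -/
theorem measurable_birth_awayFrom (ξ : Vertex → Ω → Offspring) {v w : Vertex}
    (h : v.length ≤ w.length) : Measurable[awayFrom ξ w] (birth ξ v) := by
  induction v with
  | nil => exact measurable_const
  | cons j v ih =>
    have hl : v.length < w.length := by simpa using h
    have hne : v ≠ w := by rintro rfl; exact lt_irrefl _ hl
    exact (ih hl.le).add ((measurable_age j).comp (measurable_awayFrom hne))

variable [MeasurableSpace Ω] {μ : Measure Ω} {p : ℝ} {ξ : Vertex → Ω → Offspring}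

theorem IsBranchingProcess.measurable_birth (hξ : IsBranchingProcess μ p ξ) (v : Vertex) :
    Measurable (birth ξ v) :=
  (measurable_birth_awayFrom ξ le_rfl).mono (awayFrom_le hξ.measurable v) le_rfl

theorem IsBranchingProcess.lintegral_awayFrom [IsProbabilityMeasure μ]
    (hξ : IsBranchingProcess μ p ξ) {S : Type*} [MeasurableSpace S] {v : Vertex} {Y : Ω → S}
    (hY : Measurable[awayFrom ξ v] Y) {f : S × Offspring → ℝ≥0∞} (hf : Measurable f) :
    ∫⁻ ω, f (Y ω, ξ v ω) ∂μ = ∫⁻ ω, ∫⁻ o, f (Y ω, o) ∂(offspringLaw p) ∂μ := by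
  rw [SuperstarBP.lintegral_awayFrom hξ.measurable hξ.indep hY hf, hξ.law]

theorem IsBranchingProcess.ae_forall_vertex (hξ : IsBranchingProcess μ p ξ) {P : Offspring → Prop}
    (h : ∀ᵐ o ∂(offspringLaw p), P o) : ∀ᵐ ω ∂μ, ∀ v, P (ξ v ω) := by
  rw [ae_all_iff]
  intro v
  rw [← hξ.law v] at h
  exact ae_of_ae_map (hξ.measurable v).aemeasurable h

theorem lintegral_offspringLaw_exp {l : ℝ} (h0 : 0 ≤ p) (h1 : p ≤ 1) (hl : 1 - p < l) :
    ∫⁻ o, ∑' j, expE (-(l * (o j).1)) ∂(offspringLaw p) = ENNReal.ofReal (1 / (l - (1 - p))) := by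
  rw [lintegral_offspringLaw_tsum h0 h1 hl (f := fun s => expE (-(l * s))) (by fun_prop)
    ENNReal.one_ne_top (by simp)]
  have h := expTail_exp hl 1 0
  simpa [expTail] using h

theorem IsBranchingProcess.lintegral_children_exp [IsProbabilityMeasure μ]
    (hξ : IsBranchingProcess μ p ξ) (h0 : 0 ≤ p) (h1 : p ≤ 1) {l : ℝ} (hl : 1 - p < l)
    (v : Vertex) :
    ∑' j : ℕ, ∫⁻ ω, expE (-(l * birth ξ (j :: v) ω)) ∂μ =
      ENNReal.ofReal (1 / (l - (1 - p))) * ∫⁻ ω, expE (-(l * birth ξ v ω)) ∂μ := by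
  have hb := hξ.measurable_birth v
  have hbj : ∀ j : ℕ, AEMeasurable (fun ω => expE (-(l * birth ξ (j :: v) ω))) μ := fun j =>
    (measurable_expE.comp ((hξ.measurable_birth (j :: v)).const_mul l).neg).aemeasurable
  rw [← lintegral_tsum hbj]
  have hsum : Measurable fun o : Offspring => ∑' j, expE (-(l * (o j).1)) :=
    Measurable.tsum fun j => measurable_expE.comp ((measurable_age j).const_mul l).neg
  have hf : Measurable fun y : ℝ × Offspring => expE (-(l * y.1)) * ∑' j, expE (-(l * (y.2 j).1)) :=
    (measurable_expE.comp (measurable_fst.const_mul l).neg).mul (hsum.comp measurable_snd)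
  have h := hξ.lintegral_awayFrom (measurable_birth_awayFrom ξ (le_refl v.length)) hf
  simp only [← ENNReal.tsum_mul_left, ← expE_add] at h
  have e : ∀ ω, ∑' j : ℕ, expE (-(l * birth ξ (j :: v) ω)) =
      ∑' j : ℕ, expE (-(l * birth ξ v ω) + -(l * (ξ v ω j).1)) := by
    intro ω
    refine tsum_congr fun j => ?_
    rw [birth_cons]; congr 1; ring
  rw [lintegral_congr e, h]
  have hm : Measurable fun ω => expE (-(l * birth ξ v ω)) := by fun_prop
  rw [← lintegral_const_mul _ hm]
  refine lintegral_congr fun ω => ?_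
  simp only [expE_add, ENNReal.tsum_mul_left]
  rw [lintegral_const_mul _ hsum, lintegral_offspringLaw_exp h0 h1 hl, mul_comm]

/-- Summed by generations this is a geometric series with ratio 1/(l - (1-p)), which is below 1
exactly when l > 2 - p. -/
theorem IsBranchingProcess.tsum_lintegral_exp_ne_top [IsProbabilityMeasure μ]
    (hξ : IsBranchingProcess μ p ξ) (h0 : 0 ≤ p) (h1 : p ≤ 1) {l : ℝ} (hl : 2 - p < l) :
    ∑' v, ∫⁻ ω, expE (-(l * birth ξ v ω)) ∂μ ≠ ∞ := by
  set r := ENNReal.ofReal (1 / (l - (1 - p))) with hr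
  set g : Vertex → ℝ≥0∞ := fun v => ∫⁻ ω, expE (-(l * birth ξ v ω)) ∂μ with hg
  set S : ℕ → ℝ≥0∞ := fun n => ∑' v : Vertex, if v.length = n then g v else 0 with hS
  have hS0 : S 0 = 1 := by
    simp only [hS]
    rw [tsum_eq_single []]
    · simp [hg]
    · intro v hv
      rw [if_neg]
      simpa using hv
  have hSs : ∀ n, S (n + 1) = r * S n := by
    intro n
    simp only [hS]
    rw [tsum_vertex, ← ENNReal.tsum_mul_left]
    simp only [List.length_nil, List.length_cons, add_left_inj]
    rw [if_neg (by omega), zero_add]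
    refine tsum_congr fun v => ?_
    split_ifs
    · exact hξ.lintegral_children_exp h0 h1 (by linarith) v
    · simp
  have hSn : ∀ n, S n = r ^ n := by
    intro n
    induction n with
    | zero => simpa using hS0
    | succ n ih => rw [hSs, ih, pow_succ']
  have htot : ∑' v, g v = ∑' n, S n := by
    simp only [hS]
    rw [ENNReal.tsum_comm]
    refine tsum_congr fun v => ?_
    rw [tsum_eq_single v.length fun n hn => if_neg (Ne.symm hn)]
    simp
  rw [htot]
  simp only [hSn]
  rw [ENNReal.tsum_geometric]
  refine ENNReal.inv_ne_top.2 (tsub_pos_of_lt ?_).ne'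
  rw [hr, ← ENNReal.ofReal_one]
  refine (ENNReal.ofReal_lt_ofReal_iff one_pos).2 ?_
  rw [div_lt_one (by linarith)]
  linarith

theorem IsBranchingProcess.ae_finite_population [IsProbabilityMeasure μ]
    (hξ : IsBranchingProcess μ p ξ) (h0 : 0 ≤ p) (h1 : p ≤ 1) :
    ∀ᵐ ω ∂μ, ∀ t, (population (fun v => ξ v ω) t).Finite := by
  have h : ∀ n : ℕ, ∀ᵐ ω ∂μ, (population (fun v => ξ v ω) n).Finite := by
    intro n
    -- Markov's inequality for e^{-3σ}, before Borel–Cantelli; any exponent above 2 - p would do.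
    have hle : ∀ v, μ {ω | birth ξ v ω ≤ n} ≤ expE (3 * n) * ∫⁻ ω, expE (-(3 * birth ξ v ω)) ∂μ := by
      intro v
      have hm := hξ.measurable_birth v
      have hset : MeasurableSet {ω | birth ξ v ω ≤ n} := measurableSet_le hm measurable_const
      rw [← lintegral_indicator_one hset, ← lintegral_const_mul _ (by fun_prop)]
      refine lintegral_mono fun ω => ?_
      by_cases hω : birth ξ v ω ≤ n
      · simp only [Set.indicator, Set.mem_ofPred_eq, hω, if_true, Pi.one_apply]
        rw [← expE_add, ← expE_zero]
        exact expE_le_expE (by linarith)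
      · simp [Set.indicator, hω]
    have hsum : ∑' v, μ {ω | birth ξ v ω ≤ n} ≠ ∞ := by
      refine ne_top_of_le_ne_top ?_ (ENNReal.tsum_le_tsum hle)
      rw [ENNReal.tsum_mul_left]
      exact ENNReal.mul_ne_top (expE_ne_top _)
        (hξ.tsum_lintegral_exp_ne_top h0 h1 (by linarith))
    exact ae_finite_setOfPred_mem hsum
  filter_upwards [ae_all_iff.2 h] with ω hω t
  obtain ⟨n, hn⟩ := exists_nat_ge t
  exact (hω n).subset fun v (hv : _ ≤ t) => (le_trans hv hn : _ ≤ (n : ℝ))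

/-- With u the mother of `w`, a coincidence prescribes the age of u at a birth by quantities
independent of the offspring of u, and ages have no atoms. This fails only when `v` is a sibling of
`w`, and then the strict order of the ages decides. -/
theorem IsBranchingProcess.ae_birth_ne [IsProbabilityMeasure μ]
    (hξ : IsBranchingProcess μ p ξ) (hp : 0 < p) (h1 : p ≤ 1) {v w : Vertex}
    (hlen : v.length ≤ w.length) (hne : v ≠ w) : ∀ᵐ ω ∂μ, birth ξ v ω ≠ birth ξ w ω := by
  cases w with
  | nil => simp at hlen; exact absurd hlen hne
  | cons j u =>
    have hind : Measurable[awayFrom ξ u] (birth ξ v) →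
        ∀ᵐ ω ∂μ, birth ξ v ω ≠ birth ξ (j :: u) ω := by
      intro hm
      have hf : Measurable fun y : (ℝ × ℝ) × Offspring =>
          Set.indicator {y : (ℝ × ℝ) × Offspring | y.1.1 = y.1.2 + (y.2 j).1}
            (fun _ => (1 : ℝ≥0∞)) y := by
        refine measurable_const.indicator (measurableSet_eq_fun measurable_fst.fst ?_)
        exact measurable_fst.snd.add ((measurable_age j).comp measurable_snd)
      have h := hξ.lintegral_awayFrom
        (hm.prodMk (measurable_birth_awayFrom ξ (le_refl u.length))) hf
      have hz : ∀ ω, ∫⁻ o, Set.indicator {y : (ℝ × ℝ) × Offspring | y.1.1 = y.1.2 + (y.2 j).1}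
          (fun _ => (1 : ℝ≥0∞)) ((birth ξ v ω, birth ξ u ω), o) ∂(offspringLaw p) = 0 := by
        intro ω
        have hset : MeasurableSet {o : Offspring | (o j).1 = birth ξ v ω - birth ξ u ω} :=
          measurableSet_eq_fun (measurable_age j) measurable_const
        rw [← offspringLaw_age_eq hp.le h1 j (birth ξ v ω - birth ξ u ω),
          ← lintegral_indicator_one hset]
        refine lintegral_congr fun o => ?_
        simp only [Set.indicator, Set.mem_ofPred_eq, Pi.one_apply]
        congr 1
        rw [eq_sub_iff_add_eq, add_comm]
        exact propext eq_comm
      simp only [hz, lintegral_zero] at h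
      rw [lintegral_eq_zero_iff] at h
      · filter_upwards [h] with ω hω heq
        simp [Set.indicator, ← birth_cons, heq] at hω
      · exact hf.comp (((hξ.measurable_birth v).prodMk (hξ.measurable_birth u)).prodMk
          (hξ.measurable u))
    cases v with
    | nil => exact hind measurable_const
    | cons i v =>
      by_cases hvu : v = u
      · subst hvu
        have hij : i ≠ j := fun h => hne (by rw [h])
        filter_upwards [hξ.ae_forall_vertex (ae_isRegularOffspring hp h1)] with ω hω heq
        rw [birth_cons, birth_cons, add_right_inj] at heq
        exact hij ((hω v).strictMono.injective heq)
      · refine hind ?_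
        have hl : v.length ≤ u.length := by simpa using hlen
        exact (measurable_birth_awayFrom ξ hl).add ((measurable_age i).comp
          (measurable_awayFrom hvu))

theorem IsRegularOffspring.discounted {p : ℝ} {o : Offspring} (h : IsRegularOffspring p o) :
    Summable fun j => Real.exp (-(2 - p) * (o j).1) := by
  refine Summable.of_nonneg_of_le (fun _ => (Real.exp_pos _).le) (fun j => ?_) h.summable
  exact Real.exp_le_exp.2 (by nlinarith [h.pos j])

theorem IsBranchingProcess.ae_isRegular [IsProbabilityMeasure μ]
    (hξ : IsBranchingProcess μ p ξ) (hp : 0 < p) (h1 : p ≤ 1) :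
    ∀ᵐ ω ∂μ, IsRegular p (fun v => ξ v ω) := by
  have hinj : ∀ᵐ ω ∂μ, ∀ v w, v ≠ w → birth ξ v ω ≠ birth ξ w ω := by
    rw [ae_all_iff]; intro v
    rw [ae_all_iff]; intro w
    by_cases hne : v = w
    · exact Eventually.of_forall fun ω h => absurd hne h
    rcases le_total v.length w.length with hl | hl
    · filter_upwards [hξ.ae_birth_ne hp h1 hl hne] with ω hω _ using hω
    · filter_upwards [hξ.ae_birth_ne hp h1 hl (Ne.symm hne)] with ω hω _ using hω.symm
  filter_upwards [hinj, hξ.ae_finite_population hp.le h1,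
    hξ.ae_forall_vertex (ae_isRegularOffspring hp h1)] with ω h2 h3 h4
  exact ⟨h3, fun v w hvw => by_contra fun hne => h2 v w hne hvw, fun v => (h4 v).discounted⟩

end Tree

section

/-! ### Sums of centred contributions of the vertices -/

/-- The random variable which dominates the contribution of one vertex. -/
def envelope (p : ℝ) (o : Offspring) : ℝ≥0∞ := 1 + ∑' j, expE (-((3 / 2 - p) * (o j).1))

theorem measurable_envelope (p : ℝ) : Measurable (envelope p) :=
  measurable_const.add (Measurable.tsum fun j =>
    measurable_expE.comp ((measurable_age j).const_mul _).neg)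

theorem lintegral_sq_envelope_ne_top {p : ℝ} (hp : 0 < p) (hp1 : p ≤ 1) :
    ∫⁻ o, envelope p o ^ 2 ∂(offspringLaw p) ≠ ∞ := by
  have := isProbabilityMeasure_offspringLaw hp.le hp1
  set S : Offspring → ℝ≥0∞ := fun o => ∑' j, expE (-((3 / 2 - p) * (o j).1)) with hS
  have h : ∀ o, envelope p o ^ 2 ≤ 4 + 4 * S o ^ 2 := by
    intro o
    change (1 + S o) ^ 2 ≤ _
    rcases le_total (S o) 1 with h | h
    · calc (1 + S o) ^ 2 ≤ (1 + 1) ^ 2 := by gcongr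
        _ = 4 := by norm_num
        _ ≤ _ := le_self_add
    · calc (1 + S o) ^ 2 ≤ (S o + S o) ^ 2 := by gcongr
        _ = 4 * S o ^ 2 := by ring
        _ ≤ _ := le_add_self
  refine ne_top_of_le_ne_top ?_ (lintegral_mono h)
  rw [lintegral_add_left measurable_const, lintegral_const_mul']
  · refine ENNReal.add_ne_top.2 ⟨by simp, ENNReal.mul_ne_top (by simp) ?_⟩
    exact ((lintegral_sq_tsum_le hp hp1).trans_lt ENNReal.ofReal_lt_top).ne
  · simp

/-- A centred function of an offspring process which depends on the birth time of the mother, with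
a bound which makes the sum over all vertices square integrable. -/
structure IsFluctuation (p : ℝ) (Φ : ℝ → Offspring → ℝ) (κ : ℝ≥0∞) : Prop where
  measurable : Measurable (Function.uncurry Φ)
  integral_eq_zero : ∀ s, ∫ o, Φ s o ∂(offspringLaw p) = 0
  bound : ∀ s, ∀ᵐ o ∂(offspringLaw p), ‖Φ s o‖ₑ ≤ κ * expE (-((3 / 2 - p) * s)) * envelope p o

theorem tendsto_sum_map_equiv {V : Type*} (e : ℕ ≃ V) {f : V → ℝ} (hf : Summable f) :
    Tendsto (fun n => ∑ v ∈ (Finset.range n).map e.toEmbedding, f v) atTop (𝓝 (∑' v, f v)) := by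
  have h := (e.summable_iff.2 hf).hasSum.tendsto_sum_nat
  simp only [Finset.sum_map, Equiv.coe_toEmbedding]
  rwa [show ∑' n, (f ∘ e) n = ∑' v, f v from e.tsum_eq f] at h

theorem enorm_sq_eq_ofReal (x : ℝ) : ‖x‖ₑ ^ 2 = ENNReal.ofReal (x ^ 2) := by
  rw [← enorm_pow, Real.enorm_of_nonneg (sq_nonneg x)]

variable {Ω : Type*} [MeasurableSpace Ω] {μ : Measure Ω} {p : ℝ} {ξ : Vertex → Ω → Offspring}

/-- The second moment of the sum of the contributions of all vertices. -/
def momentConst (μ : Measure Ω) (p : ℝ) (ξ : Vertex → Ω → Offspring) : ℝ≥0∞ :=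
  (∑' v, ∫⁻ ω, expE (-((3 - 2 * p) * birth ξ v ω)) ∂μ) * ∫⁻ o, envelope p o ^ 2 ∂(offspringLaw p)

/-- Here p < 1 is decisive: the doubled exponent 3 - 2p must exceed the growth rate 2 - p. -/
theorem IsBranchingProcess.momentConst_ne_top [IsProbabilityMeasure μ]
    (hξ : IsBranchingProcess μ p ξ) (hp : 0 < p) (hp1 : p < 1) : momentConst μ p ξ ≠ ∞ :=
  ENNReal.mul_ne_top (hξ.tsum_lintegral_exp_ne_top hp.le hp1.le (by linarith))
    (lintegral_sq_envelope_ne_top hp hp1.le)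

section Fluctuation

variable {Φ : ℝ → Offspring → ℝ} {κ : ℝ≥0∞}

theorem IsFluctuation.measurable_vertex (hΦ : IsFluctuation p Φ κ) (hξ : IsBranchingProcess μ p ξ)
    (v : Vertex) : Measurable fun ω => Φ (birth ξ v ω) (ξ v ω) :=
  hΦ.measurable.comp ((hξ.measurable_birth v).prodMk (hξ.measurable v))

variable [IsProbabilityMeasure μ]

theorem IsFluctuation.lintegral_sq_le (hΦ : IsFluctuation p Φ κ) (hξ : IsBranchingProcess μ p ξ)
    (v : Vertex) :
    ∫⁻ ω, ‖Φ (birth ξ v ω) (ξ v ω)‖ₑ ^ 2 ∂μ ≤ κ ^ 2 *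
      ((∫⁻ ω, expE (-((3 - 2 * p) * birth ξ v ω)) ∂μ) *
        ∫⁻ o, envelope p o ^ 2 ∂(offspringLaw p)) := by
  have hf : Measurable fun y : ℝ × Offspring => ‖Φ y.1 y.2‖ₑ ^ 2 :=
    (hΦ.measurable.enorm).pow_const 2
  have hm := hξ.measurable_birth v
  rw [hξ.lintegral_awayFrom (measurable_birth_awayFrom ξ (le_refl v.length)) hf,
    ← lintegral_mul_const _ (by fun_prop), ← lintegral_const_mul _ (by fun_prop)]
  refine lintegral_mono fun ω => ?_
  have hme := (measurable_envelope p).pow_const 2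
  rw [← lintegral_const_mul _ hme, ← lintegral_const_mul _ (hme.const_mul _)]
  refine lintegral_mono_ae ?_
  filter_upwards [hΦ.bound (birth ξ v ω)] with o ho
  calc ‖Φ (birth ξ v ω) o‖ₑ ^ 2 ≤
      (κ * expE (-((3 / 2 - p) * birth ξ v ω)) * envelope p o) ^ 2 := by gcongr
    _ = κ ^ 2 * ((expE (-((3 / 2 - p) * birth ξ v ω)) * expE (-((3 / 2 - p) * birth ξ v ω))) *
        envelope p o ^ 2) := by ring
    _ = _ := by rw [← expE_add]; congr 4; ring

theorem IsBranchingProcess.vertex_moment_ne_top (hξ : IsBranchingProcess μ p ξ) (hp : 0 < p)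
    (hp1 : p < 1) (v : Vertex) :
    (∫⁻ ω, expE (-((3 - 2 * p) * birth ξ v ω)) ∂μ) *
        ∫⁻ o, envelope p o ^ 2 ∂(offspringLaw p) ≠ ∞ := by
  refine ne_top_of_le_ne_top (hξ.momentConst_ne_top hp hp1) ?_
  exact mul_le_mul_left (ENNReal.le_tsum v) _

theorem IsFluctuation.memLp (hΦ : IsFluctuation p Φ κ) (hκ : κ ≠ ∞)
    (hξ : IsBranchingProcess μ p ξ) (hp : 0 < p) (hp1 : p < 1) (v : Vertex) :
    MemLp (fun ω => Φ (birth ξ v ω) (ξ v ω)) 2 μ := by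
  have hm := hΦ.measurable_vertex hξ v
  rw [memLp_two_iff_integrable_sq hm.aestronglyMeasurable]
  refine ⟨(hm.pow_const 2).aestronglyMeasurable, ?_⟩
  rw [HasFiniteIntegral]
  simp only [enorm_pow]
  exact (hΦ.lintegral_sq_le hξ v).trans_lt (ENNReal.mul_lt_top (by finiteness)
    (hξ.vertex_moment_ne_top hp hp1 v).lt_top)

/-- Since `w` is no shorter than `v`, both the contribution of `v` and the birth time of `w` are
independent of the offspring of `w`. Integrating the latter out first gives zero by centring. -/
theorem IsFluctuation.integral_mul_eq_zero_of_length_le (hΦ : IsFluctuation p Φ κ) (hκ : κ ≠ ∞)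
    (hξ : IsBranchingProcess μ p ξ) (hp : 0 < p) (hp1 : p < 1) {v w : Vertex} (hne : v ≠ w)
    (hl : v.length ≤ w.length) :
    ∫ ω, Φ (birth ξ v ω) (ξ v ω) * Φ (birth ξ w ω) (ξ w ω) ∂μ = 0 := by
  have := isProbabilityMeasure_offspringLaw hp.le hp1.le
  set Y : Ω → ℝ × ℝ := fun ω => (Φ (birth ξ v ω) (ξ v ω), birth ξ w ω) with hY
  have hYm : Measurable[awayFrom ξ w] Y := by
    refine Measurable.prodMk ?_ (measurable_birth_awayFrom ξ le_rfl)
    exact hΦ.measurable.comp ((measurable_birth_awayFrom ξ hl).prodMk (measurable_awayFrom hne))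
  have hYm' : Measurable Y := hYm.mono (awayFrom_le hξ.measurable w) le_rfl
  have hmap := map_prodMk_of_awayFrom hξ.measurable hξ.indep hYm
  rw [hξ.law] at hmap
  set F : (ℝ × ℝ) × Offspring → ℝ := fun y => y.1.1 * Φ y.1.2 y.2 with hF
  have hFm : Measurable F := measurable_fst.fst.mul
    (hΦ.measurable.comp (measurable_fst.snd.prodMk measurable_snd))
  have hpair : Measurable fun ω => (Y ω, ξ w ω) := hYm'.prodMk (hξ.measurable w)
  have hint : Integrable (fun ω => F (Y ω, ξ w ω)) μ :=
    (hΦ.memLp hκ hξ hp hp1 v).integrable_mul (hΦ.memLp hκ hξ hp hp1 w)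
  have h1 : ∫ ω, F (Y ω, ξ w ω) ∂μ = ∫ y, F y ∂((μ.map Y).prod (offspringLaw p)) := by
    rw [← hmap, integral_map hpair.aemeasurable hFm.aestronglyMeasurable]
  have h2 : Integrable F ((μ.map Y).prod (offspringLaw p)) := by
    rw [← hmap, integrable_map_measure hFm.aestronglyMeasurable hpair.aemeasurable]
    exact hint
  have := Measure.isProbabilityMeasure_map (μ := μ) hYm'.aemeasurable
  change ∫ ω, F (Y ω, ξ w ω) ∂μ = 0
  rw [h1, integral_prod _ h2]
  simp only [hF, integral_const_mul, hΦ.integral_eq_zero, mul_zero, integral_zero]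

theorem IsFluctuation.integral_mul_eq_zero (hΦ : IsFluctuation p Φ κ) (hκ : κ ≠ ∞)
    (hξ : IsBranchingProcess μ p ξ) (hp : 0 < p) (hp1 : p < 1) {v w : Vertex} (hne : v ≠ w) :
    ∫ ω, Φ (birth ξ v ω) (ξ v ω) * Φ (birth ξ w ω) (ξ w ω) ∂μ = 0 := by
  rcases le_total v.length w.length with hl | hl
  · exact hΦ.integral_mul_eq_zero_of_length_le hκ hξ hp hp1 hne hl
  · simp only [mul_comm (Φ (birth ξ v _) _)]
    exact hΦ.integral_mul_eq_zero_of_length_le hκ hξ hp hp1 hne.symm hl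

theorem IsFluctuation.lintegral_sq_sum_le (hΦ : IsFluctuation p Φ κ) (hκ : κ ≠ ∞)
    (hξ : IsBranchingProcess μ p ξ) (hp : 0 < p) (hp1 : p < 1) (s : Finset Vertex) :
    ∫⁻ ω, ‖∑ v ∈ s, Φ (birth ξ v ω) (ξ v ω)‖ₑ ^ 2 ∂μ ≤ κ ^ 2 * momentConst μ p ξ := by
  have hL := hΦ.memLp hκ hξ hp hp1
  have hint : ∀ v w, Integrable
      (fun ω => Φ (birth ξ v ω) (ξ v ω) * Φ (birth ξ w ω) (ξ w ω)) μ :=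
    fun v w => (hL v).integrable_mul (hL w)
  have hsq : ∀ v, ∫⁻ ω, ‖Φ (birth ξ v ω) (ξ v ω)‖ₑ ^ 2 ∂μ =
      ENNReal.ofReal (∫ ω, Φ (birth ξ v ω) (ξ v ω) * Φ (birth ξ v ω) (ξ v ω) ∂μ) := by
    intro v
    rw [ofReal_integral_eq_lintegral_ofReal (hint v v)
      (Eventually.of_forall fun ω => mul_self_nonneg _)]
    simp only [enorm_sq_eq_ofReal]
    simp only [sq]
  have e : ∀ ω, ‖∑ v ∈ s, Φ (birth ξ v ω) (ξ v ω)‖ₑ ^ 2 = ENNReal.ofReal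
      (∑ v ∈ s, ∑ w ∈ s, Φ (birth ξ v ω) (ξ v ω) * Φ (birth ξ w ω) (ξ w ω)) := by
    intro ω
    rw [enorm_sq_eq_ofReal, sq, Finset.sum_mul_sum]
  simp only [e]
  rw [← ofReal_integral_eq_lintegral_ofReal]
  · rw [integral_finsetSum _ fun v _ => integrable_finsetSum _ fun w _ => hint v w]
    have e2 : ∀ v ∈ s, ∫ ω, ∑ w ∈ s, Φ (birth ξ v ω) (ξ v ω) * Φ (birth ξ w ω) (ξ w ω) ∂μ =
        ∫ ω, Φ (birth ξ v ω) (ξ v ω) * Φ (birth ξ v ω) (ξ v ω) ∂μ := by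
      intro v hv
      rw [integral_finsetSum _ fun w _ => hint v w]
      refine Finset.sum_eq_single_of_mem v hv fun w _ hwv => ?_
      exact hΦ.integral_mul_eq_zero hκ hξ hp hp1 hwv.symm
    rw [Finset.sum_congr rfl e2, ENNReal.ofReal_sum_of_nonneg fun v _ =>
      integral_nonneg fun ω => mul_self_nonneg _]
    simp only [← hsq]
    calc _ ≤ ∑ v ∈ s, κ ^ 2 * ((∫⁻ ω, expE (-((3 - 2 * p) * birth ξ v ω)) ∂μ) *
          ∫⁻ o, envelope p o ^ 2 ∂(offspringLaw p)) :=
          Finset.sum_le_sum fun v _ => hΦ.lintegral_sq_le hξ v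
      _ = κ ^ 2 * ((∑ v ∈ s, ∫⁻ ω, expE (-((3 - 2 * p) * birth ξ v ω)) ∂μ) *
          ∫⁻ o, envelope p o ^ 2 ∂(offspringLaw p)) := by
          rw [← Finset.mul_sum, ← Finset.sum_mul]
      _ ≤ _ := by
          unfold momentConst
          gcongr
          exact ENNReal.sum_le_tsum s
  · exact integrable_finsetSum _ fun v _ => integrable_finsetSum _ fun w _ => hint v w
  · refine Eventually.of_forall fun ω => ?_
    simp only [Pi.zero_apply]
    rw [← Finset.sum_mul_sum]
    exact mul_self_nonneg _

/-- Fatou's lemma along an enumeration of the vertices carries the bound from finite sums to the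
full sum. -/
theorem IsFluctuation.lintegral_sq_tsum_le (hΦ : IsFluctuation p Φ κ) (hκ : κ ≠ ∞)
    (hξ : IsBranchingProcess μ p ξ) (hp : 0 < p) (hp1 : p < 1)
    (hsum : ∀ᵐ ω ∂μ, Summable fun v => Φ (birth ξ v ω) (ξ v ω)) :
    ∫⁻ ω, ‖∑' v, Φ (birth ξ v ω) (ξ v ω)‖ₑ ^ 2 ∂μ ≤ κ ^ 2 * momentConst μ p ξ := by
  obtain ⟨e⟩ : Nonempty (ℕ ≃ Vertex) := ⟨(Denumerable.eqv Vertex).symm⟩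
  have hlim : ∀ᵐ ω ∂μ, ‖∑' v, Φ (birth ξ v ω) (ξ v ω)‖ₑ ^ 2 = liminf (fun n =>
      ‖∑ v ∈ (Finset.range n).map e.toEmbedding, Φ (birth ξ v ω) (ξ v ω)‖ₑ ^ 2) atTop := by
    filter_upwards [hsum] with ω hω
    refine (Tendsto.liminf_eq ?_).symm
    exact ((ENNReal.continuous_pow 2).tendsto _).comp
      ((continuous_enorm.tendsto _).comp (tendsto_sum_map_equiv e hω))
  rw [lintegral_congr_ae hlim]
  have hmeas : ∀ n, Measurable fun ω =>
      ‖∑ v ∈ (Finset.range n).map e.toEmbedding, Φ (birth ξ v ω) (ξ v ω)‖ₑ ^ 2 := fun n =>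
    (Finset.measurable_fun_sum _ fun v _ => hΦ.measurable_vertex hξ v).enorm.pow_const 2
  refine (lintegral_liminf_le hmeas).trans ?_
  refine liminf_le_of_frequently_le' (Frequently.of_forall fun n => ?_)
  exact hΦ.lintegral_sq_sum_le hκ hξ hp hp1 _

end Fluctuation

theorem ae_tendsto_zero_of_tsum_lintegral_sq {X : ℕ → Ω → ℝ} (hX : ∀ n, AEMeasurable (X n) μ)
    (h : ∑' n, ∫⁻ ω, ‖X n ω‖ₑ ^ 2 ∂μ ≠ ∞) : ∀ᵐ ω ∂μ, Tendsto (fun n => X n ω) atTop (𝓝 0) := by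
  have hm : ∀ n, AEMeasurable (fun ω => ‖X n ω‖ₑ ^ 2) μ := fun n => (hX n).enorm.pow_const 2
  rw [← lintegral_tsum hm] at h
  filter_upwards [ae_lt_top' (AEMeasurable.tsum hm) h] with ω hω
  have h0 := ENNReal.tendsto_atTop_zero_of_tsum_ne_top hω.ne
  have h1 : Tendsto (fun n => X n ω ^ 2) atTop (𝓝 0) := by
    have := (ENNReal.tendsto_toReal (ENNReal.zero_ne_top)).comp h0
    refine this.congr fun n => ?_
    simp [enorm_sq_eq_ofReal, ENNReal.toReal_ofReal (sq_nonneg _)]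
  have h2 := (Real.continuous_sqrt.tendsto 0).comp h1
  simp only [Real.sqrt_zero] at h2
  rw [tendsto_zero_iff_abs_tendsto_zero]
  exact h2.congr fun n => Real.sqrt_sq_eq_abs _

/-- If the bounds decrease geometrically, the sums over all vertices tend to zero. -/
theorem IsBranchingProcess.ae_tendsto_fluctuation [IsProbabilityMeasure μ]
    (hξ : IsBranchingProcess μ p ξ) (hp : 0 < p) (hp1 : p < 1) {Φ : ℕ → ℝ → Offspring → ℝ}
    {C c : ℝ} (hc : 0 < c)
    (hΦ : ∀ n : ℕ, IsFluctuation p (Φ n) (ENNReal.ofReal C * expE (-(c * n))))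
    (hsum : ∀ n, ∀ᵐ ω ∂μ, Summable fun v => Φ n (birth ξ v ω) (ξ v ω)) :
    ∀ᵐ ω ∂μ, Tendsto (fun n => ∑' v, Φ n (birth ξ v ω) (ξ v ω)) atTop (𝓝 0) := by
  refine ae_tendsto_zero_of_tsum_lintegral_sq (fun n => ?_) ?_
  · obtain ⟨e⟩ : Nonempty (ℕ ≃ Vertex) := ⟨(Denumerable.eqv Vertex).symm⟩
    refine aemeasurable_of_tendsto_metrizable_ae (u := atTop) (f := fun (k : ℕ) ω =>
      ∑ v ∈ (Finset.range k).map e.toEmbedding, Φ n (birth ξ v ω) (ξ v ω)) (fun k => ?_) ?_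
    · exact (Finset.measurable_fun_sum _ fun v _ => (hΦ n).measurable_vertex hξ v).aemeasurable
    · filter_upwards [hsum n] with ω hω
      exact tendsto_sum_map_equiv e hω
  · refine ne_top_of_le_ne_top ?_ (ENNReal.tsum_le_tsum fun n =>
      (hΦ n).lintegral_sq_tsum_le (ENNReal.mul_ne_top ENNReal.ofReal_ne_top (expE_ne_top _))
        hξ hp hp1 (hsum n))
    rw [ENNReal.tsum_mul_right]
    refine ENNReal.mul_ne_top ?_ (hξ.momentConst_ne_top hp hp1)
    have e : ∀ n : ℕ, (ENNReal.ofReal C * expE (-(c * n))) ^ 2 =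
        ENNReal.ofReal C ^ 2 * expE (-(2 * c)) ^ n := by
      intro n
      rw [mul_pow]
      congr 1
      rw [expE, expE, ← ENNReal.ofReal_pow (Real.exp_pos _).le, ← ENNReal.ofReal_pow
        (Real.exp_pos _).le, ← Real.exp_nat_mul, ← Real.exp_nat_mul]
      congr 2; push_cast; ring
    simp only [e]
    rw [ENNReal.tsum_mul_left, ENNReal.tsum_geometric]
    refine ENNReal.mul_ne_top (by finiteness) (ENNReal.inv_ne_top.2 (tsub_pos_of_lt ?_).ne')
    rw [expE, ← ENNReal.ofReal_one]
    refine (ENNReal.ofReal_lt_ofReal_iff one_pos).2 ?_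
    rw [Real.exp_lt_one_iff]
    linarith

end

section

/-! ### The reproduction martingale at fixed times -/

/-- The finite version of `envelope`. -/
def realEnvelope (p : ℝ) (o : Offspring) : ℝ := 1 + ∑' j, Real.exp (-((3 / 2 - p) * (o j).1))

theorem one_le_realEnvelope (p : ℝ) (o : Offspring) : 1 ≤ realEnvelope p o := by
  have : 0 ≤ ∑' j, Real.exp (-((3 / 2 - p) * (o j).1)) := tsum_nonneg fun _ => (Real.exp_pos _).le
  unfold realEnvelope; linarith

theorem IsRegularOffspring.envelope_eq {p : ℝ} {o : Offspring} (h : IsRegularOffspring p o) :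
    envelope p o = ENNReal.ofReal (realEnvelope p o) := by
  rw [realEnvelope, ENNReal.ofReal_add zero_le_one (tsum_nonneg fun _ => (Real.exp_pos _).le),
    ENNReal.ofReal_tsum_of_nonneg (fun _ => (Real.exp_pos _).le) h.summable, ENNReal.ofReal_one]
  rfl

theorem IsFluctuation.of_abs_le {p : ℝ} (hp : 0 < p) (hp1 : p ≤ 1) {Φ : ℝ → Offspring → ℝ}
    {K a : ℝ} (hK : 0 ≤ K) (hm : Measurable (Function.uncurry Φ))
    (hz : ∀ s, ∫ o, Φ s o ∂(offspringLaw p) = 0)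
    (hb : ∀ s o, IsRegularOffspring p o →
      |Φ s o| ≤ K * Real.exp (-a) * Real.exp (-((3 / 2 - p) * s)) * realEnvelope p o) :
    IsFluctuation p Φ (ENNReal.ofReal K * expE (-a)) := by
  refine ⟨hm, hz, fun s => ?_⟩
  filter_upwards [ae_isRegularOffspring hp hp1] with o ho
  rw [ho.envelope_eq, expE, expE, ← ENNReal.ofReal_mul hK, ← ENNReal.ofReal_mul (by positivity),
    ← ENNReal.ofReal_mul (by positivity), ← ofReal_norm]
  exact ENNReal.ofReal_le_ofReal (hb s o ho)

theorem measurable_discountedOffspring (p : ℝ) : Measurable (discountedOffspring p) :=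
  Measurable.tsum fun j => Real.measurable_exp.comp ((measurable_age j).const_mul _)

theorem discountedOffspring_eq_toReal (p : ℝ) (o : Offspring) :
    discountedOffspring p o = (∑' j, expE (-((2 - p) * (o j).1))).toReal := by
  rw [ENNReal.tsum_toReal_eq fun j => expE_ne_top _]
  refine tsum_congr fun j => ?_
  rw [expE, ENNReal.toReal_ofReal (Real.exp_pos _).le, neg_mul]

theorem lintegral_discounted {p : ℝ} (h0 : 0 ≤ p) (h1 : p ≤ 1) :
    ∫⁻ o, ∑' j, expE (-((2 - p) * (o j).1)) ∂(offspringLaw p) = 1 := by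
  rw [lintegral_offspringLaw_exp h0 h1 (by linarith)]
  simp [show 2 - p - (1 - p) = 1 by ring]

theorem measurable_tsum_expE (l : ℝ) : Measurable fun o : Offspring => ∑' j, expE (-(l * (o j).1)) :=
  Measurable.tsum fun j => measurable_expE.comp ((measurable_age j).const_mul _).neg

theorem integrable_discountedOffspring {p : ℝ} (h0 : 0 ≤ p) (h1 : p ≤ 1) :
    Integrable (discountedOffspring p) (offspringLaw p) := by
  have h := integrable_toReal_of_lintegral_ne_top (measurable_tsum_expE (2 - p)).aemeasurable
    (by rw [lintegral_discounted h0 h1]; exact ENNReal.one_ne_top)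
  exact h.congr (Eventually.of_forall fun o => (discountedOffspring_eq_toReal p o).symm)

theorem integral_discountedOffspring {p : ℝ} (h0 : 0 ≤ p) (h1 : p ≤ 1) :
    ∫ o, discountedOffspring p o ∂(offspringLaw p) = 1 := by
  simp only [discountedOffspring_eq_toReal]
  rw [integral_toReal (measurable_tsum_expE (2 - p)).aemeasurable, lintegral_discounted h0 h1]
  · simp
  · exact ae_lt_top (measurable_tsum_expE (2 - p))
      (by rw [lintegral_discounted h0 h1]; exact ENNReal.one_ne_top)

theorem discountedOffspring_nonneg (p : ℝ) (o : Offspring) : 0 ≤ discountedOffspring p o :=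
  tsum_nonneg fun _ => (Real.exp_pos _).le

theorem IsRegularOffspring.abs_discounted_sub_one_le {p : ℝ} {o : Offspring}
    (h : IsRegularOffspring p o) : |discountedOffspring p o - 1| ≤ realEnvelope p o := by
  have h1 : discountedOffspring p o ≤ ∑' j, Real.exp (-((3 / 2 - p) * (o j).1)) :=
    h.discounted.tsum_le_tsum (fun j => Real.exp_le_exp.2 (by nlinarith [h.pos j])) h.summable
  have h2 := discountedOffspring_nonneg p o
  rw [abs_le]
  unfold realEnvelope
  constructor <;> linarith

/-- The contribution of a vertex to the reproduction martingale. -/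
def reproTerm (p s : ℝ) (o : Offspring) : ℝ :=
  Real.exp (-(2 - p) * s) * (discountedOffspring p o - 1)

/-- The contributions to the reproduction martingale of the vertices born between `a` and `b`. -/
def reproIncrement (p a b s : ℝ) (o : Offspring) : ℝ :=
  if a < s ∧ s ≤ b then reproTerm p s o else 0

theorem measurable_reproIncrement (p a b : ℝ) :
    Measurable (Function.uncurry (reproIncrement p a b)) := by
  refine Measurable.ite ?_ ?_ measurable_const
  · exact (measurableSet_lt measurable_const measurable_fst).inter
      (measurableSet_le measurable_fst measurable_const)
  · exact (Real.measurable_exp.comp (measurable_fst.const_mul _)).mul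
      (((measurable_discountedOffspring p).comp measurable_snd).sub_const 1)

/-- Write e^{-(2-p)s} = e^{-s/2} e^{-(3/2-p)s}. On s > a the first factor is below e^{-a/2}; of this
gain, c pays for the prefactor and d remains as decay. -/
theorem isFluctuation_reproIncrement {p : ℝ} (hp : 0 < p) (hp1 : p ≤ 1) {a b d : ℝ}
    (c : ℝ) (hcd : c + d ≤ a / 2) :
    IsFluctuation p (fun s o => Real.exp c * reproIncrement p a b s o)
      (ENNReal.ofReal 1 * expE (-d)) := by
  refine IsFluctuation.of_abs_le hp hp1 zero_le_one
    ((measurable_reproIncrement p a b).const_mul _) (fun s => ?_) (fun s o ho => ?_)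
  · have := isProbabilityMeasure_offspringLaw hp.le hp1
    rw [integral_const_mul]
    unfold reproIncrement
    split_ifs
    · simp only [reproTerm]
      rw [integral_const_mul, integral_sub (integrable_discountedOffspring hp.le hp1)
        (integrable_const 1), integral_discountedOffspring hp.le hp1]
      simp
    · simp
  · have hE := one_le_realEnvelope p o
    unfold reproIncrement
    split_ifs with hs
    · rw [reproTerm, abs_mul, abs_mul, abs_of_pos (Real.exp_pos _), abs_of_pos (Real.exp_pos _),
        ← mul_assoc, ← Real.exp_add, one_mul, ← Real.exp_add]
      refine mul_le_mul (Real.exp_le_exp.2 ?_) ho.abs_discounted_sub_one_le (abs_nonneg _)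
        (Real.exp_pos _).le
      linarith [hs.1]
    · rw [mul_zero, abs_zero]
      positivity

/-- Realizations with the almost sure properties which are used. -/
structure IsGood (p : ℝ) (x : Vertex → Offspring) : Prop where
  regular : IsRegular p x
  offspring : ∀ v, IsRegularOffspring p (x v)

/-- Populations are finite, so sums over the vertices born by a given time are finite sums. -/
theorem IsGood.summable_of_population {p : ℝ} {x : Vertex → Offspring} (hx : IsGood p x) (t : ℝ)
    {f : Vertex → ℝ} (hf : ∀ v, t < birthTime x v → f v = 0) : Summable f :=
  summable_of_ne_finset_zero (s := (hx.regular.finite t).toFinset) fun v hv => hf v (by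
    simpa [population] using hv)

/-- The reproduction martingale at the time `t`. -/
def reproAt (p : ℝ) (x : Vertex → Offspring) (t : ℝ) : ℝ :=
  1 + ∑' v, if birthTime x v ≤ t then reproTerm p (birthTime x v) (x v) else 0

theorem IsGood.reproAt_sub {p : ℝ} {x : Vertex → Offspring} (hx : IsGood p x) {a b : ℝ}
    (hab : a ≤ b) :
    reproAt p x b - reproAt p x a = ∑' v, reproIncrement p a b (birthTime x v) (x v) := by
  unfold reproAt
  rw [add_sub_add_left_eq_sub, ← Summable.tsum_sub]
  · refine tsum_congr fun v => ?_
    unfold reproIncrement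
    by_cases h1 : birthTime x v ≤ a
    · simp [h1, h1.trans hab]
    · simp [h1, not_le.1 h1]
  · exact hx.summable_of_population b fun v hv => if_neg (not_le.2 hv)
  · exact hx.summable_of_population a fun v hv => if_neg (not_le.2 hv)

variable {Ω : Type*} [MeasurableSpace Ω] {μ : Measure Ω} {p : ℝ} {ξ : Vertex → Ω → Offspring}

theorem IsBranchingProcess.aemeasurable_reproAt (hξ : IsBranchingProcess μ p ξ) (t : ℝ) :
    AEMeasurable (fun ω => reproAt p (fun v => ξ v ω) t) μ := by
  refine (Measurable.const_add (Measurable.tsum fun v => ?_) 1).aemeasurable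
  have hb := hξ.measurable_birth v
  refine Measurable.ite (measurableSet_le hb measurable_const) ?_ measurable_const
  exact (Real.measurable_exp.comp (hb.const_mul _)).mul
    (((measurable_discountedOffspring p).comp (hξ.measurable v)).sub_const 1)

variable [IsProbabilityMeasure μ]

theorem IsBranchingProcess.ae_isGood (hξ : IsBranchingProcess μ p ξ) (hp : 0 < p) (hp1 : p ≤ 1) :
    ∀ᵐ ω ∂μ, IsGood p fun v => ξ v ω := by
  filter_upwards [hξ.ae_isRegular hp hp1, hξ.ae_forall_vertex (ae_isRegularOffspring hp hp1)]
    with ω h1 h2 using ⟨h1, h2⟩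

theorem IsBranchingProcess.ae_summable_of_population (hξ : IsBranchingProcess μ p ξ) (hp : 0 < p)
    (hp1 : p ≤ 1) (t : ℝ) {Φ : ℝ → Offspring → ℝ} (h : ∀ s o, t < s → Φ s o = 0) :
    ∀ᵐ ω ∂μ, Summable fun v => Φ (birth ξ v ω) (ξ v ω) := by
  filter_upwards [hξ.ae_isGood hp hp1] with ω hω
  exact hω.summable_of_population t fun v hv => h _ _ hv

theorem IsBranchingProcess.ae_exists_tendsto_reproAt (hξ : IsBranchingProcess μ p ξ) (hp : 0 < p)
    (hp1 : p < 1) :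
    ∀ᵐ ω ∂μ, ∃ l, Tendsto (fun n : ℕ => reproAt p (fun v => ξ v ω) n) atTop (𝓝 l) := by
  -- The available decay e^{-n/2} is split evenly: the increments multiplied by e^{n/4} still tend
  -- to zero, so the increments themselves are O(e^{-n/4}) and summable.
  have h := hξ.ae_tendsto_fluctuation hp hp1 (c := 1 / 4) (C := 1) (by norm_num)
    (Φ := fun n s o => Real.exp (n / 4) * reproIncrement p n (n + 1) s o)
    (fun n => isFluctuation_reproIncrement hp hp1.le (a := n) (b := n + 1) (d := 1 / 4 * n)
      (n / 4) (by linarith))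
    (fun n => hξ.ae_summable_of_population hp hp1.le (n + 1)
      (Φ := fun s o => Real.exp (n / 4) * reproIncrement p n (n + 1) s o) fun s o hs => by
      simp [reproIncrement, hs])
  filter_upwards [h, hξ.ae_isGood hp hp1.le] with ω hω hgood
  set R : ℕ → ℝ := fun n => reproAt p (fun v => ξ v ω) n with hR
  have hinc : ∀ n : ℕ, ∑' v, Real.exp (n / 4) * reproIncrement p n (n + 1) (birth ξ v ω) (ξ v ω) =
      Real.exp (n / 4) * (R (n + 1) - R n) := by
    intro n
    have h := hgood.reproAt_sub (a := n) (b := n + 1) (by linarith)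
    rw [tsum_mul_left, hR]
    simp only [Nat.cast_add, Nat.cast_one]
    rw [h]; rfl
  simp only [hinc] at hω
  have hO : (fun n => R (n + 1) - R n) =O[atTop] fun n : ℕ => Real.exp (-(1 / 4)) ^ n := by
    refine Asymptotics.IsBigO.of_bound 1 ?_
    filter_upwards [(tendsto_zero_iff_abs_tendsto_zero _).1 hω |>.eventually_le_const one_pos]
      with n hn
    simp only [Function.comp, abs_mul, abs_of_pos (Real.exp_pos _)] at hn
    rw [Real.norm_eq_abs, Real.norm_eq_abs, ← Real.exp_nat_mul, abs_of_pos (Real.exp_pos _)]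
    have e : Real.exp ((n : ℝ) * -(1 / 4)) = (Real.exp (n / 4))⁻¹ := by
      rw [← Real.exp_neg]; congr 1; ring
    rw [e, one_mul, ← one_div, le_div_iff₀ (Real.exp_pos _), mul_comm]
    exact hn
  have hsum : Summable fun n => R (n + 1) - R n :=
    summable_of_isBigO_nat (summable_geometric_of_lt_one (Real.exp_pos _).le
      (by rw [Real.exp_lt_one_iff]; norm_num)) hO
  have ht := hsum.hasSum.tendsto_sum_nat
  simp only [Finset.sum_range_sub] at ht
  exact ⟨_, (ht.add_const (R 0)).congr fun n => by ring⟩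

/-- Comparing the time n/k with its integer part makes the limit along every lattice the same random
variable. -/
theorem IsBranchingProcess.ae_tendsto_reproAt_sub (hξ : IsBranchingProcess μ p ξ) (hp : 0 < p)
    (hp1 : p < 1) {k : ℕ} (hk : 0 < k) :
    ∀ᵐ ω ∂μ, Tendsto (fun n : ℕ => reproAt p (fun v => ξ v ω) (n / k) -
      reproAt p (fun v => ξ v ω) ((n / k : ℕ) : ℝ)) atTop (𝓝 0) := by
  have hk' : (0:ℝ) < k := Nat.cast_pos.2 hk
  have h := hξ.ae_tendsto_fluctuation hp hp1 (c := 1 / (2 * k)) (C := Real.exp (1 / 2))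
    (by positivity)
    (Φ := fun n s o => reproIncrement p ((n / k : ℕ) : ℝ) (n / k) s o)
    (fun n => by
      -- Division of natural numbers is the integer part here. Hence half of it is at least n/(2k) -
      -- 1/2, and the loss 1/2 becomes the constant e^{1/2}.
      have hlt : (n : ℝ) / k < ((n / k : ℕ) : ℝ) + 1 := by
        rw [div_lt_iff₀ hk']
        have := Nat.lt_div_mul_add (a := n) hk
        have h2 : n < (n / k + 1) * k := by rw [add_mul, one_mul]; exact this
        exact_mod_cast h2
      have h := isFluctuation_reproIncrement hp hp1.le (a := ((n / k : ℕ) : ℝ)) (b := n / k)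
        (d := -(1 / 2) + 1 / (2 * k) * n) 0 (by
          have : 1 / (2 * k) * (n : ℝ) = n / k / 2 := by field_simp
          linarith)
      have e : ENNReal.ofReal 1 * expE (-(-(1 / 2) + 1 / (2 * k) * n)) =
          ENNReal.ofReal (Real.exp (1 / 2)) * expE (-(1 / (2 * k) * n)) := by
        rw [ENNReal.ofReal_one, one_mul, neg_add, neg_neg, expE_add]
        rfl
      rw [e] at h
      simpa using h)
    (fun n => hξ.ae_summable_of_population hp hp1.le (n / k)
      (Φ := fun s o => reproIncrement p ((n / k : ℕ) : ℝ) (n / k) s o) fun s o hs => by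
      simp [reproIncrement, hs])
  filter_upwards [h, hξ.ae_isGood hp hp1.le] with ω hω hgood
  refine hω.congr fun n => ?_
  rw [hgood.reproAt_sub]
  · rfl
  · exact Nat.cast_div_le

/-- The limit of the reproduction martingale along all the lattices of times. -/
theorem IsBranchingProcess.exists_tendsto_reproAt (hξ : IsBranchingProcess μ p ξ) (hp : 0 < p)
    (hp1 : p < 1) :
    ∃ R : Ω → ℝ, Measurable R ∧ ∀ k : ℕ, 0 < k →
      ∀ᵐ ω ∂μ, Tendsto (fun n : ℕ => reproAt p (fun v => ξ v ω) (n / k)) atTop (𝓝 (R ω)) := by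
  obtain ⟨R, hR, hlim⟩ := measurable_limit_of_tendsto_metrizable_ae
    (fun n : ℕ => hξ.aemeasurable_reproAt n) (hξ.ae_exists_tendsto_reproAt hp hp1)
  refine ⟨R, hR, fun k hk => ?_⟩
  filter_upwards [hlim, hξ.ae_tendsto_reproAt_sub hp hp1 hk] with ω h1 h2
  have h3 := h2.add (h1.comp (Nat.tendsto_div_const_atTop hk.ne'))
  rw [zero_add] at h3
  exact h3.congr fun n => by simp

end

/-! ### The renewal equation -/

/-- A non-negative function on `[0, ∞)`, extended by zero, which is at most `C e^{-s}`. -/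
structure IsDiscounted (C : ℝ) (H : ℝ → ℝ) : Prop where
  measurable : Measurable H
  neg : ∀ s, s < 0 → H s = 0
  nonneg : ∀ s, 0 ≤ H s
  le : ∀ s, 0 ≤ s → H s ≤ C * Real.exp (-s)

/-- The solution of the renewal equation whose renewal distribution is exponential. -/
def renew (H : ℝ → ℝ) (u : ℝ) : ℝ := H u + ∫ s in Set.Ioc 0 u, H s

/-- The limit of `renew`. -/
def renewLimit (H : ℝ → ℝ) : ℝ := ∫ s in Set.Ioi 0, H s

namespace IsDiscounted

variable {C : ℝ} {H : ℝ → ℝ}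

theorem const_nonneg (h : IsDiscounted C H) : 0 ≤ C := by
  have := (h.nonneg 0).trans (h.le 0 le_rfl)
  simpa using this

theorem integrableOn (h : IsDiscounted C H) {a : ℝ} (ha : 0 ≤ a) : IntegrableOn H (Set.Ioi a) := by
  have hi : IntegrableOn (fun s => C * Real.exp (-s)) (Set.Ioi a) := by
    have h1 : IntegrableOn (fun s => Real.exp (-s)) (Set.Ioi a) := by
      simpa using integrableOn_exp_mul_Ioi (a := -1) (by norm_num) a
    exact h1.const_mul C
  refine Integrable.mono' hi h.measurable.aestronglyMeasurable ?_
  filter_upwards [ae_restrict_mem measurableSet_Ioi] with s hs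
  rw [Real.norm_of_nonneg (h.nonneg s)]
  exact h.le s (ha.trans (le_of_lt hs))

theorem integral_Ioi_le (h : IsDiscounted C H) {a : ℝ} (ha : 0 ≤ a) :
    ∫ s in Set.Ioi a, H s ≤ C * Real.exp (-a) := by
  have hi : IntegrableOn (fun s => C * Real.exp (-s)) (Set.Ioi a) := by
    have h1 : IntegrableOn (fun s => Real.exp (-s)) (Set.Ioi a) := by
      simpa using integrableOn_exp_mul_Ioi (a := -1) (by norm_num) a
    exact h1.const_mul C
  calc _ ≤ ∫ s in Set.Ioi a, C * Real.exp (-s) :=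
        setIntegral_mono_on (h.integrableOn ha) hi measurableSet_Ioi
          fun s hs => h.le s (ha.trans (le_of_lt hs))
    _ = _ := by rw [integral_const_mul, integral_exp_neg_Ioi]

theorem renew_of_neg (h : IsDiscounted C H) {u : ℝ} (hu : u < 0) : renew H u = 0 := by
  rw [renew, h.neg u hu, Set.Ioc_eq_empty (by linarith)]
  simp

theorem renew_nonneg (h : IsDiscounted C H) (u : ℝ) : 0 ≤ renew H u :=
  add_nonneg (h.nonneg u) (integral_nonneg h.nonneg)

theorem renewLimit_nonneg (h : IsDiscounted C H) : 0 ≤ renewLimit H := integral_nonneg h.nonneg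

theorem renewLimit_le (h : IsDiscounted C H) : renewLimit H ≤ C := by
  simpa [renewLimit] using h.integral_Ioi_le le_rfl

/-- For u ≥ 0 the difference consists of H(u) and a tail of ∫ H, both at most C e^{-u}. The weaker
rate e^{-u/2} is chosen so that the bound can be summed over children with u replaced by u - ζ,
including negative values: e^{-(2-p)ζ} e^{ζ/2} = e^{-(3/2-p)ζ}. -/
theorem abs_renew_sub_le (h : IsDiscounted C H) (u : ℝ) :
    |renew H u - renewLimit H| ≤ 2 * C * Real.exp (-u / 2) := by
  have hC := h.const_nonneg
  rcases lt_or_ge u 0 with hu | hu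
  · rw [h.renew_of_neg hu, zero_sub, abs_neg, abs_of_nonneg h.renewLimit_nonneg]
    have : 1 ≤ Real.exp (-u / 2) := Real.one_le_exp (by linarith)
    nlinarith [h.renewLimit_le]
  · have hsplit : renewLimit H = (∫ s in Set.Ioc 0 u, H s) + ∫ s in Set.Ioi u, H s := by
      have hd : Disjoint (Set.Ioc 0 u) (Set.Ioi u) :=
        Set.disjoint_left.2 fun x hx hx' => absurd hx.2 (not_le.2 hx')
      rw [renewLimit, ← setIntegral_union hd measurableSet_Ioi
        ((h.integrableOn le_rfl).mono_set Set.Ioc_subset_Ioi_self) (h.integrableOn hu),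
        Set.Ioc_union_Ioi_eq_Ioi hu]
    have h1 := h.integral_Ioi_le hu
    have h2 : 0 ≤ ∫ s in Set.Ioi u, H s := integral_nonneg h.nonneg
    have h3 := h.le u hu
    have h4 := h.nonneg u
    have h5 : C * Real.exp (-u) ≤ C * Real.exp (-u / 2) :=
      mul_le_mul_of_nonneg_left (Real.exp_le_exp.2 (by linarith)) hC
    have h6 : 0 ≤ C * Real.exp (-u / 2) := by positivity
    rw [renew, hsplit, abs_le]
    constructor <;> linarith

theorem tendsto_renew (h : IsDiscounted C H) : Tendsto (renew H) atTop (𝓝 (renewLimit H)) := by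
  rw [tendsto_iff_norm_sub_tendsto_zero]
  have ht : Tendsto (fun u : ℝ => 2 * C * Real.exp (-u / 2)) atTop (𝓝 0) := by
    have h1 : Tendsto (fun u : ℝ => -u / 2) atTop atBot :=
      (tendsto_neg_atTop_atBot).atBot_div_const two_pos
    simpa using (Real.tendsto_exp_atBot.comp h1).const_mul (2 * C)
  exact squeeze_zero (fun _ => norm_nonneg _) (fun u => h.abs_renew_sub_le u) ht

theorem ofReal_renew (h : IsDiscounted C H) (u : ℝ) : ENNReal.ofReal (renew H u) =
    ENNReal.ofReal (H u) + ∫⁻ s in Set.Ioc 0 u, ENNReal.ofReal (H s) := by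
  rw [renew, ENNReal.ofReal_add (h.nonneg u) (integral_nonneg h.nonneg),
    ofReal_integral_eq_lintegral_ofReal]
  · exact (h.integrableOn le_rfl).mono_set Set.Ioc_subset_Ioi_self
  · exact Eventually.of_forall h.nonneg

theorem measurable_renew (h : IsDiscounted C H) : Measurable (renew H) := by
  have hm : Measurable fun u => ENNReal.ofReal (renew H u) := by
    simp only [h.ofReal_renew]
    refine h.measurable.ennreal_ofReal.add ?_
    have hk : Measurable fun y : ℝ × ℝ => Set.indicator {y : ℝ × ℝ | 0 < y.2 ∧ y.2 ≤ y.1}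
        (fun y => ENNReal.ofReal (H y.2)) y :=
      (h.measurable.comp measurable_snd).ennreal_ofReal.indicator
        ((measurableSet_lt measurable_const measurable_snd).inter
          (measurableSet_le measurable_snd measurable_fst))
    have hk2 := hk.lintegral_prod_right' (ν := volume)
    have e : ∀ u, ∫⁻ s in Set.Ioc 0 u, ENNReal.ofReal (H s) = ∫⁻ s, Set.indicator
        {y : ℝ × ℝ | 0 < y.2 ∧ y.2 ≤ y.1} (fun y => ENNReal.ofReal (H y.2)) (u, s) := fun u => by
      rw [← lintegral_indicator measurableSet_Ioc]
      rfl
    simpa only [e] using hk2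
  have hm2 := hm.ennreal_toReal
  simpa only [ENNReal.toReal_ofReal (h.renew_nonneg _)] using hm2

/-- The renewal equation with kernel e^{-r} dr. By Fubini the summand H of `renew` contributes H(s)
e^{-(u-s)} and its integral part H(s)(1 - e^{-(u-s)}), which add up to H(s) on (0, u). -/
theorem lintegral_exp_mul_renew (h : IsDiscounted C H) (u : ℝ) :
    ∫⁻ r in Set.Ioi 0, expE (-r) * ENNReal.ofReal (renew H (u - r)) =
      ENNReal.ofReal (renew H u - H u) := by
  have hE : Measurable fun s => ENNReal.ofReal (H s) := h.measurable.ennreal_ofReal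
  have hrhs : ENNReal.ofReal (renew H u - H u) = ∫⁻ s in Set.Ioo 0 u, ENNReal.ofReal (H s) := by
    rw [renew, add_sub_cancel_left, ofReal_integral_eq_lintegral_ofReal
      ((h.integrableOn le_rfl).mono_set Set.Ioc_subset_Ioi_self) (Eventually.of_forall h.nonneg),
      setLIntegral_congr Ioo_ae_eq_Ioc]
  have hfirst : ∫⁻ r in Set.Ioi 0, expE (-r) * ENNReal.ofReal (H (u - r)) =
      ∫⁻ s in Set.Ioo 0 u, ENNReal.ofReal (H s) * expE (-(1 * (u - s))) := by
    rw [← lintegral_indicator measurableSet_Ioi, ← lintegral_indicator measurableSet_Ioo,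
      ← lintegral_sub_left_eq_self _ u]
    refine lintegral_congr_ae ?_
    have h0 : ∀ᵐ x : ℝ, x ≠ 0 := by simp [ae_iff]
    filter_upwards [h0] with s hs
    simp only [Set.indicator, Set.mem_Ioi, sub_pos, Set.mem_Ioo, sub_sub_cancel]
    rcases lt_or_gt_of_ne hs with hs' | hs'
    · simp [h.neg s hs']
    · simp only [hs', true_and, one_mul]
      split_ifs <;> simp [mul_comm]
  set k : ℝ → ℝ → ℝ≥0∞ := fun r s => Set.indicator {y : ℝ × ℝ | 0 < y.1 ∧ 0 < y.2 ∧ y.1 + y.2 ≤ u}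
    (fun y => expE (-y.1) * ENNReal.ofReal (H y.2)) (r, s) with hk
  have hkm : Measurable (Function.uncurry k) := by
    refine Measurable.indicator ?_ ?_
    · exact (measurable_expE.comp measurable_fst.neg).mul (hE.comp measurable_snd)
    · exact (measurableSet_lt measurable_const measurable_fst).inter
        ((measurableSet_lt measurable_const measurable_snd).inter
          (measurableSet_le (measurable_fst.add measurable_snd) measurable_const))
  have hsecond : ∫⁻ r in Set.Ioi 0, expE (-r) * ∫⁻ s in Set.Ioc 0 (u - r), ENNReal.ofReal (H s) =
      ∫⁻ s in Set.Ioo 0 u, ENNReal.ofReal (H s) * (1 - expE (-(1 * (u - s)))) := by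
    have e1 : ∀ r, Set.indicator (Set.Ioi 0) (fun r => expE (-r) *
        ∫⁻ s in Set.Ioc 0 (u - r), ENNReal.ofReal (H s)) r = ∫⁻ s, k r s := by
      intro r
      by_cases hr : 0 < r
      · rw [Set.indicator_of_mem (by exact hr), ← lintegral_indicator measurableSet_Ioc,
          ← lintegral_const_mul _ (hE.indicator measurableSet_Ioc)]
        refine lintegral_congr fun s => ?_
        simp only [hk, Set.indicator, Set.mem_Ioc, Set.mem_ofPred_eq, hr, true_and, le_sub_iff_add_le']
        split_ifs <;> simp
      · simp [hk, Set.indicator, hr]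
    rw [← lintegral_indicator measurableSet_Ioi, lintegral_congr e1,
      lintegral_lintegral_swap hkm.aemeasurable, ← lintegral_indicator measurableSet_Ioo]
    refine lintegral_congr fun s => ?_
    by_cases hs : 0 < s ∧ s < u
    · have e2 : ∀ r, k r s = ENNReal.ofReal (H s) * Set.indicator (Set.Ioc 0 (u - s))
          (fun r => ENNReal.ofReal 1 * expE (-(1 * r))) r := by
        intro r
        simp only [hk, Set.indicator, Set.mem_Ioc, Set.mem_ofPred_eq, hs.1, true_and,
          le_sub_iff_add_le]
        split_ifs <;> simp [mul_comm]
      have hm : Measurable fun r => ENNReal.ofReal 1 * expE (-(1 * r)) := by fun_prop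
      rw [Set.indicator_of_mem (by exact hs), lintegral_congr e2,
        lintegral_const_mul _ (hm.indicator measurableSet_Ioc),
        lintegral_indicator measurableSet_Ioc, ← setLIntegral_congr Ioo_ae_eq_Ioc,
        lintegral_Ioo_exp one_pos (by linarith [hs.2])]
    · rw [Set.indicator_of_notMem (by exact hs)]
      have e2 : ∀ r, k r s = 0 := by
        intro r
        simp only [hk, Set.indicator, Set.mem_ofPred_eq]
        rw [if_neg]
        rintro ⟨h1, h2, h3⟩
        exact hs ⟨h2, by linarith⟩
      simp [e2]
  simp only [h.ofReal_renew, mul_add]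
  have hm1 : Measurable fun r => expE (-r) * ENNReal.ofReal (H (u - r)) :=
    (measurable_expE.comp measurable_neg).mul (hE.comp (measurable_const.sub measurable_id))
  rw [lintegral_add_left hm1, hfirst, hsecond, hrhs]
  have hm2 : Measurable fun s => ENNReal.ofReal (H s) * expE (-(1 * (u - s))) := by fun_prop
  rw [← lintegral_add_left hm2]
  refine setLIntegral_congr_fun measurableSet_Ioo fun s hs => ?_
  have e2 : expE (-(1 * (u - s))) ≤ 1 := by
    rw [← expE_zero]; exact expE_le_expE (by linarith [hs.2])
  rw [← mul_add, add_tsub_cancel_of_le e2, mul_one]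

theorem renew_le (h : IsDiscounted C H) (u : ℝ) : renew H u ≤ 2 * C := by
  have hC := h.const_nonneg
  rcases lt_or_ge u 0 with hu | hu
  · rw [h.renew_of_neg hu]; positivity
  · have h1 : ∫ s in Set.Ioc 0 u, H s ≤ renewLimit H :=
      setIntegral_mono_set (h.integrableOn le_rfl) (Eventually.of_forall h.nonneg)
        (Set.Ioc_subset_Ioi_self.eventuallyLE)
    have h2 := h.le u hu
    have h3 : Real.exp (-u) ≤ 1 := Real.exp_le_one_iff.2 (by linarith)
    have h4 := h.renewLimit_le
    rw [renew]
    nlinarith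

end IsDiscounted

/-- The discounted sum of a function of the ages over the children of a vertex. -/
def childSum (p : ℝ) (m : ℝ → ℝ) (u : ℝ) (o : Offspring) : ℝ :=
  ∑' j, Real.exp (-(2 - p) * (o j).1) * m (u - (o j).1)

theorem measurable_childSum (p : ℝ) {m : ℝ → ℝ} (hm : Measurable m) :
    Measurable (Function.uncurry (childSum p m)) :=
  Measurable.tsum fun j => (Real.measurable_exp.comp
    (((measurable_age j).comp measurable_snd).const_mul _)).mul
    (hm.comp (measurable_fst.sub ((measurable_age j).comp measurable_snd)))

theorem childSum_eq_toReal (p : ℝ) {m : ℝ → ℝ} (hm : ∀ u, 0 ≤ m u) (u : ℝ) (o : Offspring) :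
    childSum p m u o =
      (∑' j, expE (-((2 - p) * (o j).1)) * ENNReal.ofReal (m (u - (o j).1))).toReal := by
  rw [ENNReal.tsum_toReal_eq fun j => ENNReal.mul_ne_top (expE_ne_top _) ENNReal.ofReal_ne_top]
  refine tsum_congr fun j => ?_
  rw [ENNReal.toReal_mul, expE, ENNReal.toReal_ofReal (Real.exp_pos _).le,
    ENNReal.toReal_ofReal (hm _), neg_mul]

/-- The discount e^{-(2-p)s} times the intensity e^{(1-p)s} is e^{-s}, so this is the renewal
equation read on the children. -/
theorem IsDiscounted.lintegral_childSum {p C : ℝ} {H : ℝ → ℝ} (h : IsDiscounted C H) (h0 : 0 ≤ p)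
    (h1 : p ≤ 1) (u : ℝ) :
    ∫⁻ o, ∑' j, expE (-((2 - p) * (o j).1)) * ENNReal.ofReal (renew H (u - (o j).1))
      ∂(offspringLaw p) = ENNReal.ofReal (renew H u - H u) := by
  have hm := h.measurable_renew
  have hmE : Measurable fun s => expE (-((2 - p) * s)) * ENNReal.ofReal (renew H (u - s)) := by
    fun_prop
  rw [lintegral_offspringLaw_tsum h0 h1 (l := 2 - p) (by linarith) hmE
    (C := ENNReal.ofReal (2 * C)) ENNReal.ofReal_ne_top fun s => by
      rw [mul_comm]
      exact mul_le_mul_left (ENNReal.ofReal_le_ofReal (h.renew_le _)) _,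
    ← h.lintegral_exp_mul_renew u]
  refine lintegral_congr fun r => ?_
  rw [mul_right_comm, ← expE_add]
  congr 2; ring

theorem IsDiscounted.integral_childSum {p C : ℝ} {H : ℝ → ℝ} (h : IsDiscounted C H) (h0 : 0 ≤ p)
    (h1 : p ≤ 1) (u : ℝ) :
    Integrable (childSum p (renew H) u) (offspringLaw p) ∧
      ∫ o, childSum p (renew H) u o ∂(offspringLaw p) = renew H u - H u := by
  have hm := h.measurable_renew
  have hmeas : Measurable fun o : Offspring =>
      ∑' j, expE (-((2 - p) * (o j).1)) * ENNReal.ofReal (renew H (u - (o j).1)) :=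
    Measurable.tsum fun j => (measurable_expE.comp ((measurable_age j).const_mul _).neg).mul
      (hm.comp (measurable_const.sub (measurable_age j))).ennreal_ofReal
  have hL := h.lintegral_childSum h0 h1 u
  have hne : ∫⁻ o, ∑' j, expE (-((2 - p) * (o j).1)) * ENNReal.ofReal (renew H (u - (o j).1))
      ∂(offspringLaw p) ≠ ∞ := by rw [hL]; exact ENNReal.ofReal_ne_top
  have e : ∀ o, childSum p (renew H) u o = _ := childSum_eq_toReal p h.renew_nonneg u
  constructor
  · exact (integrable_toReal_of_lintegral_ne_top hmeas.aemeasurable hne).congr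
      (Eventually.of_forall fun o => (e o).symm)
  · simp only [e]
    rw [integral_toReal hmeas.aemeasurable (ae_lt_top hmeas hne), hL, ENNReal.toReal_ofReal]
    rw [renew, add_sub_cancel_left]
    exact integral_nonneg h.nonneg

section

/-! ### Bounded characteristics along lattices of times -/

/-- A measurable characteristic with values between `0` and `C`. -/
structure IsMeasurableCharacteristic (φ : Offspring → ℝ → ℝ) (C : ℝ) : Prop where
  measurable : Measurable (Function.uncurry φ)
  nonneg : ∀ o, ∀ t, 0 ≤ t → 0 ≤ φ o t
  le : ∀ o, ∀ t, 0 ≤ t → φ o t ≤ C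

/-- The discounted mean of a characteristic. -/
def charMean (p : ℝ) (φ : Offspring → ℝ → ℝ) (u : ℝ) : ℝ :=
  if 0 ≤ u then Real.exp (-(2 - p) * u) * ∫ o, φ o u ∂(offspringLaw p) else 0

theorem renewLimit_charMean (p : ℝ) (φ : Offspring → ℝ → ℝ) :
    renewLimit (charMean p φ) = limitMean p φ :=
  setIntegral_congr_fun measurableSet_Ioi fun _ hs => if_pos (le_of_lt hs)

theorem IsMeasurableCharacteristic.const_nonneg {φ : Offspring → ℝ → ℝ} {C : ℝ}
    (hφ : IsMeasurableCharacteristic φ C) : 0 ≤ C :=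
  (hφ.nonneg (fun _ => (0, true)) 0 le_rfl).trans (hφ.le _ 0 le_rfl)

theorem IsMeasurableCharacteristic.integrable {φ : Offspring → ℝ → ℝ} {C p : ℝ}
    (hφ : IsMeasurableCharacteristic φ C) (h0 : 0 ≤ p) (h1 : p ≤ 1) {u : ℝ} (hu : 0 ≤ u) :
    Integrable (fun o => φ o u) (offspringLaw p) := by
  have := isProbabilityMeasure_offspringLaw h0 h1
  refine Integrable.of_bound (hφ.measurable.comp measurable_prodMk_right).aestronglyMeasurable C
    (Eventually.of_forall fun o => ?_)
  rw [Real.norm_of_nonneg (hφ.nonneg o u hu)]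
  exact hφ.le o u hu

theorem IsMeasurableCharacteristic.isDiscounted {φ : Offspring → ℝ → ℝ} {C p : ℝ}
    (hφ : IsMeasurableCharacteristic φ C) (h0 : 0 ≤ p) (h1 : p ≤ 1) :
    IsDiscounted C (charMean p φ) := by
  have := isProbabilityMeasure_offspringLaw h0 h1
  have hnn : ∀ u, 0 ≤ u → 0 ≤ ∫ o, φ o u ∂(offspringLaw p) := fun u hu =>
    integral_nonneg fun o => hφ.nonneg o u hu
  refine ⟨?_, fun s hs => if_neg (not_le.2 hs), fun s => ?_, fun s hs => ?_⟩
  · refine Measurable.ite measurableSet_Ici ?_ measurable_const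
    exact (Real.measurable_exp.comp (measurable_id.const_mul _)).mul
      (hφ.measurable.stronglyMeasurable.integral_prod_left').measurable
  · unfold charMean
    split_ifs with hs
    · exact mul_nonneg (Real.exp_pos _).le (hnn s hs)
    · exact le_rfl
  · have h2 : ∫ o, φ o s ∂(offspringLaw p) ≤ C := by
      have := integral_mono (hφ.integrable h0 h1 hs) (integrable_const C) fun o => hφ.le o s hs
      simpa using this
    rw [charMean, if_pos hs, mul_comm]
    exact mul_le_mul h2 (Real.exp_le_exp.2 (by nlinarith)) (Real.exp_pos _).le hφ.const_nonneg

theorem IsDiscounted.abs_childSum_sub_le {p C : ℝ} {H : ℝ → ℝ} (h : IsDiscounted C H)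
    {o : Offspring} (ho : IsRegularOffspring p o) (u : ℝ) :
    |childSum p (renew H) u o - renewLimit H * discountedOffspring p o| ≤
      2 * C * Real.exp (-u / 2) * (realEnvelope p o - 1) := by
  have hb : ∀ j, ‖Real.exp (-(2 - p) * (o j).1) * (renew H (u - (o j).1) - renewLimit H)‖ ≤
      2 * C * Real.exp (-u / 2) * Real.exp (-((3 / 2 - p) * (o j).1)) := by
    intro j
    rw [norm_mul, Real.norm_of_nonneg (Real.exp_pos _).le, Real.norm_eq_abs]
    calc _ ≤ Real.exp (-(2 - p) * (o j).1) * (2 * C * Real.exp (-(u - (o j).1) / 2)) :=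
          mul_le_mul_of_nonneg_left (h.abs_renew_sub_le _) (Real.exp_pos _).le
      _ = 2 * C * (Real.exp (-(2 - p) * (o j).1) * Real.exp (-(u - (o j).1) / 2)) := by ring
      _ = 2 * C * (Real.exp (-u / 2) * Real.exp (-((3 / 2 - p) * (o j).1))) := by
          rw [← Real.exp_add, ← Real.exp_add]; congr 2; ring
      _ = _ := by ring
  have hs1 := ho.summable.mul_left (2 * C * Real.exp (-u / 2))
  have hs2 : Summable fun j => Real.exp (-(2 - p) * (o j).1) *
      (renew H (u - (o j).1) - renewLimit H) := Summable.of_norm_bounded hs1 hb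
  have hs3 := ho.discounted.mul_left (renewLimit H)
  have e : childSum p (renew H) u o - renewLimit H * discountedOffspring p o =
      ∑' j, Real.exp (-(2 - p) * (o j).1) * (renew H (u - (o j).1) - renewLimit H) := by
    rw [childSum, discountedOffspring, ← tsum_mul_left, ← Summable.tsum_sub _ hs3]
    · exact tsum_congr fun j => by ring
    · exact (hs2.add hs3).congr fun j => by ring
  rw [e, ← Real.norm_eq_abs, realEnvelope, add_sub_cancel_left, ← tsum_mul_left]
  exact tsum_of_norm_bounded hs1.hasSum hb

/-- The centred contribution of a vertex to the process counted with `φ`. -/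
def charFluct (p : ℝ) (φ : Offspring → ℝ → ℝ) (t s : ℝ) (o : Offspring) : ℝ :=
  if s ≤ t then Real.exp (-(2 - p) * s) * (Real.exp (-(2 - p) * (t - s)) * φ o (t - s) -
    renew (charMean p φ) (t - s) + childSum p (renew (charMean p φ)) (t - s) o -
    limitMean p φ * (discountedOffspring p o - 1)) else 0

/-- With u = t - s, the means of the parts are H(u), -m(u), m(u) - H(u) and 0. For the bound, m and
the child sum are compared with their limits: the parts are at most C, 2C and 2C(X - 1) times
e^{-u/2}, where X is the envelope, and 3C + 2C(X - 1) ≤ 3CX. Finally e^{-(2-p)s} e^{-(t-s)/2} =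
e^{-t/2} e^{-(3/2-p)s}. -/
theorem isFluctuation_charFluct {p C : ℝ} (hp : 0 < p) (hp1 : p ≤ 1) {φ : Offspring → ℝ → ℝ}
    (hφ : IsMeasurableCharacteristic φ C) (t : ℝ) :
    IsFluctuation p (charFluct p φ t) (ENNReal.ofReal (3 * C) * expE (-(t / 2))) := by
  have hC := hφ.const_nonneg
  have hH := hφ.isDiscounted hp.le hp1
  have hm := hH.measurable_renew
  have := isProbabilityMeasure_offspringLaw hp.le hp1
  refine IsFluctuation.of_abs_le hp hp1 (by positivity) ?_ (fun s => ?_) (fun s o ho => ?_)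
  · refine Measurable.ite (measurableSet_le measurable_fst measurable_const) ?_ measurable_const
    have hts : Measurable fun y : ℝ × Offspring => t - y.1 := measurable_const.sub measurable_fst
    have m1 : Measurable fun y : ℝ × Offspring => φ y.2 (t - y.1) :=
      hφ.measurable.comp (measurable_snd.prodMk hts)
    have m2 : Measurable fun y : ℝ × Offspring => childSum p (renew (charMean p φ)) (t - y.1) y.2 :=
      (measurable_childSum p hm).comp (hts.prodMk measurable_snd)
    have m3 : Measurable fun y : ℝ × Offspring => discountedOffspring p y.2 :=
      (measurable_discountedOffspring p).comp measurable_snd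
    exact (Real.measurable_exp.comp (measurable_fst.const_mul _)).mul
      (((((Real.measurable_exp.comp (hts.const_mul _)).mul m1).sub (hm.comp hts)).add m2).sub
        ((m3.sub_const 1).const_mul _))
  · unfold charFluct
    split_ifs with hs
    · have hu : 0 ≤ t - s := sub_nonneg.2 hs
      have i1 := (hφ.integrable hp.le hp1 hu).const_mul (Real.exp (-(2 - p) * (t - s)))
      have i2 : Integrable (fun _ : Offspring => renew (charMean p φ) (t - s)) (offspringLaw p) :=
        integrable_const _
      obtain ⟨i3, e3⟩ := hH.integral_childSum hp.le hp1 (t - s)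
      have i4 := ((integrable_discountedOffspring hp.le hp1).sub
        (integrable_const (1:ℝ))).const_mul (limitMean p φ)
      have e4 : ∫ o, (discountedOffspring p o - 1) ∂(offspringLaw p) = 0 := by
        rw [integral_sub (integrable_discountedOffspring hp.le hp1) (integrable_const 1),
          integral_discountedOffspring hp.le hp1]
        simp
      have e5 : charMean p φ (t - s) =
        Real.exp (-(2 - p) * (t - s)) * ∫ o, φ o (t - s) ∂(offspringLaw p) := if_pos hu
      have i12 := i1.sub i2
      have i123 := i12.add i3
      simp only [Pi.sub_def, Pi.add_def] at i4 i12 i123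
      rw [integral_const_mul, integral_sub i123 i4, integral_add i12 i3, integral_sub i1 i2,
        integral_const_mul, integral_const_mul, e3, e4, e5]
      simp
    · simp
  · have hE := one_le_realEnvelope p o
    unfold charFluct
    split_ifs with hs
    · have hu : 0 ≤ t - s := sub_nonneg.2 hs
      have b1 : |Real.exp (-(2 - p) * (t - s)) * φ o (t - s)| ≤ C * Real.exp (-(t - s) / 2) := by
        rw [abs_mul, abs_of_pos (Real.exp_pos _), abs_of_nonneg (hφ.nonneg o _ hu), mul_comm]
        exact mul_le_mul (hφ.le o _ hu) (Real.exp_le_exp.2 (by nlinarith)) (Real.exp_pos _).le hC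
      have b2 := hH.abs_renew_sub_le (t - s)
      have b3 := hH.abs_childSum_sub_le ho (t - s)
      rw [renewLimit_charMean] at b2 b3
      set E := Real.exp (-(t - s) / 2) with hEdef
      have hEpos : 0 < E := Real.exp_pos _
      have b4 : |Real.exp (-(2 - p) * (t - s)) * φ o (t - s) - renew (charMean p φ) (t - s) +
          childSum p (renew (charMean p φ)) (t - s) o -
          limitMean p φ * (discountedOffspring p o - 1)| ≤ 3 * C * E * realEnvelope p o := by
        rw [abs_le] at b1 b2 b3 ⊢
        have hCE : 0 ≤ C * E * (realEnvelope p o - 1) :=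
          mul_nonneg (by positivity) (by linarith)
        constructor <;> nlinarith
      rw [abs_mul, abs_of_pos (Real.exp_pos _)]
      calc _ ≤ Real.exp (-(2 - p) * s) * (3 * C * E * realEnvelope p o) :=
            mul_le_mul_of_nonneg_left b4 (Real.exp_pos _).le
        _ = 3 * C * (Real.exp (-(2 - p) * s) * E) * realEnvelope p o := by ring
        _ = 3 * C * (Real.exp (-(t / 2)) * Real.exp (-((3 / 2 - p) * s))) * realEnvelope p o := by
            rw [hEdef, ← Real.exp_add, ← Real.exp_add]; congr 3; ring
        _ = _ := by ring
    · rw [abs_zero]; positivity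

/-! ### Summation of the fluctuations of a characteristic over the tree -/

theorem tsum_vertex_real {g : Vertex → ℝ} (hg : Summable g) :
    (Summable fun v => ∑' j : ℕ, g (j :: v)) ∧
      ∑' v, g v = g [] + ∑' v, ∑' j : ℕ, g (j :: v) := by
  have h1 : Summable (g ∘ vertexEquiv) := vertexEquiv.summable_iff.2 hg
  have hl : Summable ((g ∘ vertexEquiv) ∘ Sum.inl) := h1.comp_injective Sum.inl_injective
  have hr : Summable ((g ∘ vertexEquiv) ∘ Sum.inr) := h1.comp_injective Sum.inr_injective
  refine ⟨hr.prod, ?_⟩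
  have h2 := Summable.tsum_sum hl hr
  have h3 : ∑' y, (g ∘ vertexEquiv) y = ∑' v, g v := vertexEquiv.tsum_eq g
  have h4 := hr.tsum_prod
  rw [← h3, h2, tsum_fintype]
  simp only [Function.comp] at h4
  simp [vertexEquiv] at h4 ⊢
  exact h4

theorem IsGood.birthTime_lt_cons {p : ℝ} {x : Vertex → Offspring} (hx : IsGood p x) (j : ℕ)
    (v : Vertex) : birthTime x v < birthTime x (j :: v) :=
  lt_add_of_pos_right _ ((hx.offspring v).pos j)

theorem countedProcess_eq (φ : Offspring → ℝ → ℝ) (x : Vertex → Offspring) (t : ℝ) :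
    countedProcess φ x t = ∑' v, if birthTime x v ≤ t then φ (x v) (t - birthTime x v) else 0 := by
  rw [countedProcess, tsum_subtype (population x t) fun v => φ (x v) (t - birthTime x v)]
  rfl

/-- Let g(v) = e^{-ασ_v} m(t - σ_v). Each vertex contributes -g(v) plus the sum of g over its
children; every vertex but the progenitor is a child exactly once, so only -g([]) = -m(t) survives.
Vertices born after t contribute nothing because m vanishes on negative times. -/
theorem IsGood.tsum_charFluct {p C : ℝ} (h0 : 0 ≤ p) (h1 : p ≤ 1) {x : Vertex → Offspring}
    (hx : IsGood p x) {φ : Offspring → ℝ → ℝ} (hφ : IsMeasurableCharacteristic φ C) (t : ℝ) :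
    ∑' v, charFluct p φ t (birthTime x v) (x v) = Real.exp (-(2 - p) * t) * countedProcess φ x t -
      renew (charMean p φ) t - limitMean p φ * (reproAt p x t - 1) := by
  have hH := hφ.isDiscounted h0 h1
  set m := renew (charMean p φ) with hm
  set A : Vertex → ℝ := fun v => Real.exp (-(2 - p) * t) *
    (if birthTime x v ≤ t then φ (x v) (t - birthTime x v) else 0) with hA
  set g : Vertex → ℝ := fun v => Real.exp (-(2 - p) * birthTime x v) * m (t - birthTime x v) with hg
  set r : Vertex → ℝ := fun v => limitMean p φ *
    (if birthTime x v ≤ t then reproTerm p (birthTime x v) (x v) else 0) with hr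
  have hg0 : ∀ v, t < birthTime x v → g v = 0 := fun v hv => by
    simp only [hg, hm]; rw [hH.renew_of_neg (by linarith), mul_zero]
  have sA : Summable A := hx.summable_of_population t fun v hv => by simp [hA, not_le.2 hv]
  have sg : Summable g := hx.summable_of_population t hg0
  have sr : Summable r := hx.summable_of_population t fun v hv => by simp [hr, not_le.2 hv]
  obtain ⟨sc, ec⟩ := tsum_vertex_real sg
  have key : ∀ v, charFluct p φ t (birthTime x v) (x v) =
      A v - g v + (∑' j : ℕ, g (j :: v)) - r v := by
    intro v
    by_cases hv : birthTime x v ≤ t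
    · have e1 : ∑' j : ℕ, g (j :: v) = Real.exp (-(2 - p) * birthTime x v) *
          childSum p m (t - birthTime x v) (x v) := by
        rw [childSum, ← tsum_mul_left]
        refine tsum_congr fun j => ?_
        simp only [hg, birthTime]
        rw [mul_add, Real.exp_add, mul_assoc, sub_sub]
      have e2 : Real.exp (-(2 - p) * t) =
          Real.exp (-(2 - p) * birthTime x v) * Real.exp (-(2 - p) * (t - birthTime x v)) := by
        rw [← Real.exp_add]; congr 1; ring
      rw [e1]
      simp only [charFluct, hA, hr, if_pos hv, reproTerm, e2, hg, ← hm]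
      ring
    · have hv' := not_le.1 hv
      have e1 : ∀ j : ℕ, g (j :: v) = 0 := fun j => hg0 _ (hv'.trans (hx.birthTime_lt_cons j v))
      simp [charFluct, hA, hr, hv, e1, hg0 v hv']
  rw [tsum_congr key, Summable.tsum_sub ((sA.sub sg).add sc) sr, Summable.tsum_add (sA.sub sg) sc,
    Summable.tsum_sub sA sg, ec]
  simp only [hA, hr, tsum_mul_left, countedProcess_eq, reproAt, hg, birthTime]
  simp
  ring

variable {Ω : Type*} [MeasurableSpace Ω] {μ : Measure Ω} [IsProbabilityMeasure μ] {p : ℝ}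
  {ξ : Vertex → Ω → Offspring}

theorem tendsto_natCast_div_atTop {k : ℕ} (hk : 0 < k) :
    Tendsto (fun n : ℕ => (n : ℝ) / k) atTop atTop :=
  tendsto_natCast_atTop_atTop.atTop_div_const (Nat.cast_pos.2 hk)

/-- Convergence of the process counted with a bounded measurable characteristic along a lattice. -/
theorem IsBranchingProcess.ae_tendsto_countedProcess_lattice (hξ : IsBranchingProcess μ p ξ)
    (hp : 0 < p) (hp1 : p < 1) {C : ℝ} {φ : Offspring → ℝ → ℝ}
    (hφ : IsMeasurableCharacteristic φ C) {k : ℕ} (hk : 0 < k) {R : Ω → ℝ}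
    (hR : ∀ᵐ ω ∂μ, Tendsto (fun n : ℕ => reproAt p (fun v => ξ v ω) (n / k)) atTop (𝓝 (R ω))) :
    ∀ᵐ ω ∂μ, Tendsto (fun n : ℕ => Real.exp (-(2 - p) * (n / k)) *
      countedProcess φ (fun v => ξ v ω) (n / k)) atTop (𝓝 (limitMean p φ * R ω)) := by
  have hk' : (0:ℝ) < k := Nat.cast_pos.2 hk
  have h := hξ.ae_tendsto_fluctuation hp hp1 (c := 1 / (2 * k)) (C := 3 * C) (by positivity)
    (Φ := fun n => charFluct p φ (n / k))
    (fun n => by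
      have h := isFluctuation_charFluct hp hp1.le hφ (n / k)
      rwa [show (n : ℝ) / k / 2 = 1 / (2 * k) * n by field_simp] at h)
    (fun n => hξ.ae_summable_of_population hp hp1.le (n / k) (Φ := charFluct p φ (n / k))
      fun s o hs => if_neg (not_le.2 hs))
  filter_upwards [h, hR, hξ.ae_isGood hp hp1.le] with ω h1 h2 hgood
  have hH := hφ.isDiscounted hp.le hp1.le
  have h3 := hH.tendsto_renew.comp (tendsto_natCast_div_atTop hk)
  rw [renewLimit_charMean] at h3
  have h4 := (h1.add h3).add ((h2.sub_const 1).const_mul (limitMean p φ))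
  have e : 0 + limitMean p φ + limitMean p φ * (R ω - 1) = limitMean p φ * R ω := by ring
  rw [e] at h4
  refine h4.congr fun n => ?_
  have h5 := hgood.tsum_charFluct hp.le hp1.le hφ (n / k)
  change ∑' v, charFluct p φ (n / k) (birth ξ v ω) (ξ v ω) = _ at h5
  rw [h5]
  simp only [Function.comp]
  ring

end

section

/-! ### The number of blue vertices along lattices of times -/

/-- The centred colour of a child, counted if it is born by the age `u` of the mother. -/
def blueTerm (p u : ℝ) (j : ℕ) (o : Offspring) : ℝ :=
  if (o j).1 ≤ u then (if (o j).2 = true then 1 else 0) - (1 - p) else 0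

theorem measurable_blueTerm (p : ℝ) (j : ℕ) :
    Measurable fun y : ℝ × Offspring => blueTerm p y.1 j y.2 := by
  have hb : Measurable fun c : Bool => (if c = true then (1:ℝ) else 0) := measurable_of_countable _
  refine Measurable.ite (measurableSet_le ((measurable_age j).comp measurable_snd) measurable_fst)
    ?_ measurable_const
  exact (hb.comp ((measurable_pi_apply j).comp measurable_snd).snd).sub_const _

/-- The term is at most 1 and vanishes unless the age ζ satisfies ζ ≤ u, where e^{g(u-ζ)} ≥ 1. This
form is summable over the children. -/
theorem abs_blueTerm_le {p : ℝ} (h0 : 0 ≤ p) (h1 : p ≤ 1) (u : ℝ) (j : ℕ) (o : Offspring) :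
    |blueTerm p u j o| ≤ Real.exp ((3 / 2 - p) * u) * Real.exp (-((3 / 2 - p) * (o j).1)) := by
  rw [← Real.exp_add]
  unfold blueTerm
  split_ifs with h h2
  · refine le_trans ?_ (Real.one_le_exp (by nlinarith))
    rw [abs_le]; constructor <;> linarith
  · refine le_trans ?_ (Real.one_le_exp (by nlinarith))
    rw [abs_le]; constructor <;> linarith
  · rw [abs_zero]; exact (Real.exp_pos _).le

theorem integral_blueTerm {p : ℝ} (h0 : 0 ≤ p) (h1 : p ≤ 1) (u : ℝ) (j : ℕ) :
    ∫ o, blueTerm p u j o ∂(offspringLaw p) = 0 := by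
  have := isProbabilityMeasure_offspringLaw h0 h1
  set f : ℝ → ℝ≥0∞ := Set.indicator (Set.Iic u) 1 with hf
  have hfm : Measurable f := measurable_one.indicator measurableSet_Iic
  have hm1 : Measurable fun o : Offspring => f (o j).1 := hfm.comp (measurable_age j)
  have hb : Measurable fun c : Bool => (if c = true then (1:ℝ≥0∞) else 0) :=
    measurable_of_countable _
  have hm2 : Measurable fun o : Offspring => f (o j).1 * (if (o j).2 = true then 1 else 0) :=
    hm1.mul (hb.comp (measurable_pi_apply j).snd)
  have hle1 : ∀ o : Offspring, f (o j).1 ≤ 1 := fun o => Set.indicator_le_self' (by simp) _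
  have hle2 : ∀ o : Offspring, f (o j).1 * (if (o j).2 = true then 1 else 0) ≤ 1 := fun o => by
    split_ifs <;> simp [hle1 o]
  have hL := lintegral_offspringLaw_blue h0 h1 hfm j
  have hfin1 : ∫⁻ o, f (o j).1 ∂(offspringLaw p) ≠ ∞ :=
    ne_top_of_le_ne_top (by simp) (lintegral_mono hle1)
  have hfin2 : ∫⁻ o, f (o j).1 * (if (o j).2 = true then 1 else 0) ∂(offspringLaw p) ≠ ∞ :=
    ne_top_of_le_ne_top (by simp) (lintegral_mono hle2)
  have e : ∀ o, blueTerm p u j o = (f (o j).1 * (if (o j).2 = true then 1 else 0)).toReal -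
      (1 - p) * (f (o j).1).toReal := by
    intro o
    unfold blueTerm
    by_cases h : (o j).1 ≤ u <;> by_cases h2 : (o j).2 = true <;> simp [hf, h, h2]
  simp only [e]
  rw [integral_sub (integrable_toReal_of_lintegral_ne_top hm2.aemeasurable hfin2)
    ((integrable_toReal_of_lintegral_ne_top hm1.aemeasurable hfin1).const_mul _),
    integral_const_mul, integral_toReal hm1.aemeasurable (ae_lt_top hm1 hfin1),
    integral_toReal hm2.aemeasurable (ae_lt_top hm2 hfin2), hL, ENNReal.toReal_mul,
    ENNReal.toReal_ofReal (sub_nonneg.2 h1), sub_self]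

/-- The centred contribution of a vertex to the number of blue vertices. -/
def blueFluct (p t s : ℝ) (o : Offspring) : ℝ :=
  Real.exp (-(2 - p) * t) * ∑' j, blueTerm p (t - s) j o

theorem isFluctuation_blueFluct {p : ℝ} (hp : 0 < p) (hp1 : p ≤ 1) (t : ℝ) :
    IsFluctuation p (blueFluct p t) (ENNReal.ofReal 1 * expE (-(t / 2))) := by
  refine IsFluctuation.of_abs_le hp hp1 zero_le_one ?_ (fun s => ?_) (fun s o ho => ?_)
  · refine Measurable.const_mul (Measurable.tsum fun j => ?_) _
    exact (measurable_blueTerm p j).comp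
      ((measurable_const.sub measurable_fst).prodMk measurable_snd)
  · have hm : ∀ j, Measurable (blueTerm p (t - s) j) := fun j =>
      (measurable_blueTerm p j).comp (measurable_const.prodMk measurable_id)
    unfold blueFluct
    -- Each child has mean zero; the exponential bound on `blueTerm` justifies exchanging the sum
    -- and the integral.
    rw [integral_const_mul, integral_tsum fun j => (hm j).aestronglyMeasurable]
    · simp [integral_blueTerm hp.le hp1]
    · have hb : ∀ j, ∫⁻ o, ‖blueTerm p (t - s) j o‖ₑ ∂(offspringLaw p) ≤
          expE ((3 / 2 - p) * (t - s)) *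
            ∫⁻ o, expE (-((3 / 2 - p) * (o j).1)) ∂(offspringLaw p) := by
        intro j
        have hmj : Measurable fun o : Offspring => expE (-((3 / 2 - p) * (o j).1)) :=
          measurable_expE.comp ((measurable_age j).const_mul _).neg
        rw [← lintegral_const_mul _ hmj]
        refine lintegral_mono fun o => ?_
        rw [expE, expE, ← ENNReal.ofReal_mul (Real.exp_pos _).le, ← ofReal_norm]
        exact ENNReal.ofReal_le_ofReal (abs_blueTerm_le hp.le hp1 _ j o)
      refine ne_top_of_le_ne_top ?_ (ENNReal.tsum_le_tsum hb)
      have hmj : ∀ j, AEMeasurable (fun o : Offspring => expE (-((3 / 2 - p) * (o j).1)))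
          (offspringLaw p) := fun j =>
        (measurable_expE.comp ((measurable_age j).const_mul _).neg).aemeasurable
      rw [ENNReal.tsum_mul_left, ← lintegral_tsum hmj,
        lintegral_offspringLaw_exp hp.le hp1 (by linarith)]
      exact ENNReal.mul_ne_top (expE_ne_top _) ENNReal.ofReal_ne_top
  · have h1 : |∑' j, blueTerm p (t - s) j o| ≤
        Real.exp ((3 / 2 - p) * (t - s)) * (realEnvelope p o - 1) := by
      rw [realEnvelope, add_sub_cancel_left, ← tsum_mul_left, ← Real.norm_eq_abs]
      exact tsum_of_norm_bounded (ho.summable.mul_left _).hasSum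
        fun j => abs_blueTerm_le hp.le hp1 _ j o
    have hE := one_le_realEnvelope p o
    rw [blueFluct, abs_mul, abs_of_pos (Real.exp_pos _)]
    calc _ ≤ Real.exp (-(2 - p) * t) * (Real.exp ((3 / 2 - p) * (t - s)) * realEnvelope p o) := by
          refine mul_le_mul_of_nonneg_left (h1.trans ?_) (Real.exp_pos _).le
          exact mul_le_mul_of_nonneg_left (by linarith) (Real.exp_pos _).le
      _ = _ := by
          rw [← mul_assoc, ← Real.exp_add, one_mul, ← Real.exp_add]; congr 2; ring

/-! ### Population counts as sums over the tree -/

theorem ncard_eq_tsum {S : Set Vertex} (hS : S.Finite) :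
    (S.ncard : ℝ) = ∑' v, S.indicator (fun _ => (1:ℝ)) v := by
  have h : ∀ v ∈ hS.toFinset, S.indicator (fun _ => (1:ℝ)) v = 1 := fun v hv =>
    Set.indicator_of_mem (by simpa using hv) _
  rw [tsum_eq_sum (s := hS.toFinset) fun v hv => Set.indicator_of_notMem (by simpa using hv) _,
    Finset.sum_congr rfl h, Set.ncard_eq_toFinset_card S hS]
  simp

theorem IsGood.ncard_population {p : ℝ} {x : Vertex → Offspring} (hx : IsGood p x) (t : ℝ) :
    ((population x t).ncard : ℝ) = ∑' v, if birthTime x v ≤ t then (1:ℝ) else 0 :=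
  ncard_eq_tsum (hx.regular.finite t)

theorem IsGood.ncard_bluePopulation {p : ℝ} {x : Vertex → Offspring} (hx : IsGood p x) (t : ℝ) :
    ((bluePopulation x t).ncard : ℝ) =
      ∑' v, if birthTime x v ≤ t ∧ isBlue x v = true then (1:ℝ) else 0 := by
  rw [ncard_eq_tsum (S := bluePopulation x t)
    ((hx.regular.finite t).subset fun v (hv : v ∈ population x t ∧ _) => hv.1)]
  refine tsum_congr fun v => ?_
  by_cases h1 : birthTime x v ≤ t <;> by_cases h2 : isBlue x v = true <;>
    simp [Set.indicator, bluePopulation, population, h1, h2]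

theorem IsGood.tsum_blueFluct {p : ℝ} {x : Vertex → Offspring} (hx : IsGood p x) {t : ℝ}
    (ht : 0 ≤ t) :
    ∑' v, blueFluct p t (birthTime x v) (x v) = Real.exp (-(2 - p) * t) *
      ((bluePopulation x t).ncard - (1 - p) * (population x t).ncard + (1 - p)) := by
  set f : Vertex → ℝ := fun v => if birthTime x v ≤ t then
    (if isBlue x v = true then 1 else 0) - (1 - p) else 0 with hf
  have sf : Summable f := hx.summable_of_population t fun v hv => if_neg (not_le.2 hv)
  have s1 : Summable fun v => if birthTime x v ≤ t then (1:ℝ) else 0 :=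
    hx.summable_of_population t fun v hv => if_neg (not_le.2 hv)
  have s2 : Summable fun v => if birthTime x v ≤ t ∧ isBlue x v = true then (1:ℝ) else 0 :=
    hx.summable_of_population t fun v hv => if_neg fun h => not_le.2 hv h.1
  have e1 : ∑' v, f v = (bluePopulation x t).ncard - (1 - p) * (population x t).ncard := by
    rw [hx.ncard_population, hx.ncard_bluePopulation, ← tsum_mul_left,
      ← Summable.tsum_sub s2 (s1.mul_left _)]
    refine tsum_congr fun v => ?_
    by_cases h1 : birthTime x v ≤ t <;> simp [hf, h1]
  have e2 := (tsum_vertex_real sf).2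
  -- The progenitor is red, belongs to the population since t ≥ 0, and is nobody's child: hence the
  -- correction 1 - p.
  have e3 : f [] = -(1 - p) := by simp [hf, birthTime, isBlue, ht]
  have e4 : ∀ v, blueFluct p t (birthTime x v) (x v) =
      Real.exp (-(2 - p) * t) * ∑' j : ℕ, f (j :: v) := by
    intro v
    rw [blueFluct]
    congr 1
    refine tsum_congr fun j => ?_
    simp only [blueTerm, hf, birthTime, isBlue, le_sub_iff_add_le']
    congr
  rw [tsum_congr e4, tsum_mul_left]
  congr 1
  linarith

theorem IsGood.blueFluct_eq_zero {p : ℝ} {x : Vertex → Offspring} (hx : IsGood p x) {t : ℝ}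
    {v : Vertex} (hv : t < birthTime x v) : blueFluct p t (birthTime x v) (x v) = 0 := by
  have : ∀ j, blueTerm p (t - birthTime x v) j (x v) = 0 := fun j => by
    rw [blueTerm, if_neg]
    linarith [(hx.offspring v).pos j]
  simp [blueFluct, this]

theorem limitMean_const {p : ℝ} (h0 : 0 ≤ p) (h1 : p ≤ 1) (C : ℝ) :
    limitMean p (fun _ _ => C) = C / (2 - p) := by
  have := isProbabilityMeasure_offspringLaw h0 h1
  have h := integral_exp_mul_Ioi (a := -(2 - p)) (by linarith) 0
  simp only [limitMean, integral_const, probReal_univ, one_smul, integral_mul_const, h]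
  simp only [mul_zero, Real.exp_zero]
  rw [neg_div_neg_eq]
  ring

theorem isMeasurableCharacteristic_const {C : ℝ} (hC : 0 ≤ C) :
    IsMeasurableCharacteristic (fun _ _ => C) C :=
  ⟨measurable_const, fun _ _ _ => hC, fun _ _ _ => le_rfl⟩

theorem IsGood.countedProcess_one {p : ℝ} {x : Vertex → Offspring} (hx : IsGood p x) (t : ℝ) :
    countedProcess (fun _ _ => 1) x t = (population x t).ncard := by
  rw [countedProcess_eq, hx.ncard_population]

variable {Ω : Type*} [MeasurableSpace Ω] {μ : Measure Ω} [IsProbabilityMeasure μ] {p : ℝ}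
  {ξ : Vertex → Ω → Offspring}

theorem IsBranchingProcess.ae_tendsto_population_lattice (hξ : IsBranchingProcess μ p ξ)
    (hp : 0 < p) (hp1 : p < 1) {k : ℕ} (hk : 0 < k) {R : Ω → ℝ}
    (hR : ∀ᵐ ω ∂μ, Tendsto (fun n : ℕ => reproAt p (fun v => ξ v ω) (n / k)) atTop (𝓝 (R ω))) :
    ∀ᵐ ω ∂μ, Tendsto (fun n : ℕ => Real.exp (-(2 - p) * (n / k)) *
      ((population (fun v => ξ v ω) (n / k)).ncard : ℝ)) atTop (𝓝 (R ω / (2 - p))) := by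
  filter_upwards [hξ.ae_tendsto_countedProcess_lattice hp hp1
    (isMeasurableCharacteristic_const zero_le_one) hk hR, hξ.ae_isGood hp hp1.le] with ω h hgood
  simp only [hgood.countedProcess_one] at h
  rw [limitMean_const hp.le hp1.le] at h
  rwa [div_mul_eq_mul_div, one_mul] at h

/-- The blue count is (1-p) times the population up to a negligible error, so |BP| + B behaves like
(2-p)|BP|, and the factor cancels the 1/(2-p) in the limit of the population. -/
theorem IsBranchingProcess.ae_tendsto_sizeMartingale_lattice (hξ : IsBranchingProcess μ p ξ)
    (hp : 0 < p) (hp1 : p < 1) {k : ℕ} (hk : 0 < k) {R : Ω → ℝ}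
    (hR : ∀ᵐ ω ∂μ, Tendsto (fun n : ℕ => reproAt p (fun v => ξ v ω) (n / k)) atTop (𝓝 (R ω))) :
    ∀ᵐ ω ∂μ, Tendsto (fun n : ℕ => sizeMartingale p (fun v => ξ v ω) (n / k)) atTop
      (𝓝 (R ω)) := by
  have hk' : (0:ℝ) < k := Nat.cast_pos.2 hk
  have h := hξ.ae_tendsto_fluctuation hp hp1 (c := 1 / (2 * k)) (C := 1) (by positivity)
    (Φ := fun n => blueFluct p (n / k))
    (fun n => by
      have h := isFluctuation_blueFluct hp hp1.le (n / k)
      rwa [show (n : ℝ) / k / 2 = 1 / (2 * k) * n by field_simp] at h)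
    (fun n => by
      filter_upwards [hξ.ae_isGood hp hp1.le] with ω hω
      exact hω.summable_of_population (n / k) fun v hv => hω.blueFluct_eq_zero hv)
  filter_upwards [h, hξ.ae_tendsto_population_lattice hp hp1 hk hR, hξ.ae_isGood hp hp1.le]
    with ω h1 h2 hgood
  have h3 : Tendsto (fun n : ℕ => Real.exp (-(2 - p) * (n / k))) atTop (𝓝 0) :=
    Real.tendsto_exp_atBot.comp
      ((tendsto_natCast_div_atTop hk).const_mul_atTop_of_neg (by linarith))
  have h4 := (h1.add (h2.const_mul (2 - p))).sub (h3.const_mul (1 - p))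
  have e : 0 + (2 - p) * (R ω / (2 - p)) - (1 - p) * 0 = R ω := by
    rw [mul_div_cancel₀ _ (by linarith)]; ring
  rw [e] at h4
  refine h4.congr fun n => ?_
  have h5 := hgood.tsum_blueFluct (t := n / k) (by positivity)
  change ∑' v, blueFluct p (n / k) (birth ξ v ω) (ξ v ω) = _ at h5
  rw [h5, sizeMartingale]
  ring

end

/-! ### From lattices to continuous time -/

/-- A mesh 1/k with U k < b is fixed first; then t is compared with the lattice point of index ⌊tk⌋.
-/
theorem eventually_le_of_lattice {f : ℝ → ℝ} {u : ℕ → ℕ → ℝ} {U : ℕ → ℝ} {L : ℝ}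
    (hf : ∀ k : ℕ, 0 < k → ∀ (n : ℕ) (t : ℝ), (n : ℝ) / k ≤ t → t < ((n + 1 : ℕ) : ℝ) / k →
      f t ≤ u k n)
    (hu : ∀ k, 0 < k → Tendsto (u k) atTop (𝓝 (U k))) (hU : Tendsto U atTop (𝓝 L)) {b : ℝ}
    (hb : L < b) : ∀ᶠ t in atTop, f t < b := by
  obtain ⟨k, hk, hk0⟩ := ((hU.eventually_lt_const hb).and (eventually_gt_atTop 0)).exists
  have hk' : (0:ℝ) < k := Nat.cast_pos.2 hk0
  have h1 := (hu k hk0).eventually_lt_const hk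
  have h2 : Tendsto (fun t : ℝ => ⌊t * k⌋₊) atTop atTop :=
    tendsto_nat_floor_atTop.comp (tendsto_id.atTop_mul_const hk')
  filter_upwards [h2.eventually h1, eventually_ge_atTop 0] with t ht ht0
  refine (hf k hk0 _ t ?_ ?_).trans_lt ht
  · rw [div_le_iff₀ hk']
    exact Nat.floor_le (by positivity)
  · rw [lt_div_iff₀ hk']
    exact_mod_cast Nat.lt_floor_add_one (t * k)

theorem tendsto_of_lattice {f : ℝ → ℝ} {l u : ℕ → ℕ → ℝ} {V U : ℕ → ℝ} {L : ℝ}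
    (hf : ∀ k : ℕ, 0 < k → ∀ (n : ℕ) (t : ℝ), (n : ℝ) / k ≤ t → t < ((n + 1 : ℕ) : ℝ) / k →
      l k n ≤ f t ∧ f t ≤ u k n)
    (hl : ∀ k, 0 < k → Tendsto (l k) atTop (𝓝 (V k))) (hV : Tendsto V atTop (𝓝 L))
    (hu : ∀ k, 0 < k → Tendsto (u k) atTop (𝓝 (U k))) (hU : Tendsto U atTop (𝓝 L)) :
    Tendsto f atTop (𝓝 L) := by
  refine tendsto_order.2 ⟨fun a ha => ?_, fun b hb =>
    eventually_le_of_lattice (fun k hk n t h1 h2 => (hf k hk n t h1 h2).2) hu hU hb⟩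
  have h := eventually_le_of_lattice (f := fun t => -f t) (u := fun k n => -l k n)
    (U := fun k => -V k) (L := -L) (b := -a)
    (fun k hk n t h1 h2 => neg_le_neg (hf k hk n t h1 h2).1) (fun k hk => (hl k hk).neg) hV.neg
    (by linarith)
  filter_upwards [h] with t ht
  linarith

theorem tendsto_exp_div (a : ℝ) : Tendsto (fun k : ℕ => Real.exp (a / k)) atTop (𝓝 1) := by
  have h := (Real.continuous_exp.tendsto 0).comp (tendsto_const_div_atTop_nhds_zero_nat a)
  rwa [Real.exp_zero] at h

/-- A monotone function whose discounted values converge along all lattices. -/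
theorem tendsto_of_monotone_lattice {α L : ℝ} (hα : 0 < α) {Y : ℝ → ℝ} (hY : Monotone Y)
    (h0 : ∀ t, 0 ≤ Y t)
    (h : ∀ k : ℕ, 0 < k → Tendsto (fun n : ℕ => Real.exp (-α * (n / k)) * Y (n / k)) atTop (𝓝 L)) :
    Tendsto (fun t => Real.exp (-α * t) * Y t) atTop (𝓝 L) := by
  refine tendsto_of_lattice
    (l := fun k n => Real.exp (-α / k) * (Real.exp (-α * (n / k)) * Y (n / k)))
    (u := fun k n => Real.exp (α / k) *
      (Real.exp (-α * (((n + 1 : ℕ) : ℝ) / k)) * Y (((n + 1 : ℕ) : ℝ) / k)))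
    (V := fun k => Real.exp (-α / k) * L) (U := fun k => Real.exp (α / k) * L) ?_
    (fun k hk => (h k hk).const_mul _) ?_
    (fun k hk => ((tendsto_add_atTop_iff_nat 1).2 (h k hk)).const_mul _) ?_
  · intro k hk n t h1 h2
    have hk' : (0:ℝ) < k := Nat.cast_pos.2 hk
    have e : ((n + 1 : ℕ) : ℝ) / k = n / k + 1 / k := by push_cast; ring
    rw [← mul_assoc, ← mul_assoc, ← Real.exp_add, ← Real.exp_add]
    constructor
    · refine mul_le_mul (Real.exp_le_exp.2 ?_) (hY h1) (h0 _) (Real.exp_pos _).le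
      rw [e] at h2
      have := mul_le_mul_of_nonneg_left h2.le hα.le
      have e2 : -α / k = -α * (1 / k) := by ring
      rw [e2]; linarith
    · refine mul_le_mul (Real.exp_le_exp.2 ?_) (hY h2.le) (h0 _) (Real.exp_pos _).le
      rw [e]
      have := mul_le_mul_of_nonneg_left h1 hα.le
      have e2 : α / k = α * (1 / k) := by ring
      rw [e2]; linarith
  · simpa using (tendsto_exp_div (-α)).mul_const L
  · simpa using (tendsto_exp_div α).mul_const L

/-! ### The largest value of a characteristic over a short time -/

/-- The supremum of `φ o` over the rational translates of `u` by less than `1 / k`. -/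
def upperChar (φ : Offspring → ℝ → ℝ) (k : ℕ) (o : Offspring) (u : ℝ) : ℝ :=
  ⨆ r : {q : ℚ // 0 ≤ q ∧ (q : ℝ) < 1 / (k : ℝ)}, φ o (u + ((r : ℚ) : ℝ))

section UpperChar

variable {φ : Offspring → ℝ → ℝ} {C : ℝ} {k : ℕ}

theorem nonempty_rat_lt (hk : 0 < k) : Nonempty {q : ℚ // 0 ≤ q ∧ (q : ℝ) < 1 / (k : ℝ)} :=
  ⟨⟨0, le_rfl, by simpa using hk⟩⟩

theorem IsMeasurableCharacteristic.le_upperChar (hφ : IsMeasurableCharacteristic φ C)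
    (o : Offspring) {u : ℝ} (hu : 0 ≤ u) (r : {q : ℚ // 0 ≤ q ∧ (q : ℝ) < 1 / (k : ℝ)}) :
    φ o (u + ((r : ℚ) : ℝ)) ≤ upperChar φ k o u := by
  refine le_ciSup (f := fun r : {q : ℚ // 0 ≤ q ∧ (q : ℝ) < 1 / (k : ℝ)} =>
    φ o (u + ((r : ℚ) : ℝ))) ⟨C, ?_⟩ r
  rintro _ ⟨r, rfl⟩
  exact hφ.le o _ (add_nonneg hu (Rat.cast_nonneg.2 r.2.1))

/-- Rational translates keep the supremum countable, hence measurable. The result need not be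
right-continuous, so the lattice theorem is stated for merely measurable characteristics. -/
theorem IsMeasurableCharacteristic.upperChar (hφ : IsMeasurableCharacteristic φ C) (hk : 0 < k) :
    IsMeasurableCharacteristic (upperChar φ k) C := by
  have := nonempty_rat_lt hk
  refine ⟨?_, fun o u hu => ?_, fun o u hu => ?_⟩
  · refine Measurable.iSup fun r => ?_
    exact hφ.measurable.comp (measurable_fst.prodMk (measurable_snd.add_const _))
  · refine le_trans ?_ (hφ.le_upperChar o hu ⟨0, le_rfl, by simpa using hk⟩)
    exact hφ.nonneg o _ (by simpa using hu)
  · exact ciSup_le fun r => hφ.le o _ (add_nonneg hu (Rat.cast_nonneg.2 r.2.1))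

/-- The strict inequality s < 1/k leaves room for rationals just to the right of s inside the
window, and right-continuity compares φ there with its value at u + s. -/
theorem IsMeasurableCharacteristic.le_upperChar_of_rightContinuous
    (hφ : IsMeasurableCharacteristic φ C) {o : Offspring}
    (ho : ∀ t, 0 ≤ t → ContinuousWithinAt (φ o) (Set.Ici t) t) {u s : ℝ} (hu : 0 ≤ u) (hs : 0 ≤ s)
    (hsk : s < 1 / k) : φ o (u + s) ≤ SuperstarBP.upperChar φ k o u := by
  refine le_of_forall_lt fun c hc => ?_
  have h1 := (ho (u + s) (add_nonneg hu hs)).eventually (lt_mem_nhds hc)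
  rw [eventually_nhdsWithin_iff, Metric.eventually_nhds_iff] at h1
  obtain ⟨ε, hε, h2⟩ := h1
  obtain ⟨q, hq1, hq2⟩ := exists_rat_btwn (lt_min (lt_add_of_pos_right s hε) hsk)
  have hq3 := lt_min_iff.1 hq2
  have h3 : c < φ o (u + q) := by
    refine h2 ?_ ?_
    · rw [Real.dist_eq, abs_lt]; constructor <;> linarith [hq3.1]
    · exact add_le_add_right hq1.le u
  exact h3.trans_le (hφ.le_upperChar o hu
    ⟨q, by exact_mod_cast hs.trans hq1.le, hq3.2⟩)

theorem IsMeasurableCharacteristic.tendsto_upperChar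
    (hφ : IsMeasurableCharacteristic φ C) {o : Offspring}
    (ho : ∀ t, 0 ≤ t → ContinuousWithinAt (φ o) (Set.Ici t) t) {u : ℝ} (hu : 0 ≤ u) :
    Tendsto (fun k : ℕ => SuperstarBP.upperChar φ (k + 1) o u) atTop (𝓝 (φ o u)) := by
  refine tendsto_order.2 ⟨fun a ha => Eventually.of_forall fun k => ha.trans_le ?_, fun b hb => ?_⟩
  · have := hφ.le_upperChar_of_rightContinuous (k := k + 1) ho hu le_rfl (by positivity)
    simpa using this
  · obtain ⟨c, hc, hcb⟩ := exists_between hb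
    have h1 := (ho u hu).eventually (gt_mem_nhds hc)
    rw [eventually_nhdsWithin_iff, Metric.eventually_nhds_iff] at h1
    obtain ⟨ε, hε, h2⟩ := h1
    have h3 : ∀ᶠ k : ℕ in atTop, 1 / ((k : ℝ) + 1) < ε :=
      tendsto_one_div_add_atTop_nhds_zero_nat.eventually_lt_const hε
    filter_upwards [h3] with k hk
    have := nonempty_rat_lt (k := k + 1) (by omega)
    refine (ciSup_le fun r => le_of_lt (h2 ?_ ?_)).trans_lt hcb
    · have hr := r.2.2
      have hr0 : (0:ℝ) ≤ ((r : ℚ) : ℝ) := Rat.cast_nonneg.2 r.2.1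
      push_cast at hr
      rw [Real.dist_eq, add_sub_cancel_left, abs_of_nonneg hr0]
      linarith
    · have hr0 : (0:ℝ) ≤ ((r : ℚ) : ℝ) := Rat.cast_nonneg.2 r.2.1
      exact Set.mem_Ici.2 (by linarith)

theorem IsMeasurableCharacteristic.tendsto_limitMean_upperChar {p : ℝ} (h0 : 0 ≤ p) (h1 : p ≤ 1)
    (hφ : IsMeasurableCharacteristic φ C)
    (hr : ∀ᵐ o ∂(offspringLaw p), ∀ t, 0 ≤ t → ContinuousWithinAt (φ o) (Set.Ici t) t) :
    Tendsto (fun k : ℕ => limitMean p (SuperstarBP.upperChar φ (k + 1))) atTop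
      (𝓝 (limitMean p φ)) := by
  have := isProbabilityMeasure_offspringLaw h0 h1
  -- The shift to `k + 1` avoids the empty window, since 1/0 = 0.
  have hψ : ∀ k : ℕ, IsMeasurableCharacteristic (SuperstarBP.upperChar φ (k + 1)) C :=
    fun k => hφ.upperChar (by omega)
  have hi : IntegrableOn (fun s => C * Real.exp (-s)) (Set.Ioi 0) := by
    have h1 : IntegrableOn (fun s => Real.exp (-s)) (Set.Ioi 0) := by
      simpa using integrableOn_exp_mul_Ioi (a := -1) (by norm_num) 0
    exact h1.const_mul C
  refine Tendsto.congr (fun k => renewLimit_charMean p _) ?_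
  rw [← renewLimit_charMean]
  refine tendsto_integral_of_dominated_convergence (fun s => C * Real.exp (-s))
    (fun k => ((hψ k).isDiscounted h0 h1).measurable.aestronglyMeasurable) hi (fun k => ?_) ?_
  · filter_upwards [ae_restrict_mem measurableSet_Ioi] with s hs
    have hd := (hψ k).isDiscounted h0 h1
    rw [Real.norm_of_nonneg (hd.nonneg s)]
    exact hd.le s (le_of_lt hs)
  · filter_upwards [ae_restrict_mem measurableSet_Ioi] with s hs
    have hs' : 0 ≤ s := le_of_lt hs
    simp only [charMean, if_pos hs']
    refine Tendsto.const_mul _ ?_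
    refine tendsto_integral_of_dominated_convergence (fun _ => C)
      (fun k => ((hψ k).integrable h0 h1 hs').aestronglyMeasurable) (integrable_const C)
      (fun k => Eventually.of_forall fun o => ?_) ?_
    · rw [Real.norm_of_nonneg ((hψ k).nonneg o s hs')]
      exact (hψ k).le o s hs'
    · filter_upwards [hr] with o ho using hφ.tendsto_upperChar ho hs'

/-- Vertices born by n/k are covered by the supremum over the window; those born in (n/k, t] cost at
most C each. -/
theorem IsMeasurableCharacteristic.countedProcess_le {p : ℝ} {x : Vertex → Offspring}
    (hx : IsGood p x) (hφ : IsMeasurableCharacteristic φ C)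
    (ho : ∀ v, ∀ t, 0 ≤ t → ContinuousWithinAt (φ (x v)) (Set.Ici t) t) (hk : 0 < k) {n : ℕ}
    {t : ℝ} (h1 : (n : ℝ) / k ≤ t) (h2 : t < ((n + 1 : ℕ) : ℝ) / k) :
    countedProcess φ x t ≤ countedProcess (SuperstarBP.upperChar φ k) x (n / k) +
      C * ((population x (((n + 1 : ℕ) : ℝ) / k)).ncard - (population x (n / k)).ncard) := by
  have hψ := hφ.upperChar hk
  have hC := hφ.const_nonneg
  rw [countedProcess_eq, countedProcess_eq, hx.ncard_population, hx.ncard_population]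
  have s1 : Summable fun v => if birthTime x v ≤ t then φ (x v) (t - birthTime x v) else 0 :=
    hx.summable_of_population t fun v hv => if_neg (not_le.2 hv)
  have s2 : Summable fun v => if birthTime x v ≤ n / k then
      SuperstarBP.upperChar φ k (x v) (n / k - birthTime x v) else 0 :=
    hx.summable_of_population (n / k) fun v hv => if_neg (not_le.2 hv)
  have s3 : ∀ t, Summable fun v => if birthTime x v ≤ t then (1:ℝ) else 0 := fun t =>
    hx.summable_of_population t fun v hv => if_neg (not_le.2 hv)
  rw [← Summable.tsum_sub (s3 _) (s3 _), ← tsum_mul_left,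
    ← Summable.tsum_add s2 (((s3 _).sub (s3 _)).mul_left C)]
  refine s1.tsum_le_tsum (fun v => ?_) (s2.add (((s3 _).sub (s3 _)).mul_left C))
  by_cases hv1 : birthTime x v ≤ n / k
  · have hv2 := hv1.trans h1
    have hv3 := hv2.trans h2.le
    simp only [if_pos hv1, if_pos hv2, if_pos hv3, sub_self, mul_zero, add_zero]
    have h := hφ.le_upperChar_of_rightContinuous (k := k) (ho v) (sub_nonneg.2 hv1)
      (sub_nonneg.2 h1) (by
        have : ((n + 1 : ℕ) : ℝ) / k = n / k + 1 / k := by push_cast; ring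
        linarith)
    rwa [show (n : ℝ) / k - birthTime x v + (t - n / k) = t - birthTime x v by ring] at h
  · by_cases hv2 : birthTime x v ≤ t
    · simp only [if_neg hv1, if_pos hv2, if_pos (hv2.trans h2.le), sub_zero, mul_one, zero_add]
      exact hφ.le _ _ (sub_nonneg.2 hv2)
    · simp only [if_neg hv1, if_neg hv2, sub_zero, zero_add]
      split_ifs <;> simp [hC]

theorem IsMeasurableCharacteristic.countedProcess_nonneg (hφ : IsMeasurableCharacteristic φ C)
    (x : Vertex → Offspring) (t : ℝ) : 0 ≤ countedProcess φ x t := by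
  rw [countedProcess_eq]
  refine tsum_nonneg fun v => ?_
  split_ifs with h
  · exact hφ.nonneg _ _ (sub_nonneg.2 h)
  · exact le_rfl

end UpperChar

theorem IsGood.monotone_population {p : ℝ} {x : Vertex → Offspring} (hx : IsGood p x) :
    Monotone fun t => ((population x t).ncard : ℝ) := fun _ b hab =>
  Nat.cast_le.2 (Set.ncard_le_ncard (fun _ hv => le_trans (b := _) hv hab) (hx.regular.finite b))

theorem IsGood.monotone_bluePopulation {p : ℝ} {x : Vertex → Offspring} (hx : IsGood p x) :
    Monotone fun t => ((bluePopulation x t).ncard : ℝ) := fun a b hab =>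
  Nat.cast_le.2 (Set.ncard_le_ncard (s := bluePopulation x a) (t := bluePopulation x b)
    (fun _ (hv : _ ≤ a ∧ _) => (⟨hv.1.trans hab, hv.2⟩ : _ ≤ b ∧ _))
    ((hx.regular.finite b).subset fun v (hv : v ∈ population x b ∧ _) => hv.1))

/-- Applied to the population, this bounds the discounted births in one mesh interval; the limit
vanishes as k → ∞. -/
theorem tendsto_increment_lattice {α L : ℝ} {Y : ℝ → ℝ}
    {k : ℕ} (h : Tendsto (fun n : ℕ => Real.exp (-α * (n / k)) * Y (n / k)) atTop (𝓝 L)) :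
    Tendsto (fun n : ℕ => Real.exp (-α * (n / k)) * (Y (((n + 1 : ℕ) : ℝ) / k) - Y (n / k))) atTop
      (𝓝 (Real.exp (α / k) * L - L)) := by
  refine ((((tendsto_add_atTop_iff_nat 1).2 h).const_mul (Real.exp (α / k))).sub h).congr
    fun n => ?_
  rw [← mul_assoc, ← Real.exp_add, mul_sub]
  congr 3
  push_cast; ring

theorem tendsto_exp_div_mul_sub (α L : ℝ) :
    Tendsto (fun k : ℕ => Real.exp (α / k) * L - L) atTop (𝓝 0) := by
  simpa using ((tendsto_exp_div α).mul_const L).sub_const L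

section

/-! ### The order of birth -/

section NthBorn

variable {p : ℝ} {x : Vertex → Offspring}

theorem IsRegular.exists_first_notMem (hx : IsRegular p x) {S : Set Vertex} (hS : S.Finite) :
    ∃ v, v ∉ S ∧ ∀ w, w ∉ S → birthTime x v ≤ birthTime x w := by
  obtain ⟨v₀, hv₀⟩ := hS.exists_notMem
  have hT : {w | w ∉ S ∧ birthTime x w ≤ birthTime x v₀}.Finite :=
    (hx.finite (birthTime x v₀)).subset fun w hw => hw.2
  obtain ⟨v, hv, hmin⟩ := Set.exists_min_image _ (birthTime x) hT ⟨v₀, hv₀, le_rfl⟩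
  refine ⟨v, hv.1, fun w hw => ?_⟩
  rcases le_total (birthTime x w) (birthTime x v₀) with h | h
  · exact hmin w ⟨hw, h⟩
  · exact (hmin v₀ ⟨hv₀, le_rfl⟩).trans h

theorem IsRegular.setOf_le_eq_insert (hx : IsRegular p x) (v : Vertex) :
    {w | birthTime x w ≤ birthTime x v} = insert v {w | birthTime x w < birthTime x v} := by
  ext w
  simp only [Set.mem_ofPred_eq, Set.mem_insert_iff]
  rw [le_iff_lt_or_eq, hx.injective.eq_iff, or_comm]

theorem IsRegular.encard_setOf_le (hx : IsRegular p x) (v : Vertex) :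
    {w | birthTime x w ≤ birthTime x v}.encard =
      {w | birthTime x w < birthTime x v}.encard + 1 := by
  rw [hx.setOf_le_eq_insert, Set.encard_insert_of_notMem]
  exact fun h : birthTime x v < birthTime x v => lt_irrefl _ h

theorem IsRegular.exists_encard_eq (hx : IsRegular p x) (m : ℕ) :
    ∃ v, {w | birthTime x w < birthTime x v}.encard = m := by
  induction m with
  | zero =>
    obtain ⟨v, -, hv⟩ := hx.exists_first_notMem Set.finite_empty
    refine ⟨v, ?_⟩
    rw [Nat.cast_zero, Set.encard_eq_zero, Set.eq_empty_iff_forall_notMem]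
    exact fun w hw => not_lt.2 (hv w (Set.notMem_empty w)) hw
  | succ m ih =>
    obtain ⟨v, hv⟩ := ih
    -- The successor is the earliest vertex outside the population at the birth of `v`.
    obtain ⟨v', h1, h2⟩ := hx.exists_first_notMem (hx.finite (birthTime x v))
    refine ⟨v', ?_⟩
    rw [Nat.cast_succ, ← hv, ← hx.encard_setOf_le]
    congr 1
    ext w
    have h1' : ¬ birthTime x v' ≤ birthTime x v := h1
    rw [Set.mem_ofPred_eq, Set.mem_ofPred_eq]
    refine ⟨fun hw => ?_, fun hw => lt_of_le_of_lt hw (not_le.1 h1')⟩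
    by_contra h
    exact not_lt.2 (h2 w h) hw

theorem IsRegular.encard_lt_nthBorn (hx : IsRegular p x) (m : ℕ) :
    {w | birthTime x w < birthTime x (nthBorn x m)}.encard = m :=
  Classical.epsilon_spec (hx.exists_encard_eq m)

theorem IsRegular.strictMono_nthBorn (hx : IsRegular p x) :
    StrictMono fun m => birthTime x (nthBorn x m) := by
  refine strictMono_nat_of_lt_succ fun m => lt_of_not_ge fun h => ?_
  have h1 := Set.encard_le_encard (s := {w | birthTime x w < birthTime x (nthBorn x (m + 1))})
    (t := {w | birthTime x w < birthTime x (nthBorn x m)}) fun w hw => lt_of_lt_of_le hw h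
  rw [hx.encard_lt_nthBorn, hx.encard_lt_nthBorn] at h1
  exact absurd (Nat.cast_le.1 h1) (by omega)

/-- One of the two sets of vertices contains the other, and both have m + 1 elements. -/
theorem IsRegular.lt_nthBorn_succ_iff (hx : IsRegular p x) (m : ℕ) (w : Vertex) :
    birthTime x w < birthTime x (nthBorn x (m + 1)) ↔
      birthTime x w ≤ birthTime x (nthBorn x m) := by
  have hle := (hx.encard_setOf_le (nthBorn x m)).trans
    (by rw [hx.encard_lt_nthBorn, ← Nat.cast_succ])
  have h : {w | birthTime x w ≤ birthTime x (nthBorn x m)} =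
      {w | birthTime x w < birthTime x (nthBorn x (m + 1))} :=
    (Set.finite_of_encard_eq_coe hle).eq_of_subset_of_encard_le
      (fun w hw => lt_of_le_of_lt (b := birthTime x (nthBorn x m)) hw
        (hx.strictMono_nthBorn m.lt_succ_self))
      (by rw [hle, hx.encard_lt_nthBorn])
  exact (Set.ext_iff.1 h w).symm

theorem IsRegular.tendsto_birthTime_nthBorn (hx : IsRegular p x) :
    Tendsto (fun m => birthTime x (nthBorn x m)) atTop atTop := by
  refine tendsto_atTop_atTop_of_monotone hx.strictMono_nthBorn.monotone fun t => ?_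
  by_contra! h
  refine Set.not_injOn_infinite_finite_image (f := nthBorn x) Set.infinite_univ
    ((hx.finite t).subset ?_) ?_
  · rintro _ ⟨m, -, rfl⟩
    exact (h m).le
  · exact fun a _ b _ hab => hx.strictMono_nthBorn.injective (congrArg (birthTime x) hab)

theorem IsGood.reproductionMartingale_eq (hx : IsGood p x) (m : ℕ) :
    reproductionMartingale p x m = 1 + ∑' v, if birthTime x v < birthTime x (nthBorn x m) then
      reproTerm p (birthTime x v) (x v) else 0 := by
  induction m with
  | zero =>
    have h := hx.regular.encard_lt_nthBorn 0
    rw [Nat.cast_zero, Set.encard_eq_zero, Set.eq_empty_iff_forall_notMem] at h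
    have h' : ∀ v, ¬ birthTime x v < birthTime x (nthBorn x 0) := h
    simp [reproductionMartingale, h']
  | succ m ih =>
    rw [reproductionMartingale, ih, add_assoc]
    congr 1
    have s1 : Summable fun v => if birthTime x v < birthTime x (nthBorn x m) then
        reproTerm p (birthTime x v) (x v) else 0 :=
      hx.summable_of_population (birthTime x (nthBorn x m)) fun v hv => if_neg hv.not_gt
    have s2 := (hasSum_ite_eq (nthBorn x m)
      (reproTerm p (birthTime x (nthBorn x m)) (x (nthBorn x m))))
    refine (s1.hasSum.add s2).tsum_eq.symm.trans (tsum_congr fun v => ?_)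
    simp only [hx.regular.lt_nthBorn_succ_iff]
    by_cases h : v = nthBorn x m
    · simp [h]
    · have h' : birthTime x v ≤ birthTime x (nthBorn x m) ↔
          birthTime x v < birthTime x (nthBorn x m) :=
        ⟨fun hv => lt_of_le_of_ne hv fun e => h (hx.regular.injective e), le_of_lt⟩
      simp [h, h']

/-- Step m + 1 adds the contribution of `nthBorn x m` itself, which `reproAt` includes through its
weak inequality. -/
theorem IsGood.reproductionMartingale_succ (hx : IsGood p x) (m : ℕ) :
    reproductionMartingale p x (m + 1) = reproAt p x (birthTime x (nthBorn x m)) := by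
  rw [hx.reproductionMartingale_eq, reproAt]
  simp only [hx.regular.lt_nthBorn_succ_iff]

end NthBorn

/-! ### The reproduction martingale in continuous time -/

theorem neg_exp_le_reproTerm (p s : ℝ) (o : Offspring) :
    -Real.exp (-(2 - p) * s) ≤ reproTerm p s o := by
  have := mul_nonneg (Real.exp_pos (-(2 - p) * s)).le (discountedOffspring_nonneg p o)
  unfold reproTerm
  linarith

/-- A vertex can lower the martingale by at most e^{-(2-p)σ}, as the discounted offspring is
non-negative. Upward jumps have no such bound, so the estimate is one-sided; using it from the left
lattice point to t and from t to the right one encloses the value at t. -/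
theorem IsGood.reproAt_le_add {p : ℝ} {x : Vertex → Offspring} (hx : IsGood p x) (hp : p ≤ 2)
    {a b c d : ℝ} (hab : a ≤ b) (hbc : b ≤ c) (hcd : c ≤ d) :
    reproAt p x b ≤ reproAt p x c +
      Real.exp (-(2 - p) * a) * ((population x d).ncard - (population x a).ncard) := by
  rw [hx.ncard_population, hx.ncard_population]
  have s1 : ∀ t, Summable fun v => if birthTime x v ≤ t then
      reproTerm p (birthTime x v) (x v) else 0 := fun t =>
    hx.summable_of_population t fun v hv => if_neg (not_le.2 hv)
  have s3 : ∀ t, Summable fun v => if birthTime x v ≤ t then (1:ℝ) else 0 := fun t =>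
    hx.summable_of_population t fun v hv => if_neg (not_le.2 hv)
  have s4 := ((s3 d).sub (s3 a)).mul_left (Real.exp (-(2 - p) * a))
  rw [← Summable.tsum_sub (s3 _) (s3 _), ← tsum_mul_left, reproAt, reproAt, add_assoc,
    ← Summable.tsum_add (s1 c) s4, add_le_add_iff_left]
  refine (s1 b).tsum_le_tsum (fun v => ?_) ((s1 c).add s4)
  by_cases h1 : birthTime x v ≤ b
  · have h2 := h1.trans hbc
    simp only [if_pos h1, if_pos h2, if_pos (h2.trans hcd)]
    split_ifs <;> simp [Real.exp_nonneg]
  · have ha : ¬ birthTime x v ≤ a := fun h => h1 (h.trans hab)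
    simp only [if_neg h1, if_neg ha, sub_zero]
    by_cases h2 : birthTime x v ≤ c
    · simp only [if_pos h2, if_pos (h2.trans hcd), mul_one]
      have h3 := neg_exp_le_reproTerm p (birthTime x v) (x v)
      have h4 : Real.exp (-(2 - p) * birthTime x v) ≤ Real.exp (-(2 - p) * a) :=
        Real.exp_le_exp.2 (by nlinarith [not_le.1 ha])
      linarith
    · simp only [if_neg h2, zero_add]
      split_ifs <;> simp [Real.exp_nonneg]

theorem IsGood.tendsto_reproAt {p : ℝ} {x : Vertex → Offspring} (hx : IsGood p x) (hp : p ≤ 2)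
    {R : ℝ} (hR : ∀ k : ℕ, 0 < k → Tendsto (fun n : ℕ => reproAt p x (n / k)) atTop (𝓝 R))
    {L : ℝ} (hN : ∀ k : ℕ, 0 < k → Tendsto (fun n : ℕ => Real.exp (-(2 - p) * (n / k)) *
      ((population x (n / k)).ncard : ℝ)) atTop (𝓝 L)) :
    Tendsto (reproAt p x) atTop (𝓝 R) := by
  have hD : ∀ k : ℕ, 0 < k → Tendsto (fun n : ℕ => Real.exp (-(2 - p) * (n / k)) *
      (((population x (((n + 1 : ℕ) : ℝ) / k)).ncard : ℝ) - (population x (n / k)).ncard)) atTop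
      (𝓝 (Real.exp ((2 - p) / k) * L - L)) := fun k hk =>
    tendsto_increment_lattice (Y := fun t => ((population x t).ncard : ℝ)) (hN k hk)
  have h0 := tendsto_exp_div_mul_sub (2 - p) L
  refine tendsto_of_lattice
    (l := fun k n => reproAt p x (n / k) - Real.exp (-(2 - p) * (n / k)) *
      (((population x (((n + 1 : ℕ) : ℝ) / k)).ncard : ℝ) - (population x (n / k)).ncard))
    (u := fun k n => reproAt p x (((n + 1 : ℕ) : ℝ) / k) + Real.exp (-(2 - p) * (n / k)) *
      (((population x (((n + 1 : ℕ) : ℝ) / k)).ncard : ℝ) - (population x (n / k)).ncard))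
    (fun k _ n t h1 h2 => ⟨sub_le_iff_le_add.2 (hx.reproAt_le_add hp le_rfl h1 h2.le),
      hx.reproAt_le_add hp h1 h2.le le_rfl⟩)
    (fun k hk => (hR k hk).sub (hD k hk)) ?_
    (fun k hk => ((tendsto_add_atTop_iff_nat 1).2 (hR k hk)).add (hD k hk)) ?_
  · simpa using h0.const_sub R
  · simpa using h0.const_add R

theorem IsGood.tendsto_reproductionMartingale {p : ℝ} {x : Vertex → Offspring} (hx : IsGood p x)
    {R : ℝ} (hR : Tendsto (reproAt p x) atTop (𝓝 R)) :
    Tendsto (reproductionMartingale p x) atTop (𝓝 R) := by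
  rw [← tendsto_add_atTop_iff_nat 1]
  exact (hR.comp hx.regular.tendsto_birthTime_nthBorn).congr fun m =>
    (hx.reproductionMartingale_succ m).symm

/-! ### Characteristics in continuous time -/

theorem IsGood.tendsto_population {p : ℝ} {x : Vertex → Offspring} (hx : IsGood p x) (hp : p < 2)
    {L : ℝ} (hN : ∀ k : ℕ, 0 < k → Tendsto (fun n : ℕ => Real.exp (-(2 - p) * (n / k)) *
      ((population x (n / k)).ncard : ℝ)) atTop (𝓝 L)) :
    Tendsto (fun t => Real.exp (-(2 - p) * t) * ((population x t).ncard : ℝ)) atTop (𝓝 L) :=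
  tendsto_of_monotone_lattice (by linarith) hx.monotone_population (fun _ => Nat.cast_nonneg _) hN

theorem IsGood.tendsto_sizeMartingale {p : ℝ} {x : Vertex → Offspring} (hx : IsGood p x)
    (hp : p < 2) {L : ℝ}
    (h : ∀ k : ℕ, 0 < k → Tendsto (fun n : ℕ => sizeMartingale p x (n / k)) atTop (𝓝 L)) :
    Tendsto (sizeMartingale p x) atTop (𝓝 L) :=
  tendsto_of_monotone_lattice (Y := fun t => ((population x t).ncard : ℝ) +
    (bluePopulation x t).ncard) (by linarith)
    (hx.monotone_population.add hx.monotone_bluePopulation) (fun _ => by positivity) h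

theorem IsMeasurableCharacteristic.eventually_countedProcess_lt {p C : ℝ} {x : Vertex → Offspring}
    {φ : Offspring → ℝ → ℝ} (hx : IsGood p x) (hp : p ≤ 2)
    (hφ : IsMeasurableCharacteristic φ C)
    (ho : ∀ v, ∀ t, 0 ≤ t → ContinuousWithinAt (φ (x v)) (Set.Ici t) t) {L : ℝ}
    (hN : ∀ k : ℕ, 0 < k → Tendsto (fun n : ℕ => Real.exp (-(2 - p) * (n / k)) *
      ((population x (n / k)).ncard : ℝ)) atTop (𝓝 L)) {U : ℕ → ℝ} {M : ℝ}
    (hZ : ∀ k : ℕ, 0 < k → Tendsto (fun n : ℕ => Real.exp (-(2 - p) * (n / k)) *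
      countedProcess (SuperstarBP.upperChar φ k) x (n / k)) atTop (𝓝 (U k)))
    (hU : Tendsto (fun k => U (k + 1)) atTop (𝓝 M)) {b : ℝ} (hb : M < b) :
    ∀ᶠ t in atTop, Real.exp (-(2 - p) * t) * countedProcess φ x t < b := by
  have hU' : Tendsto (fun k : ℕ => U k + C * (Real.exp ((2 - p) / k) * L - L)) atTop (𝓝 M) := by
    simpa using ((tendsto_add_atTop_iff_nat 1).1 hU).add
      ((tendsto_exp_div_mul_sub (2 - p) L).const_mul C)
  refine eventually_le_of_lattice (fun k hk n t h1 h2 => ?_) (fun k hk => (hZ k hk).add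
    ((tendsto_increment_lattice (Y := fun t => ((population x t).ncard : ℝ)) (hN k hk)).const_mul
      C)) hU' hb
  have h3 := hφ.countedProcess_le hx ho hk h1 h2
  have h4 := hφ.countedProcess_nonneg x t
  calc Real.exp (-(2 - p) * t) * countedProcess φ x t
      ≤ Real.exp (-(2 - p) * (n / k)) * (countedProcess (SuperstarBP.upperChar φ k) x (n / k) +
        C * ((population x (((n + 1 : ℕ) : ℝ) / k)).ncard - (population x (n / k)).ncard)) :=
        mul_le_mul (Real.exp_le_exp.2 (by nlinarith)) h3 h4 (Real.exp_pos _).le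
    _ = _ := by ring

theorem IsMeasurableCharacteristic.const_sub {C : ℝ} {φ : Offspring → ℝ → ℝ}
    (hφ : IsMeasurableCharacteristic φ C) :
    IsMeasurableCharacteristic (fun o t => C - φ o t) C :=
  ⟨hφ.measurable.const_sub C, fun o t ht => sub_nonneg.2 (hφ.le o t ht),
    fun o t ht => sub_le_self C (hφ.nonneg o t ht)⟩

theorem IsGood.countedProcess_const_sub {p : ℝ} {x : Vertex → Offspring} (hx : IsGood p x)
    (C : ℝ) (φ : Offspring → ℝ → ℝ) (t : ℝ) :
    countedProcess (fun o t => C - φ o t) x t =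
      C * (population x t).ncard - countedProcess φ x t := by
  have s1 : Summable fun v => if birthTime x v ≤ t then (1:ℝ) else 0 :=
    hx.summable_of_population t fun v hv => if_neg (not_le.2 hv)
  have s2 : Summable fun v => if birthTime x v ≤ t then φ (x v) (t - birthTime x v) else 0 :=
    hx.summable_of_population t fun v hv => if_neg (not_le.2 hv)
  rw [countedProcess_eq, countedProcess_eq, hx.ncard_population, ← tsum_mul_left,
    ← Summable.tsum_sub (s1.mul_left C) s2]
  refine tsum_congr fun v => ?_
  split_ifs <;> simp

theorem IsMeasurableCharacteristic.limitMean_const_sub {p C : ℝ} (h0 : 0 ≤ p) (h1 : p ≤ 1)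
    {φ : Offspring → ℝ → ℝ} (hφ : IsMeasurableCharacteristic φ C) :
    limitMean p (fun o t => C - φ o t) = C / (2 - p) - limitMean p φ := by
  have := isProbabilityMeasure_offspringLaw h0 h1
  have hC := hφ.const_nonneg
  have i1 : IntegrableOn (fun s => Real.exp (-(2 - p) * s) * C) (Set.Ioi 0) :=
    (integrableOn_exp_mul_Ioi (by linarith) 0).mul_const C
  have i2 : IntegrableOn (fun s => Real.exp (-(2 - p) * s) * ∫ o, φ o s ∂(offspringLaw p))
      (Set.Ioi 0) := by
    refine i1.mono' ?_ ?_
    · refine ((Measurable.mul (by fun_prop) ?_).aestronglyMeasurable)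
      exact (StronglyMeasurable.integral_prod_right (f := fun s o => φ o s)
        (hφ.measurable.comp measurable_swap).stronglyMeasurable).measurable
    · filter_upwards [ae_restrict_mem measurableSet_Ioi] with s hs
      have hs' : 0 ≤ s := le_of_lt hs
      have h2 : 0 ≤ ∫ o, φ o s ∂(offspringLaw p) := integral_nonneg fun o => hφ.nonneg o s hs'
      rw [Real.norm_of_nonneg (mul_nonneg (Real.exp_pos _).le h2)]
      refine mul_le_mul_of_nonneg_left ?_ (Real.exp_pos _).le
      calc _ ≤ ∫ _, C ∂(offspringLaw p) :=
            integral_mono (hφ.integrable h0 h1 hs') (integrable_const C) fun o => hφ.le o s hs'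
        _ = C := by simp
  have e := limitMean_const h0 h1 C
  rw [← e, limitMean, limitMean, limitMean, ← integral_sub]
  · refine setIntegral_congr_fun measurableSet_Ioi fun s hs => ?_
    have hs' : 0 ≤ s := le_of_lt hs
    rw [integral_sub (integrable_const C) (hφ.integrable h0 h1 hs'), mul_sub]
  · simp only [integral_const, probReal_univ, one_smul]
    exact i1
  · exact i2

theorem IsBoundedCharacteristic.exists_isMeasurableCharacteristic {p : ℝ} {φ : Offspring → ℝ → ℝ}
    (hφ : IsBoundedCharacteristic p φ) : ∃ C, IsMeasurableCharacteristic φ C :=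
  hφ.bounded.imp fun _ hC => ⟨hφ.measurable, hφ.nonneg, hC⟩

variable {Ω : Type*} [MeasurableSpace Ω] {μ : Measure Ω} [IsProbabilityMeasure μ] {p : ℝ}
  {ξ : Vertex → Ω → Offspring}

/-- Only an upper bound comes from the windows. The lower bound is the upper bound for C - φ,
subtracted from C times the population, whose limit is already known. -/
theorem IsBranchingProcess.ae_tendsto_countedProcess (hξ : IsBranchingProcess μ p ξ)
    (hp : 0 < p) (hp1 : p < 1) {R : Ω → ℝ}
    (hR : ∀ k : ℕ, 0 < k → ∀ᵐ ω ∂μ,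
      Tendsto (fun n : ℕ => reproAt p (fun v => ξ v ω) (n / k)) atTop (𝓝 (R ω)))
    {φ : Offspring → ℝ → ℝ} (hφ : IsBoundedCharacteristic p φ) :
    ∀ᵐ ω ∂μ, Tendsto (fun t : ℝ => Real.exp (-(2 - p) * t) *
      countedProcess φ (fun v => ξ v ω) t) atTop (𝓝 (limitMean p φ * R ω)) := by
  obtain ⟨C, hm⟩ := hφ.exists_isMeasurableCharacteristic
  have hr' : ∀ᵐ o ∂(offspringLaw p), ∀ t, 0 ≤ t →
      ContinuousWithinAt (fun t => C - φ o t) (Set.Ici t) t := by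
    filter_upwards [hφ.rightContinuous] with o ho t ht using continuousWithinAt_const.sub (ho t ht)
  have hN : ∀ᵐ ω ∂μ, ∀ k : ℕ, 0 < k → Tendsto (fun n : ℕ => Real.exp (-(2 - p) * (n / k)) *
      ((population (fun v => ξ v ω) (n / k)).ncard : ℝ)) atTop (𝓝 (R ω / (2 - p))) :=
    ae_all_iff.2 fun k => eventually_imp_distrib_left.2 fun hk =>
      hξ.ae_tendsto_population_lattice hp hp1 hk (hR k hk)
  have hZ : ∀ {ψ : Offspring → ℝ → ℝ}, IsMeasurableCharacteristic ψ C → ∀ᵐ ω ∂μ, ∀ k : ℕ, 0 < k →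
      Tendsto (fun n : ℕ => Real.exp (-(2 - p) * (n / k)) *
        countedProcess (upperChar ψ k) (fun v => ξ v ω) (n / k)) atTop
        (𝓝 (limitMean p (upperChar ψ k) * R ω)) := fun hψ =>
    ae_all_iff.2 fun k => eventually_imp_distrib_left.2 fun hk =>
      hξ.ae_tendsto_countedProcess_lattice hp hp1 (hψ.upperChar hk) hk (hR k hk)
  filter_upwards [hξ.ae_isGood hp hp1.le, hN, hZ hm, hZ hm.const_sub,
    hξ.ae_forall_vertex hφ.rightContinuous, hξ.ae_forall_vertex hr'] with ω hx hN h1 h2 r1 r2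
  have hT := (hx.tendsto_population (by linarith) hN).const_mul C
  refine tendsto_order.2 ⟨fun a ha => ?_, fun b hb => ?_⟩
  · have hc : limitMean p (fun o t => C - φ o t) * R ω = C * (R ω / (2 - p)) - limitMean p φ * R ω := by
      rw [hm.limitMean_const_sub hp.le hp1.le]; ring
    -- The gap below the limit is shared: the part above a' serves the upper bound for C - φ, and a'
    -- - a the convergence of the population.
    obtain ⟨a', ha1, ha2⟩ := exists_between ha
    have hlt : limitMean p (fun o t => C - φ o t) * R ω < C * (R ω / (2 - p)) - a' := by
      rw [hc]; linarith
    filter_upwards [hm.const_sub.eventually_countedProcess_lt hx (by linarith) r2 hN h2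
      ((hm.const_sub.tendsto_limitMean_upperChar hp.le hp1.le hr').mul_const _) hlt,
      hT.eventually_const_lt (show C * (R ω / (2 - p)) - (a' - a) < C * (R ω / (2 - p)) by linarith)]
      with t h3 h4
    rw [hx.countedProcess_const_sub] at h3
    linarith
  · exact hm.eventually_countedProcess_lt hx (by linarith) r1 hN h1
      ((hm.tendsto_limitMean_upperChar hp.le hp1.le hφ.rightContinuous).mul_const _) hb

end

end SuperstarBP

end

/-! ### Assembly of the three limits -/

theorem mainTheorem6 {Ω : Type*} [MeasurableSpace Ω] (μ : Measure Ω) [IsProbabilityMeasure μ]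
    (p : ℝ) (hp0 : 0 < p) (hp1 : p < 1)
    (ξ : SuperstarBP.Vertex → Ω → SuperstarBP.Offspring)
    (hξ : SuperstarBP.IsBranchingProcess μ p ξ) :
    (∀ᵐ ω ∂μ, SuperstarBP.IsRegular p (fun v => ξ v ω)) ∧
    ∃ Rinf : Ω → ℝ, Measurable Rinf ∧
      (∀ᵐ ω ∂μ, Tendsto (fun m : ℕ => SuperstarBP.reproductionMartingale p (fun v => ξ v ω) m)
        atTop (𝓝 (Rinf ω))) ∧
      (∀ φ : SuperstarBP.Offspring → ℝ → ℝ, SuperstarBP.IsBoundedCharacteristic p φ →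
        ∀ᵐ ω ∂μ, Tendsto
          (fun t : ℝ => Real.exp (-(2 - p) * t) *
            SuperstarBP.countedProcess φ (fun v => ξ v ω) t)
          atTop (𝓝 (SuperstarBP.limitMean p φ * Rinf ω))) ∧
      (∀ᵐ ω ∂μ, Tendsto (fun t : ℝ => SuperstarBP.sizeMartingale p (fun v => ξ v ω) t)
        atTop (𝓝 (Rinf ω))) := by
  obtain ⟨R, hRm, hR⟩ := hξ.exists_tendsto_reproAt hp0 hp1
  refine ⟨hξ.ae_isRegular hp0 hp1.le, R, hRm, ?_,
    fun φ hφ => hξ.ae_tendsto_countedProcess hp0 hp1 hR hφ, ?_⟩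
  · filter_upwards [hξ.ae_isGood hp0 hp1.le,
      ae_all_iff.2 fun k => eventually_imp_distrib_left.2 (hR k),
      ae_all_iff.2 fun k : ℕ => eventually_imp_distrib_left.2 fun hk : 0 < k =>
        hξ.ae_tendsto_population_lattice hp0 hp1 hk (hR k hk)] with ω hx h1 h2
    exact hx.tendsto_reproductionMartingale (hx.tendsto_reproAt (by linarith) h1 h2)
  · filter_upwards [hξ.ae_isGood hp0 hp1.le,
      ae_all_iff.2 fun k : ℕ => eventually_imp_distrib_left.2 fun hk : 0 < k =>
        hξ.ae_tendsto_sizeMartingale_lattice hp0 hp1 hk (hR k hk)] with ω hx h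
    exact hx.tendsto_sizeMartingale (by linarith) h
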